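/- Let $\pi:\mathbb C\to\mathbb C/\mathbb Z$ be the quotient map, $s$ the coordinate of $\mathbb C$, and for an open set $V\subset\mathbb C/\mathbb Z$ write $\mathcal O(V)=(\pi_*\mathcal O^{an}_{\mathbb C})(V)$ for the ring of holomorphic functions on $\pi^{-1}(V)$. Let $\mathcal C^{<0}(V)$ (the sections over $V$ of $(q_2\circ\pi)_*\mathcal C^{<0}_{\mathbb P^1\times\mathbb C}$) be the space of functions $f(t,s)$ on $\mathbb P^1\times\pi^{-1}(V)$ that are $C^\infty$, holomorphic in $s$, and flat (all derivatives vanish) along $\{0,\infty\}\times\pi^{-1}(V)$. Let $\mathrm D=\mathbb C[t,t^{-1}]\langle t\partial_t\rangle$ act on $\mathcal C^{<0}$ by letting $t$ act by multiplication by $t$ and $t\partial_t$ act by $t\frac{\partial}{\partial t}-s-1$, and let $\tau$ be the translation $s\mapsto s+1$. Put $$\mathcal T=\frac{\mathcal O[[t]][\frac1t]}{\mathcal O[\frac1t]}\ \oplus\ \frac{\mathcal O[[\frac1t]][t]}{(t)\,\mathcal O[t]} .$$ An element of $\mathcal T$ has a unique representative $(a,b)$ with $a=\sum_{k\ge1}a_kt^k$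 and $b=\sum_{k\ge0}b_kt^{-k}$; identify it with the bi-infinite formal series $a-b$ in $t$. Through this identification $\mathcal T$ is a sheaf of $\mathrm D$-modules: $t$ acts by multiplication by $t$ and $t\partial_t$ by $t\frac{\partial}{\partial t}-s-1$ (in other words, one acts on both representatives and then normalizes by subtracting the same Laurent polynomial from both); $\tau$ acts on coefficients. For a section $f$ of $\mathcal C^{<0}$ and $K(t)=\frac{-1}{2i\pi(t-1)}$ let $$(K*f)(t,s)=\int_{\mathbb C^*}f(\xi,s)\,K\!\left(\tfrac{\xi}{t}\right)\frac{d\xi}{\xi}\wedge\frac{d\bar\xi}{\bar\xi}=\frac1{2i\pi}\int_{\mathbb C^*}f(\xi,s)\frac{1}{1-\frac{\xi}{t}}\,\frac{d\xi}{\xi}\wedge\frac{d\bar\xi}{\bar\xi}.$$ Then this integral converges absolutely for all $t\in\mathbb C^*$ and all $s$; $K*f$ has asymptotic expansions at $t=0$ in $\mathcal O[[t]][\frac1t]$ and at $t=\infty$ in $\mathcal O[[\frac1t]][t]$, uniformly for $s$ in compact sets; and the map $\varepsilon:\mathcal C^{<0}\to\mathcal T$ sending $f$ to the classes of these two expansions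 is a morphism of sheaves of $\mathrm D$-modules. The operator $\partial_{\bar t}$ and multiplication by $\bar t$ are $\mathrm D$-linear endomorphisms of $\mathcal C^{<0}$, and the sequences of sheaves of $\mathrm D$-modules on $\mathbb C/\mathbb Z$ $$0\to\mathcal C^{<0}\xrightarrow{\ \bar t\,\partial_{\bar t}\ }\mathcal C^{<0}\xrightarrow{\ \varepsilon\ }\mathcal T\to0 \qquad\text{and}\qquad 0\to\mathcal C^{<0}\xrightarrow{\ \partial_{\bar t}\ }\mathcal C^{<0}\xrightarrow{\ \varepsilon'\ }\mathcal T\to0$$ are exact, where $\varepsilon'(f)=\varepsilon(\bar t f)$, i.e. $\varepsilon'(f)$ is given by the asymptotic expansions of $\frac1{2i\pi}\int_{\mathbb C^*}f(\xi,s)\frac{1}{1-\xi/t}\frac{d\xi}{\xi}\wedge d\bar\xi$. Moreover $\varepsilon\circ(\tau t^{-1}-1)=(\tau t^{-1}-1)\circ\varepsilon$ and $\varepsilon'\circ(\tau t^{-1}-1)=(\tau t^{-1}-1)\circ\varepsilon'$. -/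

import Mathlib

namespace MellinDA

open scoped ContDiff Topology
open Set TopologicalSpace

/-- Flatness along `{0} × U`: the function `h` is `C^∞` on `ℂ × U` and all its partial derivatives
(of every order, including `0`) vanish at the points of `{0} × U`. -/
def FlatOn {E : Type} [NormedAddCommGroup E] [NormedSpace ℝ E] (U : Set ℂ) (h : ℂ × ℂ → E) : Prop :=
  ContDiffOn ℝ ∞ h (univ ×ˢ U) ∧ ∀ s ∈ U, ∀ n : ℕ, iteratedFDeriv ℝ n h (0, s) = 0

section flat
variable {E F : Type} [NormedAddCommGroup E] [NormedSpace ℝ E]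
  [NormedAddCommGroup F] [NormedSpace ℝ F] {U : Set ℂ} {h k : ℂ × ℂ → E}

theorem isOpen_slab (hU : IsOpen U) : IsOpen ((univ : Set ℂ) ×ˢ U) := isOpen_univ.prod hU

theorem mem_slab {t s : ℂ} (hs : s ∈ U) : (t, s) ∈ (univ : Set ℂ) ×ˢ U := ⟨mem_univ _, hs⟩

theorem FlatOn.contDiffAt (hf : FlatOn U h) (hU : IsOpen U) {t s : ℂ} (hs : s ∈ U) :
    ContDiffAt ℝ ∞ h (t, s) :=
  hf.1.contDiffAt ((isOpen_slab hU).mem_nhds (mem_slab hs))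

theorem FlatOn.differentiableAt (hf : FlatOn U h) (hU : IsOpen U) {t s : ℂ} (hs : s ∈ U) :
    DifferentiableAt ℝ h (t, s) :=
  (hf.contDiffAt hU hs).differentiableAt (by simp)

theorem FlatOn.eq_zero (hf : FlatOn U h) {s : ℂ} (hs : s ∈ U) : h (0, s) = 0 := by
  have := hf.2 s hs 0
  rw [← norm_eq_zero, norm_iteratedFDeriv_zero, norm_eq_zero] at this
  exact this

theorem FlatOn.congr (hf : FlatOn U h) (hU : IsOpen U) (e : ∀ t, ∀ s ∈ U, k (t, s) = h (t, s)) :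
    FlatOn U k := by
  refine ⟨hf.1.congr fun p hp => e p.1 p.2 hp.2, fun s hs n => ?_⟩
  rw [← hf.2 s hs n]
  refine (Filter.EventuallyEq.iteratedFDeriv (𝕜 := ℝ) ?_ n).eq_of_nhds
  filter_upwards [(isOpen_slab hU).mem_nhds (mem_slab (t := 0) hs)] with p hp
  exact e p.1 p.2 hp.2

theorem FlatOn.mono {U' : Set ℂ} (hf : FlatOn U h) (hUU : U' ⊆ U) : FlatOn U' h :=
  ⟨hf.1.mono (prod_mono_right hUU), fun s hs => hf.2 s (hUU hs)⟩

theorem FlatOn.zero : FlatOn U (fun _ => (0 : E)) :=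
  ⟨contDiffOn_const, fun s _ n => by
    simp⟩

theorem FlatOn.add (hU : IsOpen U) (hf : FlatOn U h) (hk : FlatOn U k) :
    FlatOn U (fun p => h p + k p) := by
  refine ⟨hf.1.add hk.1, fun s hs n => ?_⟩
  have := fun_iteratedFDeriv_add_apply (𝕜 := ℝ) (i := n) (f := h) (g := k) (x := ((0 : ℂ), s))
    ((hf.contDiffAt hU hs).of_le (by exact_mod_cast le_top))
    ((hk.contDiffAt hU hs).of_le (by exact_mod_cast le_top))
  rw [this, hf.2 s hs, hk.2 s hs, add_zero]

theorem FlatOn.clm (hU : IsOpen U) (hf : FlatOn U h) (L : E →L[ℝ] F) :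
    FlatOn U (fun p => L (h p)) := by
  refine ⟨L.contDiff.comp_contDiffOn hf.1, fun s hs n => ?_⟩
  have := L.iteratedFDeriv_comp_left (i := n) (hf.contDiffAt hU (t := 0) hs)
    (by exact_mod_cast le_top)
  have e : (fun p => L (h p)) = L ∘ h := rfl
  rw [e, this, hf.2 s hs]
  ext; simp

theorem FlatOn.fderiv (hU : IsOpen U) (hf : FlatOn U h) : FlatOn U (fderiv ℝ h) := by
  refine ⟨hf.1.fderiv_of_isOpen (isOpen_slab hU) (by simp), fun s hs n => ?_⟩
  rw [← norm_eq_zero, norm_iteratedFDeriv_fderiv, hf.2 s hs, norm_zero]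

theorem FlatOn.smul (hU : IsOpen U) (hf : FlatOn U h) [NormedSpace ℂ E]
    {c : ℂ × ℂ → ℂ} (hc : ContDiffOn ℝ ∞ c (univ ×ˢ U)) : FlatOn U (fun p => c p • h p) := by
  refine ⟨hc.smul hf.1, fun s hs n => ?_⟩
  have ho := isOpen_slab hU
  have hm : ((0 : ℂ), s) ∈ (univ : Set ℂ) ×ˢ U := mem_slab hs
  rw [← norm_le_zero_iff, ← iteratedFDerivWithin_of_isOpen n ho hm]
  refine (norm_iteratedFDerivWithin_smul_le hc hf.1 ho.uniqueDiffOn hm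
    (by exact_mod_cast le_top)).trans (le_of_eq (Finset.sum_eq_zero fun i _ => ?_))
  rw [iteratedFDerivWithin_of_isOpen (n - i) ho hm, hf.2 s hs]
  simp

theorem FlatOn.translate (hf : FlatOn U h) (c : ℂ) (hc : ∀ s ∈ U, s + c ∈ U) :
    FlatOn U (fun p => h (p.1, p.2 + c)) := by
  have e : (fun p : ℂ × ℂ => h (p.1, p.2 + c)) = fun p => h (p + (0, c)) := by
    funext p; congr 1; ext <;> simp
  rw [e]
  refine ⟨hf.1.comp (by fun_prop) fun p hp => ⟨mem_univ _, hc _ hp.2⟩, fun s hs n => ?_⟩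
  rw [iteratedFDeriv_comp_add_right]
  simpa using hf.2 _ (hc s hs) n

theorem FlatOn.bound (hU : IsOpen U) (N : ℕ) : ∀ (E : Type) [NormedAddCommGroup E] [NormedSpace ℝ E]
    (h : ℂ × ℂ → E), FlatOn U h → ∀ s ∈ U, ∃ C : ℝ, 0 ≤ C ∧
    ∀ᶠ p : ℂ × ℂ in 𝓝 (0, s), ‖h p‖ ≤ C * ‖p.1‖ ^ N := by
  induction N with
  | zero =>
    intro E _ _ h hf s hs
    refine ⟨1, zero_le_one, ?_⟩
    have hc : Filter.Tendsto (fun p => ‖h p‖) (𝓝 (0, s)) (𝓝 0) := by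
      have := (hf.contDiffAt hU (t := 0) hs).continuousAt.norm
      rw [ContinuousAt, hf.eq_zero hs, norm_zero] at this
      exact this
    filter_upwards [hc.eventually (gt_mem_nhds zero_lt_one)] with p hp
    simpa using hp.le
  | succ N ih =>
    intro E _ _ h hf s hs
    obtain ⟨C, hC0, hC⟩ := ih _ _ (hf.fderiv hU) s hs
    refine ⟨C, hC0, ?_⟩
    have hslab := (isOpen_slab hU).mem_nhds (mem_slab (t := 0) hs)
    obtain ⟨r, hr, hball⟩ := Metric.eventually_nhds_iff_ball.1 (hC.and hslab)
    filter_upwards [Metric.ball_mem_nhds _ hr] with p hp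
    have hp0 : ((0 : ℂ), p.2) ∈ Metric.ball ((0 : ℂ), s) r := by
      rw [Metric.mem_ball, Prod.dist_eq] at hp ⊢
      exact lt_of_le_of_lt (max_le_max (by simp) le_rfl) hp
    have hsub : segment ℝ ((0 : ℂ), p.2) p ⊆ Metric.ball ((0 : ℂ), s) r :=
      (convex_ball _ _).segment_subset hp0 hp
    have hz : h (0, p.2) = 0 := hf.eq_zero ((hball _ hp0).2.2)
    have key := Convex.norm_image_sub_le_of_norm_hasFDerivWithin_le (𝕜 := ℝ)
      (f := h) (f' := fun q => _root_.fderiv ℝ h q) (s := segment ℝ ((0 : ℂ), p.2) p)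
      (C := C * ‖p.1‖ ^ N) (x := ((0 : ℂ), p.2)) (y := p)
      (fun q hq => by
        have h2 := (hball _ (hsub hq)).2.2
        exact (hf.differentiableAt hU (t := q.1) h2).hasFDerivAt.hasFDerivWithinAt)
      (fun q hq => by
        refine ((hball _ (hsub hq)).1).trans ?_
        gcongr
        obtain ⟨a, b, ha, hb, hab, rfl⟩ := hq
        simp only [Prod.fst_add, Prod.smul_fst, smul_zero, zero_add, norm_smul, Real.norm_eq_abs,
          abs_of_nonneg hb]
        exact mul_le_of_le_one_left (norm_nonneg _) (by linarith))
      (convex_segment _ _) (left_mem_segment _ _ _) (right_mem_segment _ _ _)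
    rw [hz, sub_zero] at key
    refine key.trans (le_of_eq ?_)
    have : p - ((0 : ℂ), p.2) = (p.1, 0) := by ext <;> simp
    rw [this, Prod.norm_mk, norm_zero, max_eq_left (norm_nonneg _)]
    ring

/-- the real linear map `e ↦ (v ↦ - j v.1 e)` -/
noncomputable def divAux (E : Type) [NormedAddCommGroup E] [NormedSpace ℂ E] (j : ℕ) :
    E →L[ℝ] (ℂ × ℂ →L[ℝ] E) :=
  ((ContinuousLinearMap.compL ℝ (ℂ × ℂ) ℂ E).flip (ContinuousLinearMap.fst ℝ ℂ ℂ)).comp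
    ((-(j : ℝ)) • (ContinuousLinearMap.lsmul ℝ ℂ : ℂ →L[ℝ] E →L[ℝ] E).flip)

theorem divAux_apply (E : Type) [NormedAddCommGroup E] [NormedSpace ℂ E] (j : ℕ) (e : E)
    (v : ℂ × ℂ) : divAux E j e v = -((j : ℂ) * v.1) • e := by
  simp only [divAux, ContinuousLinearMap.comp_apply, ContinuousLinearMap.flip_apply,
    ContinuousLinearMap.compL_apply, smul_apply,
    ContinuousLinearMap.coe_fst', mul_smul, neg_smul]
  rw [← Complex.coe_smul]; norm_cast

theorem FlatOn.hasFDerivAt_div (hU : IsOpen U) {E : Type} [NormedAddCommGroup E] [NormedSpace ℂ E]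
    {h : ℂ × ℂ → E} (hf : FlatOn U h) (j : ℕ) {t s : ℂ} (hs : s ∈ U) :
    HasFDerivAt (𝕜 := ℝ) (fun p : ℂ × ℂ => (p.1⁻¹) ^ j • h p)
      ((t⁻¹) ^ j • _root_.fderiv ℝ h (t, s) + (t⁻¹) ^ (j + 1) • divAux E j (h (t, s))) (t, s) := by
  by_cases ht : t = 0
  · subst ht
    obtain ⟨C, hC0, hC⟩ := FlatOn.bound hU (j + 2) E h hf s hs
    have hz : _root_.fderiv ℝ h (0, s) = 0 := (hf.fderiv hU).eq_zero hs
    rw [hz, hf.eq_zero hs, map_zero, smul_zero, smul_zero, add_zero]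
    rw [hasFDerivAt_iff_isLittleO]
    simp only [hf.eq_zero hs, smul_zero, sub_zero, zero_apply]
    have h1 : (fun p : ℂ × ℂ => (p.1⁻¹) ^ j • h p) =O[𝓝 ((0 : ℂ), s)] fun p => ‖p - (0, s)‖ ^ 2 := by
      refine Asymptotics.IsBigO.of_bound C ?_
      filter_upwards [hC] with p hp
      rw [norm_smul, norm_pow, norm_inv]
      have h2 : ‖p.1‖ ≤ ‖p - ((0 : ℂ), s)‖ := by
        simpa using norm_fst_le (p - ((0 : ℂ), s))
      have h3 : (‖p.1‖⁻¹) ^ j * ‖h p‖ ≤ C * ‖p.1‖ ^ 2 := by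
        by_cases h0 : ‖p.1‖ = 0
        · have : ‖h p‖ = 0 := by
            have := hp; rw [h0] at this; simp at this; simp [this]
          rw [this, mul_zero]; positivity
        · calc _ ≤ (‖p.1‖⁻¹) ^ j * (C * ‖p.1‖ ^ (j + 2)) := by gcongr
            _ = C * ‖p.1‖ ^ 2 := by rw [inv_pow, pow_add]; field_simp
      refine h3.trans ?_
      rw [Real.norm_of_nonneg (by positivity)]
      gcongr
    refine h1.trans_isLittleO ?_
    have h4 : (fun p : ℂ × ℂ => ‖p - ((0 : ℂ), s)‖ ^ 2) =o[𝓝 ((0 : ℂ), s)] fun p => ‖p - ((0 : ℂ), s)‖ ^ 1 :=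
      (Asymptotics.isLittleO_pow_pow (𝕜 := ℝ) one_lt_two).comp_tendsto (by
        have : Filter.Tendsto (fun p : ℂ × ℂ => ‖p - ((0 : ℂ), s)‖) (𝓝 ((0 : ℂ), s)) (𝓝 ‖((0 : ℂ), s) - ((0 : ℂ), s)‖) :=
          (continuous_id.sub continuous_const).norm.tendsto _
        simpa using this)
    simp only [pow_one] at h4
    exact h4.of_norm_right
  · have h1 : HasDerivAt (fun z : ℂ => (z⁻¹) ^ j) (-(j : ℂ) * (t⁻¹) ^ (j + 1)) t := by
      have := (hasDerivAt_inv ht).pow j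
      refine this.congr_deriv ?_
      rcases j with _ | j
      · simp
      · simp only [Nat.add_sub_cancel]
        rw [pow_succ (t⁻¹) (j + 1), pow_succ (t⁻¹) j]; push_cast; field_simp
    have h2 : HasFDerivAt (𝕜 := ℝ) (fun p : ℂ × ℂ => (p.1⁻¹) ^ j) _ (t, s) :=
      HasFDerivAt.comp (g := fun z : ℂ => (z⁻¹) ^ j) (f := Prod.fst) (t, s)
        (h1.hasFDerivAt.restrictScalars ℝ)
        (hasFDerivAt_fst (𝕜 := ℝ) (E := ℂ) (F := ℂ) (p := (t, s)))
    refine (h2.smul (hf.differentiableAt hU hs).hasFDerivAt).congr_fderiv ?_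
    ext v
    · simp only [ContinuousLinearMap.comp_apply, ContinuousLinearMap.inl_apply, add_apply,
        smul_apply, divAux_apply, smul_smul]
      simp
      ring_nf
    · simp [divAux_apply]

theorem FlatOn.contDiffOn_div (hU : IsOpen U) (n : ℕ) : ∀ (E : Type) [NormedAddCommGroup E]
    [NormedSpace ℂ E] (h : ℂ × ℂ → E) (j : ℕ), FlatOn U h →
    ContDiffOn ℝ n (fun p : ℂ × ℂ => (p.1⁻¹) ^ j • h p) (univ ×ˢ U) := by
  induction n with
  | zero =>
    intro E _ _ h j hf
    rw [Nat.cast_zero, contDiffOn_zero]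
    exact fun p hp => (hf.hasFDerivAt_div hU j (t := p.1) hp.2).continuousAt.continuousWithinAt
  | succ n ih =>
    intro E _ _ h j hf
    push_cast
    rw [contDiffOn_succ_iff_fderiv_of_isOpen (isOpen_slab hU)]
    refine ⟨fun p hp =>
      (hf.hasFDerivAt_div hU j (t := p.1) hp.2).differentiableAt.differentiableWithinAt,
      by simp, ?_⟩
    refine ((ih _ _ j (hf.fderiv hU)).add (ih _ _ (j + 1) (hf.clm hU (divAux E j)))).congr ?_
    intro p hp
    exact (hf.hasFDerivAt_div hU j (t := p.1) hp.2).fderiv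

theorem FlatOn.iter_div (hU : IsOpen U) (n : ℕ) : ∀ (E : Type) [NormedAddCommGroup E]
    [NormedSpace ℂ E] (h : ℂ × ℂ → E) (j : ℕ), FlatOn U h → ∀ s ∈ U,
    iteratedFDeriv ℝ n (fun p : ℂ × ℂ => (p.1⁻¹) ^ j • h p) (0, s) = 0 := by
  induction n with
  | zero =>
    intro E _ _ h j hf s hs
    rw [← norm_eq_zero, norm_iteratedFDeriv_zero, hf.eq_zero hs, smul_zero, norm_zero]
  | succ n ih =>
    intro E _ _ h j hf s hs
    rw [← norm_eq_zero, ← norm_iteratedFDeriv_fderiv, norm_eq_zero]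
    have e : _root_.fderiv ℝ (fun p : ℂ × ℂ => (p.1⁻¹) ^ j • h p) =ᶠ[𝓝 (0, s)]
        fun p => (p.1⁻¹) ^ j • _root_.fderiv ℝ h p + (p.1⁻¹) ^ (j + 1) • divAux E j (h p) := by
      filter_upwards [(isOpen_slab hU).mem_nhds (mem_slab (t := 0) hs)] with p hp
      exact (hf.hasFDerivAt_div hU j (t := p.1) hp.2).fderiv
    rw [(e.iteratedFDeriv (𝕜 := ℝ) n).eq_of_nhds]
    have h1 := FlatOn.contDiffOn_div hU n _ _ j (hf.fderiv hU)
    have h2 := FlatOn.contDiffOn_div hU n _ _ (j + 1) (hf.clm hU (divAux E j))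
    have hm := (isOpen_slab hU).mem_nhds (mem_slab (t := 0) hs)
    rw [fun_iteratedFDeriv_add_apply (h1.contDiffAt hm) (h2.contDiffAt hm),
      ih _ _ j (hf.fderiv hU) s hs, ih _ _ (j + 1) (hf.clm hU (divAux E j)) s hs, add_zero]

theorem FlatOn.div (hU : IsOpen U) {E : Type} [NormedAddCommGroup E] [NormedSpace ℂ E]
    {h : ℂ × ℂ → E} (hf : FlatOn U h) : FlatOn U (fun p : ℂ × ℂ => p.1⁻¹ • h p) := by
  have h1 : ContDiffOn ℝ ∞ (fun p : ℂ × ℂ => (p.1⁻¹) ^ 1 • h p) (univ ×ˢ U) :=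
    contDiffOn_infty.2 fun n => FlatOn.contDiffOn_div hU n E h 1 hf
  have h2 : ∀ s ∈ U, ∀ n, iteratedFDeriv ℝ n (fun p : ℂ × ℂ => (p.1⁻¹) ^ 1 • h p) (0, s) = 0 :=
    fun s hs n => FlatOn.iter_div hU n E h 1 hf s hs
  simp only [pow_one] at h1 h2
  exact ⟨h1, h2⟩

end flat

/-- The cylinder `ℂ/ℤ`. -/
abbrev CmodZ : Type := ℂ ⧸ AddSubgroup.zmultiples (1 : ℂ)

/-- The preimage `π⁻¹(V) ⊆ ℂ` of an open subset `V` of `ℂ/ℤ`. -/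
def fiber (V : Opens CmodZ) : Set ℂ := {s | (QuotientAddGroup.mk s : CmodZ) ∈ V}

theorem isOpen_fiber (V : Opens CmodZ) : IsOpen (fiber V) :=
  V.isOpen.preimage continuous_quotient_mk'

theorem fiber_mono {W V : Opens CmodZ} (h : W ≤ V) : fiber W ⊆ fiber V := fun _ hs => h hs

theorem add_int_mem_fiber (V : Opens CmodZ) (n : ℤ) {s : ℂ} (hs : s ∈ fiber V) :
    s + n ∈ fiber V := by
  have : (QuotientAddGroup.mk (s + n) : CmodZ) = QuotientAddGroup.mk s := by
    rw [QuotientAddGroup.eq]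
    exact ⟨-n, by simp⟩
  show (QuotientAddGroup.mk (s + n) : CmodZ) ∈ V
  rw [this]; exact hs

/-- The translation `s ↦ s + n` of `π⁻¹(V)`. -/
def shiftPt (V : Opens CmodZ) (n : ℤ) (s : fiber V) : fiber V :=
  ⟨s + n, add_int_mem_fiber V n s.2⟩

/-- Extension by zero of a function on the open set `π⁻¹(V)` to `ℂ`, a device to speak of
derivatives at the points of `π⁻¹(V)`. -/
noncomputable def extZero {V : Opens CmodZ} (g : fiber V → ℂ) : ℂ → ℂ :=
  Function.extend Subtype.val g 0

theorem extZero_coe {V : Opens CmodZ} (g : fiber V → ℂ) (s : fiber V) : extZero g s = g s :=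
  Subtype.val_injective.extend_apply g 0 s

theorem extZero_mem {V : Opens CmodZ} (g : fiber V → ℂ) {s : ℂ} (hs : s ∈ fiber V) :
    extZero g s = g ⟨s, hs⟩ := extZero_coe g ⟨s, hs⟩

/-- The ring `(π_* 𝒪)(V)` of holomorphic functions on `π⁻¹(V)`. -/
def Holo (V : Opens CmodZ) : Subalgebra ℂ (fiber V → ℂ) where
  carrier := {a | DifferentiableOn ℂ (extZero a) (fiber V)}
  mul_mem' {a b} ha hb := (ha.mul hb).congr fun s hs => by simp [extZero_mem _ hs]
  add_mem' {a b} ha hb := (ha.add hb).congr fun s hs => by simp [extZero_mem _ hs]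
  algebraMap_mem' c := (differentiableOn_const c).congr fun s hs => by
    simp [extZero_mem _ hs]

theorem mem_Holo {V : Opens CmodZ} {a : fiber V → ℂ} :
    a ∈ Holo V ↔ DifferentiableOn ℂ (extZero a) (fiber V) := Iff.rfl

theorem shift_mem_Holo {V : Opens CmodZ} {a : fiber V → ℂ} (ha : a ∈ Holo V) (n : ℤ) :
    (fun s => a (shiftPt V n s)) ∈ Holo V := by
  refine (ha.comp (f := fun s : ℂ => s + n) (by fun_prop)
    fun s hs => add_int_mem_fiber V n hs).congr fun s hs => ?_
  simp only [Function.comp]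
  rw [extZero_mem _ hs, extZero_mem _ (add_int_mem_fiber V n hs)]; rfl

theorem restrict_mem_Holo {V W : Opens CmodZ} (h : W ≤ V) {a : fiber V → ℂ} (ha : a ∈ Holo V) :
    (fun s => a (inclusion (fiber_mono h) s)) ∈ Holo W :=
  (ha.mono (fiber_mono h)).congr fun s hs => by
    rw [extZero_mem _ hs, extZero_mem _ (fiber_mono h hs)]

/-- The coordinate function `s`. -/
def holoS (V : Opens CmodZ) : Holo V :=
  ⟨fun s => s, differentiableOn_id.congr fun s hs => by simp [extZero_mem _ hs]⟩

/-- The translation `a(s) ↦ a(s + n)`. -/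
def holoShift (V : Opens CmodZ) (n : ℤ) : Holo V →ₗ[ℂ] Holo V where
  toFun a := ⟨fun s => a.1 (shiftPt V n s), shift_mem_Holo a.2 n⟩
  map_add' _ _ := rfl
  map_smul' _ _ := rfl

/-- Restriction of holomorphic functions. -/
def holoRes {V W : Opens CmodZ} (h : W ≤ V) : Holo V →ₗ[ℂ] Holo W where
  toFun a := ⟨fun s => a.1 (inclusion (fiber_mono h) s), restrict_mem_Holo h a.2⟩
  map_add' _ _ := rfl
  map_smul' _ _ := rfl

/-- The coordinate `t` of the projective line `ℙ¹ = ℂ ∪ {∞}` (value `0` at `∞`, where it is only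
ever multiplied by flat functions, which vanish there). -/
noncomputable def coord (x : OnePoint ℂ) : ℂ := x.elim 0 id

/-- The affine chart `t ↦ t` of `ℙ¹`. -/
def affChart (t : ℂ) : OnePoint ℂ := (t : OnePoint ℂ)

open Classical in
/-- The chart `u ↦ 1/u` of `ℙ¹` around `∞`. -/
noncomputable def infChart (u : ℂ) : OnePoint ℂ :=
  if u = 0 then OnePoint.infty else ((u⁻¹ : ℂ) : OnePoint ℂ)

@[simp] theorem coord_coe (t : ℂ) : coord (t : OnePoint ℂ) = t := rfl
@[simp] theorem coord_infty : coord OnePoint.infty = 0 := rfl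
@[simp] theorem coord_aff (t : ℂ) : coord (affChart t) = t := rfl
@[simp] theorem coord_inf (u : ℂ) : coord (infChart u) = u⁻¹ := by
  by_cases h : u = 0 <;> simp [infChart, h]

/-- A function on `ℙ¹ × π⁻¹(V)` read in a chart of `ℙ¹`. -/
noncomputable def inChart {V : Opens CmodZ} (φ : ℂ → OnePoint ℂ) (f : OnePoint ℂ → fiber V → ℂ) :
    ℂ × ℂ → ℂ := fun p => extZero (f (φ p.1)) p.2

theorem inChart_mem {V : Opens CmodZ} (φ : ℂ → OnePoint ℂ) (f : OnePoint ℂ → fiber V → ℂ)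
    (t : ℂ) {s : ℂ} (hs : s ∈ fiber V) : inChart φ f (t, s) = f (φ t) ⟨s, hs⟩ :=
  extZero_mem _ hs

/-- Sections over `V ⊆ ℂ/ℤ` of `(q₂ ∘ π)_* 𝒞^{<0}`: functions on `ℙ¹ × π⁻¹(V)` which are `C^∞`,
holomorphic in `s`, and flat along `{0, ∞} × π⁻¹(V)`. Smoothness and flatness are expressed in the
two standard charts of `ℙ¹`, the points `0` and `∞` being the origins of these charts. -/
def Cflat (V : Opens CmodZ) : Submodule ℂ (OnePoint ℂ → fiber V → ℂ) where
  carrier := {f | FlatOn (fiber V) (inChart affChart f) ∧ FlatOn (fiber V) (inChart infChart f) ∧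
    ∀ x, f x ∈ Holo V}
  add_mem' {f g} hf hg := ⟨
    (hf.1.add (isOpen_fiber V) hg.1).congr (isOpen_fiber V) fun t s hs => by
      simp [inChart_mem _ _ _ hs],
    (hf.2.1.add (isOpen_fiber V) hg.2.1).congr (isOpen_fiber V) fun t s hs => by
      simp [inChart_mem _ _ _ hs],
    fun x => (Holo V).add_mem (hf.2.2 x) (hg.2.2 x)⟩
  zero_mem' := ⟨FlatOn.zero.congr (isOpen_fiber V) fun t s hs => by simp [inChart_mem _ _ _ hs],
    FlatOn.zero.congr (isOpen_fiber V) fun t s hs => by simp [inChart_mem _ _ _ hs],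
    fun x => (Holo V).zero_mem⟩
  smul_mem' c f hf := ⟨
    (hf.1.smul (isOpen_fiber V) (contDiffOn_const (c := c))).congr (isOpen_fiber V)
      fun t s hs => by simp [inChart_mem _ _ _ hs],
    (hf.2.1.smul (isOpen_fiber V) (contDiffOn_const (c := c))).congr (isOpen_fiber V)
      fun t s hs => by simp [inChart_mem _ _ _ hs],
    fun x => (Holo V).smul_mem (hf.2.2 x) c⟩

section ops
variable {V : Opens CmodZ} {f : OnePoint ℂ → fiber V → ℂ}

theorem Cflat_infty (hf : f ∈ Cflat V) (s : fiber V) : f OnePoint.infty s = 0 := by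
  have := hf.2.1.eq_zero s.2
  rwa [inChart_mem _ _ _ s.2, infChart, if_pos rfl] at this

theorem Cflat_zero (hf : f ∈ Cflat V) (s : fiber V) : f ((0 : ℂ) : OnePoint ℂ) s = 0 := by
  have := hf.1.eq_zero s.2
  rwa [inChart_mem _ _ _ s.2] at this

theorem mulT_mem (hf : f ∈ Cflat V) : (fun x s => coord x * f x s) ∈ Cflat V := ⟨
  (hf.1.smul (isOpen_fiber V) (c := fun p => p.1) contDiffOn_fst).congr (isOpen_fiber V)
    fun t s hs => by simp [inChart_mem _ _ _ hs],
  (hf.2.1.div (isOpen_fiber V)).congr (isOpen_fiber V)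
    fun t s hs => by simp [inChart_mem _ _ _ hs],
  fun x => (Holo V).smul_mem (hf.2.2 x) (coord x)⟩

theorem mulTinv_mem (hf : f ∈ Cflat V) : (fun x s => (coord x)⁻¹ * f x s) ∈ Cflat V := ⟨
  (hf.1.div (isOpen_fiber V)).congr (isOpen_fiber V)
    fun t s hs => by simp [inChart_mem _ _ _ hs],
  (hf.2.1.smul (isOpen_fiber V) (c := fun p => p.1) contDiffOn_fst).congr (isOpen_fiber V)
    fun t s hs => by simp [inChart_mem _ _ _ hs],
  fun x => (Holo V).smul_mem (hf.2.2 x) (coord x)⁻¹⟩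

theorem conj_contDiffOn {S : Set (ℂ × ℂ)} :
    ContDiffOn ℝ ∞ (fun p : ℂ × ℂ => (starRingEnd ℂ) p.1) S :=
  ((Complex.conjCLE : ℂ →L[ℝ] ℂ).contDiff.comp contDiff_fst).contDiffOn

theorem mulTbar_mem (hf : f ∈ Cflat V) :
    (fun x s => (starRingEnd ℂ) (coord x) * f x s) ∈ Cflat V := ⟨
  (hf.1.smul (isOpen_fiber V) conj_contDiffOn).congr (isOpen_fiber V)
    fun t s hs => by simp [inChart_mem _ _ _ hs],
  (((hf.2.1.clm (isOpen_fiber V) (Complex.conjCLE : ℂ →L[ℝ] ℂ)).div (isOpen_fiber V)).clm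
    (isOpen_fiber V) (Complex.conjCLE : ℂ →L[ℝ] ℂ)).congr (isOpen_fiber V)
    fun t s hs => by simp [inChart_mem _ _ _ hs],
  fun x => (Holo V).smul_mem (hf.2.2 x) ((starRingEnd ℂ) (coord x))⟩

theorem mulS_mem (hf : f ∈ Cflat V) : (fun x (s : fiber V) => (s : ℂ) * f x s) ∈ Cflat V := ⟨
  (hf.1.smul (isOpen_fiber V) (c := fun p => p.2) contDiffOn_snd).congr (isOpen_fiber V)
    fun t s hs => by simp [inChart_mem _ _ _ hs],
  (hf.2.1.smul (isOpen_fiber V) (c := fun p => p.2) contDiffOn_snd).congr (isOpen_fiber V)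
    fun t s hs => by simp [inChart_mem _ _ _ hs],
  fun x => (Holo V).mul_mem (holoS V).2 (hf.2.2 x)⟩

theorem shift_mem (hf : f ∈ Cflat V) (n : ℤ) : (fun x s => f x (shiftPt V n s)) ∈ Cflat V := ⟨
  (hf.1.translate n fun _ hs => add_int_mem_fiber V n hs).congr (isOpen_fiber V)
    fun t s hs => by
      rw [inChart_mem _ _ _ hs, inChart_mem _ _ _ (add_int_mem_fiber V n hs)]; rfl,
  (hf.2.1.translate n fun _ hs => add_int_mem_fiber V n hs).congr (isOpen_fiber V)
    fun t s hs => by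
      rw [inChart_mem _ _ _ hs, inChart_mem _ _ _ (add_int_mem_fiber V n hs)]; rfl,
  fun x => shift_mem_Holo (hf.2.2 x) n⟩

theorem restrict_mem {W : Opens CmodZ} (h : W ≤ V) (hf : f ∈ Cflat V) :
    (fun x s => f x (inclusion (fiber_mono h) s)) ∈ Cflat W := ⟨
  (hf.1.mono (fiber_mono h)).congr (isOpen_fiber W) fun t s hs => by
    rw [inChart_mem _ _ _ hs, inChart_mem _ _ _ (fiber_mono h hs)],
  (hf.2.1.mono (fiber_mono h)).congr (isOpen_fiber W) fun t s hs => by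
    rw [inChart_mem _ _ _ hs, inChart_mem _ _ _ (fiber_mono h hs)],
  fun x => restrict_mem_Holo h (hf.2.2 x)⟩

/-- `∂/∂t` of a function of one complex variable, in terms of its real differential. -/
noncomputable def wirt (L : ℂ →L[ℝ] ℂ) : ℂ := (L 1 - Complex.I * L Complex.I) / 2

/-- `∂/∂t̄` of a function of one complex variable, in terms of its real differential. -/
noncomputable def wirtBar (L : ℂ →L[ℝ] ℂ) : ℂ := (L 1 + Complex.I * L Complex.I) / 2

theorem real_lin (L : ℂ →L[ℝ] ℂ) (a : ℂ) : L a = a.re * L 1 + a.im * L Complex.I := by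
  have : a = a.re • (1 : ℂ) + a.im • Complex.I := by
    simp [Complex.re_add_im]
  conv_lhs => rw [this]
  rw [map_add, map_smul, map_smul, Complex.real_smul, Complex.real_smul]

theorem wirt_mul (L M : ℂ →L[ℝ] ℂ) (a : ℂ) (h : ∀ v, M v = L (a * v)) :
    wirt M = a * wirt L := by
  simp only [wirt, h]
  rw [mul_one, real_lin L a, real_lin L (a * Complex.I)]
  simp
  linear_combination ((a.im : ℂ) / 2 * L Complex.I) * Complex.I_sq
    + (L 1 - Complex.I * L Complex.I) / 2 * Complex.re_add_im a

theorem wirtBar_mul (L M : ℂ →L[ℝ] ℂ) (a : ℂ) (h : ∀ v, M v = L (a * v)) :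
    wirtBar M = (starRingEnd ℂ) a * wirtBar L := by
  simp only [wirtBar, h]
  rw [mul_one, real_lin L a, real_lin L (a * Complex.I)]
  have hb : (a.re : ℂ) - a.im * Complex.I = (starRingEnd ℂ) a := by
    apply Complex.ext <;> simp
  simp
  linear_combination ((a.im : ℂ) / 2 * L Complex.I) * Complex.I_sq
    + (L 1 + Complex.I * L Complex.I) / 2 * hb

/-- restriction of a real linear map on `ℂ × ℂ` to the first factor -/
noncomputable def fstPart : (ℂ × ℂ →L[ℝ] ℂ) →L[ℝ] (ℂ →L[ℝ] ℂ) :=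
  (ContinuousLinearMap.compL ℝ ℂ (ℂ × ℂ) ℂ).flip (ContinuousLinearMap.inl ℝ ℂ ℂ)

@[simp] theorem fstPart_apply (L : ℂ × ℂ →L[ℝ] ℂ) (v : ℂ) : fstPart L v = L (v, 0) := by
  simp [fstPart]

noncomputable def wirtCLM : (ℂ →L[ℝ] ℂ) →L[ℝ] ℂ :=
  (1 / 2 : ℂ) • (ContinuousLinearMap.apply ℝ ℂ (1 : ℂ)
    - Complex.I • ContinuousLinearMap.apply ℝ ℂ Complex.I)

noncomputable def wirtBarCLM : (ℂ →L[ℝ] ℂ) →L[ℝ] ℂ :=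
  (1 / 2 : ℂ) • (ContinuousLinearMap.apply ℝ ℂ (1 : ℂ)
    + Complex.I • ContinuousLinearMap.apply ℝ ℂ Complex.I)

theorem wirtCLM_apply (L : ℂ →L[ℝ] ℂ) : wirtCLM L = wirt L := by
  simp [wirtCLM, wirt]; ring

theorem wirtBarCLM_apply (L : ℂ →L[ℝ] ℂ) : wirtBarCLM L = wirtBar L := by
  simp [wirtBarCLM, wirtBar]; ring

theorem hasFDerivAt_slice {G : ℂ × ℂ → ℂ} {t s : ℂ} (h : DifferentiableAt ℝ G (t, s)) :
    HasFDerivAt (𝕜 := ℝ) (fun t' => G (t', s)) (fstPart (fderiv ℝ G (t, s))) t := by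
  have h1 : HasFDerivAt (𝕜 := ℝ) (fun t' : ℂ => (t', s)) (ContinuousLinearMap.inl ℝ ℂ ℂ) t :=
    hasFDerivAt_prodMk_left t s
  exact (h.hasFDerivAt.comp t h1).congr_fderiv (by ext; simp)

theorem hasFDerivAt_aff (hf : f ∈ Cflat V) (t : ℂ) (s : fiber V) :
    HasFDerivAt (𝕜 := ℝ) (fun t' : ℂ => f (t' : OnePoint ℂ) s)
      (fstPart (fderiv ℝ (inChart affChart f) (t, s))) t := by
  have := hasFDerivAt_slice (hf.1.differentiableAt (isOpen_fiber V) (t := t) s.2)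
  refine this.congr_of_eventuallyEq (Filter.Eventually.of_forall fun t' => ?_)
  exact (inChart_mem _ _ _ s.2).symm

theorem hasFDerivAt_inf (hf : f ∈ Cflat V) {u : ℂ} (hu : u ≠ 0) (s : fiber V) :
    HasFDerivAt (𝕜 := ℝ) (fun t' : ℂ => f (t' : OnePoint ℂ) s)
      ((fstPart (fderiv ℝ (inChart infChart f) (u, s))).comp
        ((ContinuousLinearMap.toSpanSingleton ℂ (-u ^ 2)).restrictScalars ℝ)) u⁻¹ := by
  have h1 := hasFDerivAt_slice (hf.2.1.differentiableAt (isOpen_fiber V) (t := u) s.2)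
  have h2 : HasDerivAt (fun z : ℂ => z⁻¹) (-u ^ 2) u⁻¹ := by
    have := hasDerivAt_inv (inv_ne_zero hu)
    refine this.congr_deriv (by simp)
  have h1' : HasFDerivAt (𝕜 := ℝ) (fun t' => inChart infChart f (t', s))
      (fstPart (fderiv ℝ (inChart infChart f) (u, s))) (u⁻¹)⁻¹ := by rwa [inv_inv]
  have h3 := HasFDerivAt.comp u⁻¹ h1' (h2.hasFDerivAt.restrictScalars ℝ)
  refine h3.congr_of_eventuallyEq ?_
  filter_upwards [isOpen_ne.mem_nhds (inv_ne_zero hu)] with z hz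
  simp only [Function.comp]
  rw [inChart_mem _ _ _ s.2, infChart, if_neg (inv_ne_zero hz), inv_inv]

/-- `∂f/∂t` (extended by `0` at `∞`). -/
noncomputable def dtFun (f : OnePoint ℂ → fiber V → ℂ) : OnePoint ℂ → fiber V → ℂ :=
  fun x s => x.elim 0 fun t => wirt (fderiv ℝ (fun t' : ℂ => f (t' : OnePoint ℂ) s) t)

/-- `∂f/∂t̄` (extended by `0` at `∞`). -/
noncomputable def dtbarFun (f : OnePoint ℂ → fiber V → ℂ) : OnePoint ℂ → fiber V → ℂ :=
  fun x s => x.elim 0 fun t => wirtBar (fderiv ℝ (fun t' : ℂ => f (t' : OnePoint ℂ) s) t)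

theorem dtFun_inf (hf : f ∈ Cflat V) (u : ℂ) (s : fiber V) : dtFun f (infChart u) s =
    -u ^ 2 * wirt (fstPart (fderiv ℝ (inChart infChart f) (u, s))) := by
  by_cases hu : u = 0
  · simp [infChart, hu, dtFun]
  · simp only [infChart, hu, if_false, dtFun, OnePoint.elim_some]
    rw [(hasFDerivAt_inf hf hu s).fderiv]
    exact wirt_mul _ _ _ fun v => by simp [mul_comm]

theorem dtbarFun_inf (hf : f ∈ Cflat V) (u : ℂ) (s : fiber V) : dtbarFun f (infChart u) s =
    (starRingEnd ℂ) (-u ^ 2) * wirtBar (fstPart (fderiv ℝ (inChart infChart f) (u, s))) := by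
  by_cases hu : u = 0
  · simp [infChart, hu, dtbarFun]
  · simp only [infChart, hu, if_false, dtbarFun, OnePoint.elim_some]
    rw [(hasFDerivAt_inf hf hu s).fderiv]
    exact wirtBar_mul _ _ _ fun v => by simp [mul_comm]

theorem holo_deriv {U : Set ℂ} (hU : IsOpen U) {G : ℂ × ℂ → ℂ} (hG : ContDiffOn ℝ ∞ G (univ ×ˢ U))
    (hol : ∀ t, DifferentiableOn ℂ (fun s => G (t, s)) U) (t v : ℂ) :
    DifferentiableOn ℂ (fun s => fderiv ℝ G (t, s) (v, 0)) U := by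
  intro s hs
  apply DifferentiableAt.differentiableWithinAt
  have hc : ∀ t', ContDiffAt ℝ ∞ G (t', s) := fun t' =>
    hG.contDiffAt ((isOpen_slab hU).mem_nhds (mem_slab hs))
  have hd : DifferentiableAt ℝ (fderiv ℝ G) (t, s) :=
    ((hc t).fderiv_right (m := 1) (by norm_cast)).differentiableAt one_ne_zero
  set D := fderiv ℝ (fderiv ℝ G) (t, s) with hD
  have h1 : HasFDerivAt (𝕜 := ℝ) (fun s' : ℂ => fderiv ℝ G (t, s') (v, 0))
      ((ContinuousLinearMap.apply ℝ ℂ ((v, 0) : ℂ × ℂ)).comp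
        (D.comp (ContinuousLinearMap.inr ℝ ℂ ℂ))) s :=
    (ContinuousLinearMap.apply ℝ ℂ ((v, 0) : ℂ × ℂ)).hasFDerivAt.comp s
      (HasFDerivAt.comp (g := fderiv ℝ G) (f := fun s' : ℂ => (t, s')) s hd.hasFDerivAt
        (hasFDerivAt_prodMk_right t s))
  have hsym : IsSymmSndFDerivAt ℝ G (t, s) := (hc t).isSymmSndFDerivAt (by
    rw [minSmoothness_of_isRCLikeNormedField]; exact WithTop.coe_le_coe.2 le_top)
  have hlin : ∀ t' w, fderiv ℝ G (t', s) (0, Complex.I * w) =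
      Complex.I * fderiv ℝ G (t', s) (0, w) := by
    intro t' w
    have h2 : HasFDerivAt (𝕜 := ℝ) (fun s' : ℂ => G (t', s'))
        ((fderiv ℝ G (t', s)).comp (ContinuousLinearMap.inr ℝ ℂ ℂ)) s :=
      HasFDerivAt.comp (g := G) (f := fun s' : ℂ => (t', s')) s
        ((hc t').differentiableAt (by simp)).hasFDerivAt (hasFDerivAt_prodMk_right t' s)
    have h3 := (((hol t').differentiableAt (hU.mem_nhds hs)).hasFDerivAt.restrictScalars ℝ)
    have h4 := h2.unique h3
    have e : ∀ w, fderiv ℝ G (t', s) (0, w) = fderiv ℂ (fun s => G (t', s)) s w := fun w => by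
      simpa using DFunLike.congr_fun h4 w
    rw [e, e, ← smul_eq_mul, map_smul, smul_eq_mul]
  have hlin2 : D (v, 0) (0, Complex.I * 1) = Complex.I * D (v, 0) (0, 1) := by
    have h5 : ∀ w, HasFDerivAt (𝕜 := ℝ) (fun t' : ℂ => fderiv ℝ G (t', s) (0, w))
      ((ContinuousLinearMap.apply ℝ ℂ ((0, w) : ℂ × ℂ)).comp
        (D.comp (ContinuousLinearMap.inl ℝ ℂ ℂ))) t := fun w =>
      (ContinuousLinearMap.apply ℝ ℂ ((0, w) : ℂ × ℂ)).hasFDerivAt.comp t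
        (HasFDerivAt.comp (g := fderiv ℝ G) (f := fun t' : ℂ => (t', s)) t hd.hasFDerivAt
          (hasFDerivAt_prodMk_left t s))
    have h6 := (h5 1).const_mul Complex.I
    have h7 := h5 (Complex.I * 1)
    simp only [hlin] at h7
    have := DFunLike.congr_fun (h7.unique h6) v
    simpa using this
  rw [differentiableAt_complex_iff_differentiableAt_real]
  refine ⟨h1.differentiableAt, ?_⟩
  rw [h1.fderiv]
  have e1 := hsym (0, Complex.I) (v, 0)
  have e2 := hsym (0, 1) (v, 0)
  simp only [ContinuousLinearMap.comp_apply, ContinuousLinearMap.inr_apply,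
    ContinuousLinearMap.apply_apply, smul_eq_mul]
  rw [← hD] at e1 e2
  rw [e1, e2]
  simpa using hlin2

theorem dt_holo (hf : f ∈ Cflat V) (t v : ℂ) :
    DifferentiableOn ℂ (fun s => fderiv ℝ (inChart affChart f) (t, s) (v, 0)) (fiber V) :=
  holo_deriv (isOpen_fiber V) hf.1.1 (fun t => (hf.2.2 (affChart t))) t v

theorem dt_mem (hf : f ∈ Cflat V) : dtFun f ∈ Cflat V := by
  refine ⟨(((hf.1.fderiv (isOpen_fiber V)).clm (isOpen_fiber V) fstPart).clm (isOpen_fiber V)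
      wirtCLM).congr (isOpen_fiber V) fun t s hs => ?_,
    (((((hf.2.1.fderiv (isOpen_fiber V)).clm (isOpen_fiber V) fstPart).clm (isOpen_fiber V)
      wirtCLM)).smul (isOpen_fiber V) (c := fun p => -p.1 ^ 2) (by fun_prop)).congr
      (isOpen_fiber V) fun t s hs => ?_, fun x => ?_⟩
  · rw [inChart_mem _ _ _ hs, wirtCLM_apply]
    exact congrArg wirt (hasFDerivAt_aff hf t ⟨s, hs⟩).fderiv
  · rw [inChart_mem _ _ _ hs, dtFun_inf hf, wirtCLM_apply]; rfl
  · induction x using OnePoint.rec with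
    | infty => exact (Holo V).zero_mem
    | coe t =>
      refine ((((dt_holo hf t 1).sub ((dt_holo hf t Complex.I).const_mul Complex.I)).div_const 2)
        ).congr fun s hs => ?_
      rw [extZero_mem _ hs]
      refine (congrArg wirt (hasFDerivAt_aff hf t ⟨s, hs⟩).fderiv).trans ?_
      simp [wirt]

theorem dtbar_mem (hf : f ∈ Cflat V) : dtbarFun f ∈ Cflat V := by
  refine ⟨(((hf.1.fderiv (isOpen_fiber V)).clm (isOpen_fiber V) fstPart).clm (isOpen_fiber V)
      wirtBarCLM).congr (isOpen_fiber V) fun t s hs => ?_,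
    (((((hf.2.1.fderiv (isOpen_fiber V)).clm (isOpen_fiber V) fstPart).clm (isOpen_fiber V)
      wirtBarCLM)).smul (isOpen_fiber V) (c := fun p => (starRingEnd ℂ) (-p.1 ^ 2)) (by
        simpa using (conj_contDiffOn.pow 2).neg)).congr
      (isOpen_fiber V) fun t s hs => ?_, fun x => ?_⟩
  · rw [inChart_mem _ _ _ hs, wirtBarCLM_apply]
    exact congrArg wirtBar (hasFDerivAt_aff hf t ⟨s, hs⟩).fderiv
  · rw [inChart_mem _ _ _ hs, dtbarFun_inf hf, wirtBarCLM_apply]; rfl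
  · induction x using OnePoint.rec with
    | infty => exact (Holo V).zero_mem
    | coe t =>
      refine ((((dt_holo hf t 1).add ((dt_holo hf t Complex.I).const_mul Complex.I)).div_const 2)
        ).congr fun s hs => ?_
      rw [extZero_mem _ hs]
      refine (congrArg wirtBar (hasFDerivAt_aff hf t ⟨s, hs⟩).fderiv).trans ?_
      simp [wirtBar]

end ops

/-- Multiplication by `t` on `(q₂ ∘ π)_* 𝒞^{<0}`. -/
noncomputable def mulT (V : Opens CmodZ) : Module.End ℂ (Cflat V) where
  toFun f := ⟨fun x s => coord x * f.1 x s, mulT_mem f.2⟩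
  map_add' f g := Subtype.ext <| by funext x s; exact mul_add _ _ _
  map_smul' c f := Subtype.ext <| by funext x s; exact mul_left_comm _ _ _

/-- Multiplication by `t⁻¹` on `(q₂ ∘ π)_* 𝒞^{<0}`. -/
noncomputable def mulTinv (V : Opens CmodZ) : Module.End ℂ (Cflat V) where
  toFun f := ⟨fun x s => (coord x)⁻¹ * f.1 x s, mulTinv_mem f.2⟩
  map_add' f g := Subtype.ext <| by funext x s; exact mul_add _ _ _
  map_smul' c f := Subtype.ext <| by funext x s; exact mul_left_comm _ _ _

/-- Multiplication by `t̄` on `(q₂ ∘ π)_* 𝒞^{<0}`. -/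
noncomputable def mulTbar (V : Opens CmodZ) : Module.End ℂ (Cflat V) where
  toFun f := ⟨fun x s => (starRingEnd ℂ) (coord x) * f.1 x s, mulTbar_mem f.2⟩
  map_add' f g := Subtype.ext <| by funext x s; exact mul_add _ _ _
  map_smul' c f := Subtype.ext <| by funext x s; exact mul_left_comm _ _ _

/-- Multiplication by `s` on `(q₂ ∘ π)_* 𝒞^{<0}`. -/
noncomputable def mulS (V : Opens CmodZ) : Module.End ℂ (Cflat V) where
  toFun f := ⟨fun x s => (s : ℂ) * f.1 x s, mulS_mem f.2⟩
  map_add' f g := Subtype.ext <| by funext x s; exact mul_add _ _ _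
  map_smul' c f := Subtype.ext <| by funext x s; exact mul_left_comm _ _ _

/-- The translation `τ`, i.e. `(τ f)(t, s) = f(t, s + 1)`, on `(q₂ ∘ π)_* 𝒞^{<0}`. -/
noncomputable def tauC (V : Opens CmodZ) : Module.End ℂ (Cflat V) where
  toFun f := ⟨fun x s => f.1 x (shiftPt V 1 s), shift_mem f.2 1⟩
  map_add' _ _ := rfl
  map_smul' _ _ := rfl

/-- Restriction of sections of `(q₂ ∘ π)_* 𝒞^{<0}`. -/
noncomputable def resC {V W : Opens CmodZ} (h : W ≤ V) : Cflat V →ₗ[ℂ] Cflat W where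
  toFun f := ⟨fun x s => f.1 x (inclusion (fiber_mono h) s), restrict_mem h f.2⟩
  map_add' _ _ := rfl
  map_smul' _ _ := rfl

theorem wirtCLM_fderiv (g : ℂ → ℂ) (t : ℂ) : wirt (fderiv ℝ g t) = wirtCLM (fderiv ℝ g t) :=
  (wirtCLM_apply _).symm

theorem wirtBarCLM_fderiv (g : ℂ → ℂ) (t : ℂ) :
    wirtBar (fderiv ℝ g t) = wirtBarCLM (fderiv ℝ g t) :=
  (wirtBarCLM_apply _).symm

theorem wirt_smul (c : ℂ) (L : ℂ →L[ℝ] ℂ) : wirt (c • L) = c * wirt L := by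
  simp [wirt]; ring

theorem wirtBar_smul (c : ℂ) (L : ℂ →L[ℝ] ℂ) : wirtBar (c • L) = c * wirtBar L := by
  simp [wirtBar]; ring

/-- The derivation `∂/∂t` on `(q₂ ∘ π)_* 𝒞^{<0}`. -/
noncomputable def dt (V : Opens CmodZ) : Module.End ℂ (Cflat V) where
  toFun f := ⟨dtFun f.1, dt_mem f.2⟩
  map_add' f g := Subtype.ext <| by
    funext x s
    induction x using OnePoint.rec with
    | infty => exact (add_zero 0).symm
    | coe t =>
      have := ((hasFDerivAt_aff f.2 t s).add (hasFDerivAt_aff g.2 t s)).fderiv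
      refine (congrArg wirt this).trans ?_
      rw [← wirtCLM_apply, map_add, wirtCLM_apply, wirtCLM_apply,
        ← (hasFDerivAt_aff f.2 t s).fderiv, ← (hasFDerivAt_aff g.2 t s).fderiv]
      rfl
  map_smul' c f := Subtype.ext <| by
    funext x s
    induction x using OnePoint.rec with
    | infty => exact (smul_zero c).symm
    | coe t =>
      have := ((hasFDerivAt_aff f.2 t s).const_smul c).fderiv
      refine (congrArg wirt this).trans ?_
      rw [wirt_smul, ← (hasFDerivAt_aff f.2 t s).fderiv]
      rfl

/-- The derivation `∂/∂t̄` on `(q₂ ∘ π)_* 𝒞^{<0}`. -/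
noncomputable def dtbar (V : Opens CmodZ) : Module.End ℂ (Cflat V) where
  toFun f := ⟨dtbarFun f.1, dtbar_mem f.2⟩
  map_add' f g := Subtype.ext <| by
    funext x s
    induction x using OnePoint.rec with
    | infty => exact (add_zero 0).symm
    | coe t =>
      have := ((hasFDerivAt_aff f.2 t s).add (hasFDerivAt_aff g.2 t s)).fderiv
      refine (congrArg wirtBar this).trans ?_
      rw [← wirtBarCLM_apply, map_add, wirtBarCLM_apply, wirtBarCLM_apply,
        ← (hasFDerivAt_aff f.2 t s).fderiv, ← (hasFDerivAt_aff g.2 t s).fderiv]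
      rfl
  map_smul' c f := Subtype.ext <| by
    funext x s
    induction x using OnePoint.rec with
    | infty => exact (smul_zero c).symm
    | coe t =>
      have := ((hasFDerivAt_aff f.2 t s).const_smul c).fderiv
      refine (congrArg wirtBar this).trans ?_
      rw [wirtBar_smul, ← (hasFDerivAt_aff f.2 t s).fderiv]
      rfl

theorem mulT_mulTinv (V : Opens CmodZ) : mulT V * mulTinv V = 1 := by
  ext f x s
  show coord x * ((coord x)⁻¹ * f.1 x s) = f.1 x s
  induction x using OnePoint.rec with
  | infty => rw [Cflat_infty f.2]; simp
  | coe t =>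
    by_cases ht : t = 0
    · subst ht; rw [Cflat_zero f.2]; simp
    · simp [ht]

theorem mulTinv_mulT (V : Opens CmodZ) : mulTinv V * mulT V = 1 := by
  ext f x s
  show (coord x)⁻¹ * (coord x * f.1 x s) = f.1 x s
  induction x using OnePoint.rec with
  | infty => rw [Cflat_infty f.2]; simp
  | coe t =>
    by_cases ht : t = 0
    · subst ht; rw [Cflat_zero f.2]; simp
    · simp [ht]

/-- The operator `t ∂/∂t - s - 1` on `(q₂ ∘ π)_* 𝒞^{<0}`. -/
noncomputable def thetaC (V : Opens CmodZ) : Module.End ℂ (Cflat V) :=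
  mulT V * dt V - mulS V - 1

theorem dt_mulT (V : Opens CmodZ) : dt V * mulT V = mulT V * dt V + 1 := by
  ext f x s
  induction x using OnePoint.rec with
  | infty =>
    show (0 : ℂ) = 0 * 0 + f.1 OnePoint.infty s
    rw [Cflat_infty f.2]; simp
  | coe t =>
    have h1 : HasFDerivAt (𝕜 := ℝ) (fun t' : ℂ => t') (ContinuousLinearMap.id ℝ ℂ) t :=
      hasFDerivAt_id t
    have h2 := (h1.mul (hasFDerivAt_aff f.2 t s)).fderiv
    have h3 := (hasFDerivAt_aff f.2 t s).fderiv
    show wirt (fderiv ℝ (fun t' : ℂ => t' * f.1 (t' : OnePoint ℂ) s) t) =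
      t * wirt (fderiv ℝ (fun t' : ℂ => f.1 (t' : OnePoint ℂ) s) t) + f.1 (t : OnePoint ℂ) s
    refine (congrArg wirt h2).trans ?_
    rw [h3]
    simp only [wirt, add_apply, smul_apply, ContinuousLinearMap.id_apply, smul_eq_mul]
    linear_combination (-(f.1 (t : OnePoint ℂ) s) / 2) * Complex.I_sq

theorem thetaC_mulT (V : Opens CmodZ) : thetaC V * mulT V = mulT V * thetaC V + mulT V := by
  refine LinearMap.ext fun f => ?_
  have h : dt V (mulT V f) = mulT V (dt V f) + f := LinearMap.congr_fun (dt_mulT V) f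
  have hs : mulS V (mulT V f) = mulT V (mulS V f) :=
    Subtype.ext <| by funext x s; exact mul_left_comm _ _ _
  show mulT V (dt V (mulT V f)) - mulS V (mulT V f) - mulT V f =
    mulT V (mulT V (dt V f) - mulS V f - f) + mulT V f
  rw [h, hs, map_add, map_sub, map_sub]
  abel

/-- Generators `t`, `t⁻¹`, `t∂_t` of the algebra `D`. -/
inductive WeylGen : Type
  | t
  | tinv
  | theta

/-- Defining relations of `D = ℂ[t, t⁻¹]⟨t∂_t⟩`. -/
inductive WeylRel : FreeAlgebra ℂ WeylGen → FreeAlgebra ℂ WeylGen → Prop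
  | mul_inv : WeylRel (FreeAlgebra.ι ℂ WeylGen.t * FreeAlgebra.ι ℂ WeylGen.tinv) 1
  | inv_mul : WeylRel (FreeAlgebra.ι ℂ WeylGen.tinv * FreeAlgebra.ι ℂ WeylGen.t) 1
  | comm : WeylRel (FreeAlgebra.ι ℂ WeylGen.theta * FreeAlgebra.ι ℂ WeylGen.t)
      (FreeAlgebra.ι ℂ WeylGen.t * FreeAlgebra.ι ℂ WeylGen.theta + FreeAlgebra.ι ℂ WeylGen.t)

/-- The algebra `D = ℂ[t, t⁻¹]⟨t∂_t⟩` of algebraic differential operators on `ℂ^*`. -/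
abbrev TorusD : Type := RingQuot WeylRel

/-- The element `t` of `D`. -/
noncomputable def TorusD.t : TorusD :=
  RingQuot.mkAlgHom ℂ WeylRel (FreeAlgebra.ι ℂ WeylGen.t)

/-- The element `t∂_t` of `D`. -/
noncomputable def TorusD.theta : TorusD :=
  RingQuot.mkAlgHom ℂ WeylRel (FreeAlgebra.ι ℂ WeylGen.theta)

/-- The element `t⁻¹` of `D`. -/
noncomputable def TorusD.tinv : TorusD :=
  RingQuot.mkAlgHom ℂ WeylRel (FreeAlgebra.ι ℂ WeylGen.tinv)

/-- The action of `D` for which `t`, `t⁻¹`, `t∂_t` act by given operators. -/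
noncomputable def weylAction {M : Type} [AddCommGroup M] [Module ℂ M] (T Ti Th : Module.End ℂ M)
    (h1 : T * Ti = 1) (h2 : Ti * T = 1) (h3 : Th * T = T * Th + T) :
    TorusD →ₐ[ℂ] Module.End ℂ M :=
  RingQuot.liftAlgHom ℂ ⟨FreeAlgebra.lift ℂ fun g => match g with
    | WeylGen.t => T
    | WeylGen.tinv => Ti
    | WeylGen.theta => Th, by
      intro x y h
      cases h <;> simp [h1, h2, h3]⟩

/-- `(q₂ ∘ π)_* 𝒞^{<0}` as a `D`-module: `t` acts by `t` and `t∂_t` by `t ∂/∂t - s - 1`. -/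
noncomputable instance (V : Opens CmodZ) : Module TorusD (Cflat V) :=
  Module.compHom (Cflat V) (weylAction (mulT V) (mulTinv V) (thetaC V) (mulT_mulTinv V)
    (mulTinv_mulT V) (thetaC_mulT V)).toRingHom

theorem t_smul (V : Opens CmodZ) (f : Cflat V) : TorusD.t • f = mulT V f := by
  show weylAction _ _ _ _ _ _ TorusD.t f = _
  simp [weylAction, TorusD.t]

theorem tinv_smul (V : Opens CmodZ) (f : Cflat V) : TorusD.tinv • f = mulTinv V f := by
  show weylAction _ _ _ _ _ _ TorusD.tinv f = _
  simp [weylAction, TorusD.tinv]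

theorem theta_smul (V : Opens CmodZ) (f : Cflat V) : TorusD.theta • f = thetaC V f := by
  show weylAction _ _ _ _ _ _ TorusD.theta f = _
  simp [weylAction, TorusD.theta]

/-- `𝒪[1/t]` inside `𝒪((t)) = 𝒪[[t]][1/t]`, where `𝒪 = π_* 𝒪`. -/
def polyInv (V : Opens CmodZ) : Submodule (Holo V) (LaurentSeries (Holo V)) :=
  Submodule.span (Holo V) (range fun k : ℕ => HahnSeries.single (-(k : ℤ)) (1 : Holo V))

/-- `(t)𝒪[t]` inside `𝒪[[1/t]][t]`; here Laurent series are written in the variable `1/t`, so that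
`t ^ (k + 1)` has exponent `-(k + 1)`. -/
def polyPos (V : Opens CmodZ) : Submodule (Holo V) (LaurentSeries (Holo V)) :=
  Submodule.span (Holo V) (range fun k : ℕ => HahnSeries.single (-((k : ℤ) + 1)) (1 : Holo V))

/-- Shortcut instances, for speed. -/
noncomputable instance (V : Opens CmodZ) : CommRing (Holo V) := inferInstance

noncomputable instance (V : Opens CmodZ) : AddCommGroup (LaurentSeries (Holo V)) :=
  inferInstance

noncomputable instance (V : Opens CmodZ) : Module (Holo V) (LaurentSeries (Holo V)) :=
  inferInstance

/-- The formal tails at `0`, `𝒪[[t]][1/t] / 𝒪[1/t]`. -/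
abbrev TailsZero (V : Opens CmodZ) : Type := LaurentSeries (Holo V) ⧸ polyInv V

/-- The formal tails at `∞`, `𝒪[[1/t]][t] / (t)𝒪[t]`. -/
abbrev TailsInf (V : Opens CmodZ) : Type := LaurentSeries (Holo V) ⧸ polyPos V

/-- The direct sum of the formal tails at `0` and at `∞`. -/
abbrev Tails (V : Opens CmodZ) : Type := TailsZero V × TailsInf V

/-- The coefficients of `t ^ k`, `k ≥ 1`, of a Laurent series in `t`. -/
def coeffPos (V : Opens CmodZ) : LaurentSeries (Holo V) →ₗ[Holo V] (ℤ → Holo V) where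
  toFun a k := if 1 ≤ k then a.coeff k else 0
  map_add' a b := by funext k; by_cases h : 1 ≤ k <;> simp [h]
  map_smul' c a := by funext k; by_cases h : 1 ≤ k <;> simp [h]

/-- The coefficients of `t ^ k`, `k ≤ 0`, of a Laurent series in `1/t`. -/
def coeffNeg (V : Opens CmodZ) : LaurentSeries (Holo V) →ₗ[Holo V] (ℤ → Holo V) where
  toFun b k := if k ≤ 0 then b.coeff (-k) else 0
  map_add' a b := by funext k; by_cases h : k ≤ 0 <;> simp [h]
  map_smul' c a := by funext k; by_cases h : k ≤ 0 <;> simp [h]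

theorem coeffPos_polyInv (V : Opens CmodZ) : polyInv V ≤ LinearMap.ker (coeffPos V) := by
  rw [polyInv, Submodule.span_le]
  rintro _ ⟨n, rfl⟩
  refine funext fun k => ?_
  show (if 1 ≤ k then _ else _) = (0 : Holo V)
  split_ifs with h
  · exact HahnSeries.coeff_single_of_ne (by omega)
  · rfl

theorem coeffNeg_polyPos (V : Opens CmodZ) : polyPos V ≤ LinearMap.ker (coeffNeg V) := by
  rw [polyPos, Submodule.span_le]
  rintro _ ⟨n, rfl⟩
  refine funext fun k => ?_
  show (if k ≤ 0 then _ else _) = (0 : Holo V)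
  split_ifs with h
  · exact HahnSeries.coeff_single_of_ne (by omega)
  · rfl

/-- The formal difference `a - b`, as a bi-infinite series in `t`, of a tail `a` at `0`
(represented by exponents `≥ 1`) and a tail `b` at `∞` (represented by exponents `≤ 0`). -/
noncomputable def tailsDiff (V : Opens CmodZ) : Tails V →ₗ[Holo V] (ℤ → Holo V) :=
  ((polyInv V).liftQ (coeffPos V) (coeffPos_polyInv V)).comp (LinearMap.fst _ _ _) -
    ((polyPos V).liftQ (coeffNeg V) (coeffNeg_polyPos V)).comp (LinearMap.snd _ _ _)

theorem tailsDiff_mk (V : Opens CmodZ) (a b : LaurentSeries (Holo V)) (k : ℤ) :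
    tailsDiff V (Submodule.Quotient.mk a, Submodule.Quotient.mk b) k =
      (if 1 ≤ k then a.coeff k else 0) - (if k ≤ 0 then b.coeff (-k) else 0) := rfl

theorem laurent_eq_sum {R : Type} [CommRing R] (a : LaurentSeries R) (m : ℤ)
    (h : ∀ k, m ≤ k → a.coeff k = 0) :
    a = ∑ k ∈ Finset.Ico a.order m, a.coeff k • HahnSeries.single k (1 : R) := by
  ext j
  have e : ∀ s : Finset ℤ, (∑ k ∈ s, a.coeff k • HahnSeries.single k (1 : R)).coeff j =
      ∑ k ∈ s, (a.coeff k • HahnSeries.single k (1 : R)).coeff j := fun s =>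
    map_sum (HahnSeries.coeff.addMonoidHom j) _ _
  rw [e]
  by_cases hj : j ∈ Finset.Ico a.order m
  · rw [Finset.sum_eq_single j]
    · simp
    · intro k _ hk
      simp [HahnSeries.coeff_single_of_ne (Ne.symm hk)]
    · exact fun h => absurd hj h
  · rw [Finset.sum_eq_zero]
    · rw [Finset.mem_Ico, not_and_or] at hj
      rcases hj with hj | hj
      · exact HahnSeries.coeff_eq_zero_of_lt_order (not_le.1 hj)
      · exact h j (not_lt.1 hj)
    · intro k hk
      have : j ≠ k := fun e => hj (e ▸ hk)
      simp [HahnSeries.coeff_single_of_ne this]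

theorem tailsDiff_bijective (V : Opens CmodZ) : Function.Bijective (tailsDiff V) := by
  constructor
  · rw [← LinearMap.ker_eq_bot, LinearMap.ker_eq_bot']
    rintro ⟨p, q⟩ h
    induction p using Submodule.Quotient.induction_on with | _ a => ?_
    induction q using Submodule.Quotient.induction_on with | _ b => ?_
    have hk : ∀ k : ℤ, (if 1 ≤ k then a.coeff k else 0) - (if k ≤ 0 then b.coeff (-k) else 0) = 0 :=
      fun k => congrFun h k
    have ha : ∀ k, 1 ≤ k → a.coeff k = 0 := fun k h1 => by
      have := hk k
      rwa [if_pos h1, if_neg (by omega), sub_zero] at this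
    have hb : ∀ k, 0 ≤ k → b.coeff k = 0 := fun k h1 => by
      have := hk (-k)
      rwa [if_neg (by omega), if_pos (by omega), neg_neg, zero_sub, neg_eq_zero] at this
    refine Prod.ext ((Submodule.Quotient.mk_eq_zero _).2 ?_)
      ((Submodule.Quotient.mk_eq_zero _).2 ?_)
    · rw [laurent_eq_sum a 1 ha]
      refine Submodule.sum_mem _ fun k hk => Submodule.smul_mem _ _ (Submodule.subset_span ?_)
      have := (Finset.mem_Ico.1 hk).2
      have e : -(((-k).toNat : ℕ) : ℤ) = k := by omega
      exact ⟨(-k).toNat, congrArg (fun j => HahnSeries.single j (1 : Holo V)) e⟩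
    · rw [laurent_eq_sum b 0 hb]
      refine Submodule.sum_mem _ fun k hk => Submodule.smul_mem _ _ (Submodule.subset_span ?_)
      have := (Finset.mem_Ico.1 hk).2
      have e : -((((-k - 1).toNat : ℕ) : ℤ) + 1) = k := by omega
      exact ⟨(-k - 1).toNat, congrArg (fun j => HahnSeries.single j (1 : Holo V)) e⟩
  · intro c
    have h1 : BddBelow (Function.support fun k : ℤ => if 1 ≤ k then c k else 0) :=
      ⟨1, fun k hk => by by_contra h; exact Function.mem_support.1 hk (if_neg h)⟩
    have h2 : BddBelow (Function.support fun k : ℤ => if 0 ≤ k then -c (-k) else 0) :=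
      ⟨0, fun k hk => by by_contra h; exact Function.mem_support.1 hk (if_neg h)⟩
    refine ⟨(Submodule.Quotient.mk (HahnSeries.ofSuppBddBelow _ h1),
      Submodule.Quotient.mk (HahnSeries.ofSuppBddBelow _ h2)), funext fun k => ?_⟩
    refine (tailsDiff_mk V _ _ k).trans ?_
    rw [HahnSeries.coeff_ofSuppBddBelow, HahnSeries.coeff_ofSuppBddBelow]
    by_cases h : 1 ≤ k
    · rw [if_pos h, if_pos h, if_neg (by omega), sub_zero]
    · rw [if_neg h, if_pos (by omega), if_pos (by omega), neg_neg, zero_sub, neg_neg]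

/-- `tailsDiff` as a linear isomorphism. -/
noncomputable def tailsEquiv (V : Opens CmodZ) : Tails V ≃ₗ[ℂ] (ℤ → Holo V) :=
  (LinearEquiv.ofBijective (tailsDiff V) (tailsDiff_bijective V)).restrictScalars ℂ

/-- Multiplication by `t ^ n` on bi-infinite formal series `∑ c_k t^k`. -/
def biShift (V : Opens CmodZ) (n : ℤ) : Module.End ℂ (ℤ → Holo V) where
  toFun c k := c (k - n)
  map_add' _ _ := rfl
  map_smul' _ _ := rfl

/-- `t ∂/∂t - s - 1` on bi-infinite formal series `∑ c_k t^k`. -/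
def biTheta (V : Opens CmodZ) : Module.End ℂ (ℤ → Holo V) where
  toFun c k := (k : Holo V) * c k - holoS V * c k - c k
  map_add' a b := by funext k; simp only [Pi.add_apply]; ring
  map_smul' z a := by
    funext k
    simp only [Pi.smul_apply, mul_smul_comm, smul_sub, RingHom.id_apply]

theorem biTheta_biShift (V : Opens CmodZ) :
    biTheta V * biShift V 1 = biShift V 1 * biTheta V + biShift V 1 := by
  refine LinearMap.ext fun c => funext fun k => ?_
  show (k : Holo V) * c (k - 1) - holoS V * c (k - 1) - c (k - 1) =
    (((k - 1 : ℤ) : Holo V) * c (k - 1) - holoS V * c (k - 1) - c (k - 1)) + c (k - 1)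
  push_cast; ring

/-- The action of `D` on bi-infinite formal series. -/
noncomputable def biAction (V : Opens CmodZ) : TorusD →ₐ[ℂ] Module.End ℂ (ℤ → Holo V) :=
  weylAction (biShift V 1) (biShift V (-1)) (biTheta V)
    (LinearMap.ext fun c => funext fun k => congrArg c (by ring))
    (LinearMap.ext fun c => funext fun k => congrArg c (by ring)) (biTheta_biShift V)

/-- The formal tails at `0` and `∞` as a `D`-module. The action of `D` is the coefficientwise one
after identification of `(a, b)` with the bi-infinite series `a - b`. Equivalently, one multiplies
the normalized representatives `a = ∑_{k ≥ 1} a_k t^k` and `b = ∑_{k ≥ 0} b_k t^{-k}` and then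
normalizes again by subtracting one and the same Laurent polynomial from both. (The subspaces
`𝒪[1/t]` and `(t)𝒪[t]` are not both stable under `t` and `t⁻¹`, so that this identification is
what gives a meaning to the multiplication by `t` on the direct sum.) -/
noncomputable instance (V : Opens CmodZ) : Module TorusD (Tails V) :=
  Module.compHom (Tails V)
    ((tailsEquiv V).symm.conjRingEquiv.toRingHom.comp (biAction V).toRingHom)

theorem tailsEquiv_smul (V : Opens CmodZ) (P : TorusD) (q : Tails V) :
    tailsEquiv V (P • q) = biAction V P (tailsEquiv V q) :=
  (tailsEquiv V).apply_symm_apply _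

/-- `t` acts on tails by multiplication of the bi-infinite series `a - b` by `t`. -/
theorem tailsEquiv_t_smul (V : Opens CmodZ) (q : Tails V) (k : ℤ) :
    tailsEquiv V (TorusD.t • q) k = tailsEquiv V q (k - 1) := by
  rw [tailsEquiv_smul]
  simp [biAction, weylAction, TorusD.t, biShift]

/-- `t∂_t` acts on tails by `t ∂/∂t - s - 1`, coefficientwise. -/
theorem tailsEquiv_theta_smul (V : Opens CmodZ) (q : Tails V) (k : ℤ) :
    tailsEquiv V (TorusD.theta • q) k =
      (k : Holo V) * tailsEquiv V q k - holoS V * tailsEquiv V q k - tailsEquiv V q k := by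
  rw [tailsEquiv_smul]
  simp [biAction, weylAction, TorusD.theta, biTheta]

/-- The translation `τ` on tails: `s ↦ s + 1` in all coefficients. -/
noncomputable def tauTails (V : Opens CmodZ) : Module.End ℂ (Tails V) :=
  ((tailsEquiv V).symm.toLinearMap.comp (LinearMap.pi fun k =>
    (holoShift V 1).comp (LinearMap.proj k))).comp (tailsEquiv V).toLinearMap

/-- Restriction of tails: restriction of all coefficients. -/
noncomputable def resTails {V W : Opens CmodZ} (h : W ≤ V) : Tails V →ₗ[ℂ] Tails W :=
  ((tailsEquiv W).symm.toLinearMap.comp (LinearMap.pi fun k =>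
    (holoRes h).comp (LinearMap.proj k))).comp (tailsEquiv V).toLinearMap

/-- The kernel `K(t) = -1 / (2iπ (t - 1))`. -/
noncomputable def kernelK (t : ℂ) : ℂ := -1 / (2 * Complex.I * Real.pi * (t - 1))

/-- The integrand of `K * f` with respect to Lebesgue measure, with
`dξ/ξ ∧ dξ̄/ξ̄ = -2i |ξ|⁻² dx dy`, `ξ = x + iy`. -/
noncomputable def convIntegrand {V : Opens CmodZ} (f : Cflat V) (t : ℂ) (s : fiber V) (ξ : ℂ) : ℂ :=
  f.1 (ξ : OnePoint ℂ) s * kernelK (ξ / t) * (-2 * Complex.I / (ξ * (starRingEnd ℂ) ξ))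

/-- `(K * f)(t, s) = (1/2iπ) ∫ f(ξ, s) (1 - ξ/t)⁻¹ dξ/ξ ∧ dξ̄/ξ̄`. -/
noncomputable def convK {V : Opens CmodZ} (f : Cflat V) (t : ℂ) (s : fiber V) : ℂ :=
  ∫ ξ : ℂ, convIntegrand f t s ξ

/-- The partial sum `∑_{k < N} a_k(s) z^k` of a Laurent series. -/
noncomputable def partialSum {V : Opens CmodZ} (a : LaurentSeries (Holo V)) (N : ℤ) (z : ℂ)
    (s : fiber V) : ℂ :=
  ∑ k ∈ Finset.Ico a.order N, (a.coeff k).1 s * z ^ k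

/-- `a` is the asymptotic expansion of `g(t, s)` at `t = 0`, locally uniformly in `s`. -/
def IsExpansionAtZero {V : Opens CmodZ} (g : ℂ → fiber V → ℂ) (a : LaurentSeries (Holo V)) : Prop :=
  ∀ (N : ℤ) (S : Set (fiber V)), IsCompact S → ∃ C r : ℝ, 0 < r ∧
    ∀ t : ℂ, t ≠ 0 → ‖t‖ < r → ∀ s ∈ S, ‖g t s - partialSum a N t s‖ ≤ C * ‖t‖ ^ N

/-- `b`, a Laurent series in `1/t`, is the asymptotic expansion of `g(t, s)` at `t = ∞`, locally
uniformly in `s`. -/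
def IsExpansionAtInf {V : Opens CmodZ} (g : ℂ → fiber V → ℂ) (b : LaurentSeries (Holo V)) : Prop :=
  ∀ (N : ℤ) (S : Set (fiber V)), IsCompact S → ∃ C R : ℝ, 0 < R ∧
    ∀ t : ℂ, R < ‖t‖ → ∀ s ∈ S, ‖g t s - partialSum b N t⁻¹ s‖ ≤ C * ‖t⁻¹‖ ^ N

/-- Exactness, as a sequence of sheaves on `ℂ/ℤ` (surjectivity is local on `ℂ/ℤ`), of
`0 → (q₂ ∘ π)_* 𝒞^{<0} → (q₂ ∘ π)_* 𝒞^{<0} → Tails → 0`. -/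
def IsExactSequence (α : ∀ V : Opens CmodZ, Cflat V →ₗ[TorusD] Cflat V)
    (β : ∀ V : Opens CmodZ, Cflat V →ₗ[TorusD] Tails V) : Prop :=
  (∀ V, Function.Injective (α V)) ∧
  (∀ V (f : Cflat V), β V f = 0 ↔ ∃ g : Cflat V, α V g = f) ∧
  (∀ V (q : Tails V), ∀ x ∈ V, ∃ (W : Opens CmodZ) (h : W ≤ V), x ∈ W ∧
    ∃ f : Cflat W, β W f = resTails h q)

end MellinDA

open MellinDA

namespace MellinDA

open scoped ContDiff Topology
open Set TopologicalSpace MeasureTheory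

/-! The whole statement is controlled by the moments c_k(f)(s) = π⁻¹ ∫ f(ξ, s) ξ^(-k) |ξ|⁻² dx dy, k
∈ ℤ, all of which converge because f is flat at 0 and ∞. Written against Lebesgue measure, K * f is
π⁻¹ ∫ f(ξ, s) t/(ξ - t) |ξ|⁻² dx dy. Expanding t/(ξ - t) as ∑_{k ≥ 1} (t/ξ)^k near t = 0 and as
-∑_{k ≥ 0} (ξ/t)^k near t = ∞ yields the expansions ∑_{k ≥ 1} c_k t^k and -∑_{k ≥ 0} c_{-k} t^(-k).
The bi-infinite series attached to this pair is ∑_{k ∈ ℤ} c_k t^k, so ε is simply the moment map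
(`moments`, `epsilon_eq`). Its `TorusD`-linearity is integration by parts, and compatibility with τ
and with restriction is visible on each coefficient.

Exactness in the middle: ∂g/∂t̄ has no moments, by Stokes and because ξ^k is holomorphic off 0
(`Cflat.mom_dtbar`). Conversely, if all c_k(f) vanish, π⁻¹ times the Cauchy transform of f/t̄ solves
t̄ ∂g/∂t̄ = f, by the Cauchy-Pompeiu formula (`BiflatOn.wirtBar_kconv_inv`). It is flat at 0:
derivatives pass through the convolution onto f/t̄, and their values at t = 0 are moments of
derivatives of f/t̄, which vanish again (`BiflatOn.iteratedFDeriv_kconv_inv`). Inversion t ↦ 1/t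
sends a Cauchy transform to minus a Cauchy transform up to one more moment, which settles flatness
at ∞ (`biflatOn_cauchy`). Injectivity is Liouville's theorem (`dtbar_eq_zero`).

Surjectivity is a Borel construction: f = ∑ a_k(s) t^k ‖t/ε_k‖² h(t/ε_k), with h a radial bump
supported in an annulus and ε_k tending to 0 fast enough (`exists_borelSum`). By rotation invariance
the k-th term contributes to c_k only, so the moments of index k ≥ 0 can be prescribed
(`exists_moments_nat`); inversion provides the negative ones. This works over every V, without
shrinking it.

The second sequence follows from the first because multiplication by t̄ is invertible on flat
functions (`mulTbarInv`). -/

/-- Functions on `ℂ × U`, in the affine coordinate of `ℙ¹`, which extend smoothly to `ℙ¹ × U` and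
are flat along `{0, ∞} × U`. -/
structure BiflatOn {E : Type} [NormedAddCommGroup E] [NormedSpace ℝ E] (U : Set ℂ)
    (h : ℂ × ℂ → E) : Prop where
  zero : FlatOn U h
  inf : FlatOn U (fun p => h (p.1⁻¹, p.2))

/-! ### Functions flat at both 0 and ∞: stability and decay -/

section biflat
variable {E F : Type} [NormedAddCommGroup E] [NormedSpace ℂ E]
  [NormedAddCommGroup F] [NormedSpace ℂ F] {U : Set ℂ} {h k : ℂ × ℂ → E}

theorem BiflatOn.congr (hf : BiflatOn U h) (hU : IsOpen U) (e : ∀ t, ∀ s ∈ U, k (t, s) = h (t, s)) :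
    BiflatOn U k :=
  ⟨hf.zero.congr hU e, hf.inf.congr hU fun t s hs => e t⁻¹ s hs⟩

theorem BiflatOn.clm (hU : IsOpen U) (hf : BiflatOn U h) (L : E →L[ℝ] F) :
    BiflatOn U (fun p => L (h p)) :=
  ⟨hf.zero.clm hU L, hf.inf.clm hU L⟩

theorem BiflatOn.comp_inv (hf : BiflatOn U h) : BiflatOn U (fun p => h (p.1⁻¹, p.2)) :=
  ⟨hf.inf, by simpa using hf.zero⟩

theorem BiflatOn.smul_fst (hU : IsOpen U) (hf : BiflatOn U h) : BiflatOn U (fun p => p.1 • h p) :=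
  ⟨hf.zero.smul hU contDiffOn_fst, hf.inf.div hU⟩

theorem BiflatOn.inv_smul_fst (hU : IsOpen U) (hf : BiflatOn U h) :
    BiflatOn U (fun p => p.1⁻¹ • h p) :=
  ⟨hf.zero.div hU, by simpa using hf.inf.smul hU (c := fun p => p.1) contDiffOn_fst⟩

theorem BiflatOn.eq_zero (hf : BiflatOn U h) {s : ℂ} (hs : s ∈ U) : h (0, s) = 0 :=
  hf.zero.eq_zero hs

theorem BiflatOn.zpow_smul_nat (hU : IsOpen U) (hf : BiflatOn U h) (n : ℕ) :
    BiflatOn U (fun p => p.1 ^ n • h p) := by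
  induction n with
  | zero => simpa using hf
  | succ n ih =>
    refine (ih.smul_fst hU).congr hU fun t s _ => ?_
    simp only [smul_smul, pow_succ']

theorem BiflatOn.zpow_smul (hU : IsOpen U) (hf : BiflatOn U h) (k : ℤ) :
    BiflatOn U (fun p => p.1 ^ k • h p) := by
  obtain ⟨n, rfl | rfl⟩ := k.eq_nat_or_neg
  · simpa using hf.zpow_smul_nat hU n
  · have := (hf.comp_inv.zpow_smul_nat hU n).comp_inv
    simpa using this

/-- Near ∞ the chain rule expresses the derivative of h at 1/u through that of k = h(1/·, ·) at u,
precomposed with multiplication by -u² on the first factor. Splitting -u² into real and imaginary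
parts turns this into smooth scalar functions times the fixed operators `P M₁` and `P M₂`, to which
`FlatOn.smul` and `FlatOn.clm` apply. -/
theorem BiflatOn.fderiv (hU : IsOpen U) (hf : BiflatOn U h) : BiflatOn U (fderiv ℝ h) := by
  refine ⟨hf.zero.fderiv hU, ?_⟩
  set k : ℂ × ℂ → E := fun p => h (p.1⁻¹, p.2) with hk
  let P : (ℂ × ℂ →L[ℝ] ℂ × ℂ) → (ℂ × ℂ →L[ℝ] E) →L[ℝ] (ℂ × ℂ →L[ℝ] E) := fun M =>
    (ContinuousLinearMap.compL ℝ (ℂ × ℂ) (ℂ × ℂ) E).flip M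
  let M₁ : ℂ × ℂ →L[ℝ] ℂ × ℂ :=
    (ContinuousLinearMap.inl ℝ ℂ ℂ).comp (ContinuousLinearMap.fst ℝ ℂ ℂ)
  let M₂ : ℂ × ℂ →L[ℝ] ℂ × ℂ := (ContinuousLinearMap.inl ℝ ℂ ℂ).comp
    (Complex.I • ContinuousLinearMap.fst ℝ ℂ ℂ)
  let M₃ : ℂ × ℂ →L[ℝ] ℂ × ℂ :=
    (ContinuousLinearMap.inr ℝ ℂ ℂ).comp (ContinuousLinearMap.snd ℝ ℂ ℂ)
  have hD := hf.inf.fderiv hU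
  have c1 : ContDiffOn ℝ ∞ (fun p : ℂ × ℂ => (((-p.1 ^ 2).re : ℝ) : ℂ)) (univ ×ˢ U) :=
    ((Complex.ofRealCLM.contDiff.comp Complex.reCLM.contDiff).comp
      (by fun_prop : ContDiff ℝ ∞ fun p : ℂ × ℂ => -p.1 ^ 2)).contDiffOn
  have c2 : ContDiffOn ℝ ∞ (fun p : ℂ × ℂ => (((-p.1 ^ 2).im : ℝ) : ℂ)) (univ ×ˢ U) :=
    ((Complex.ofRealCLM.contDiff.comp Complex.imCLM.contDiff).comp
      (by fun_prop : ContDiff ℝ ∞ fun p : ℂ × ℂ => -p.1 ^ 2)).contDiffOn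
  refine ((((hD.clm hU (P M₁)).smul hU c1).add hU ((hD.clm hU (P M₂)).smul hU c2)).add hU
    (hD.clm hU (P M₃))).congr hU fun u s hs => ?_
  -- Since `0⁻¹ = 0`, the point u = 0 compares two derivatives which both vanish by flatness.
  by_cases hu : u = 0
  · subst hu
    have e1 : _root_.fderiv ℝ k (0, s) = 0 := hD.eq_zero hs
    have e2 : _root_.fderiv ℝ h (0, s) = 0 := (hf.zero.fderiv hU).eq_zero hs
    simp [e1, e2, ← hk]
  · have h1 : HasFDerivAt (𝕜 := ℝ) k (_root_.fderiv ℝ k (u, s)) (u, s) :=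
      (hf.inf.differentiableAt hU hs).hasFDerivAt
    have h2 : HasFDerivAt (𝕜 := ℝ) (fun z : ℂ => z⁻¹)
        (((1 : ℂ →L[ℂ] ℂ).smulRight (-u ^ 2)).restrictScalars ℝ) u⁻¹ := by
      have := (hasDerivAt_inv (inv_ne_zero hu)).hasFDerivAt.restrictScalars ℝ
      refine this.congr_fderiv (by ext; simp)
    have h3 : HasFDerivAt (𝕜 := ℝ) (fun p : ℂ × ℂ => (p.1⁻¹, p.2)) _ (u⁻¹, s) :=
      (h2.comp (u⁻¹, s) (hasFDerivAt_fst (𝕜 := ℝ) (p := (u⁻¹, s)))).prodMk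
        (hasFDerivAt_snd (𝕜 := ℝ) (p := (u⁻¹, s)))
    have h1' : HasFDerivAt (𝕜 := ℝ) k (_root_.fderiv ℝ k (u, s)) ((u⁻¹)⁻¹, s) := by rwa [inv_inv]
    have h4 := HasFDerivAt.comp (u⁻¹, s) h1' h3
    have e : k ∘ (fun p : ℂ × ℂ => (p.1⁻¹, p.2)) = h := by funext p; simp [hk]
    rw [e] at h4
    simp only
    rw [h4.fderiv, ← hk]
    set L := _root_.fderiv ℝ k (u, s)
    have hL : L (0, 0) = 0 := map_zero L
    have key : ∀ (a v : ℂ), L (a * v, 0) = (a.re : ℂ) • L (v, 0) + (a.im : ℂ) • L (Complex.I * v, 0) := by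
      intro a v
      rw [Complex.coe_smul, Complex.coe_smul, ← map_smul, ← map_smul, ← map_add]
      congr 1
      ext
      · simp only [Prod.smul_mk, Prod.mk_add_mk, Complex.real_smul]
        linear_combination (-v) * Complex.re_add_im a
      · simp
    ext v
    · have := key (-u ^ 2) v
      simp only [P, M₁, M₂, M₃]
      simp [mul_comm, hL] at this ⊢
      exact this
    · simp [P, M₁, M₂, M₃, hL]

/-- Dividing by t̄ is dividing the conjugate function by t and conjugating back. -/
theorem BiflatOn.conj_inv_smul (hU : IsOpen U) {h : ℂ × ℂ → ℂ} (hf : BiflatOn U h) :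
    BiflatOn U (fun p => ((starRingEnd ℂ) p.1)⁻¹ * h p) := by
  have := (((hf.clm hU (Complex.conjCLE : ℂ →L[ℝ] ℂ)).inv_smul_fst hU).clm hU
    (Complex.conjCLE : ℂ →L[ℝ] ℂ))
  simpa using this

/-- Functions flat along `{0, ∞} × U` are bounded locally uniformly in `s`. -/
theorem BiflatOn.bounded (hU : IsOpen U) (hf : BiflatOn U h) {s : ℂ} (hs : s ∈ U) :
    ∃ C : ℝ, 0 ≤ C ∧ ∃ r > 0, Metric.ball s r ⊆ U ∧
      ∀ t, ∀ s' ∈ Metric.ball s r, ‖h (t, s')‖ ≤ C := by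
  obtain ⟨r, hr, hb⟩ := Metric.nhds_basis_closedBall.mem_iff.1 (hU.mem_nhds hs)
  -- Compactness of ℙ¹ in concrete form: the closed unit discs of the two charts cover it.
  have hK : IsCompact (Metric.closedBall (0 : ℂ) 1 ×ˢ Metric.closedBall s r) :=
    (isCompact_closedBall _ _).prod (isCompact_closedBall _ _)
  have hsub : Metric.closedBall (0 : ℂ) 1 ×ˢ Metric.closedBall s r ⊆ univ ×ˢ U :=
    prod_mono (subset_univ _) hb
  obtain ⟨C₁, h₁⟩ := hK.exists_bound_of_continuousOn (hf.zero.1.continuousOn.mono hsub)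
  obtain ⟨C₂, h₂⟩ := hK.exists_bound_of_continuousOn (hf.inf.1.continuousOn.mono hsub)
  refine ⟨max 0 (max C₁ C₂), le_max_left _ _, r, hr, Metric.ball_subset_closedBall.trans hb,
    fun t s' hs' => ?_⟩
  have hs'' := Metric.ball_subset_closedBall hs'
  by_cases ht : ‖t‖ ≤ 1
  · exact (h₁ (t, s') ⟨by simpa using ht, hs''⟩).trans ((le_max_left _ _).trans (le_max_right _ _))
  · have := h₂ (t⁻¹, s') ⟨by
      simpa using inv_le_one_of_one_le₀ (not_le.1 ht).le, hs''⟩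
    simp only [inv_inv] at this
    exact this.trans ((le_max_right _ _).trans (le_max_right _ _))

/-- Functions flat along `{0, ∞} × U` decay rapidly at `∞`, locally uniformly in `s`. -/
theorem BiflatOn.decay (hU : IsOpen U) (hf : BiflatOn U h) {s : ℂ} (hs : s ∈ U) (n : ℕ) :
    ∃ C : ℝ, 0 ≤ C ∧ ∃ r > 0, Metric.ball s r ⊆ U ∧
      ∀ t, ∀ s' ∈ Metric.ball s r, (1 + ‖t‖) ^ n * ‖h (t, s')‖ ≤ C := by
  induction n generalizing h with
  | zero => simpa using hf.bounded hU hs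
  | succ n ih =>
    -- One more factor 1 + ‖t‖ costs the bounds of order n for both h and t • h, which is again
    -- biflat.
    obtain ⟨C₁, h01, r₁, hr₁, hb₁, h₁⟩ := ih hf
    obtain ⟨C₂, h02, r₂, hr₂, hb₂, h₂⟩ := ih (hf.smul_fst hU)
    refine ⟨C₁ + C₂, by positivity, min r₁ r₂, lt_min hr₁ hr₂,
      (Metric.ball_subset_ball (min_le_left _ _)).trans hb₁, fun t s' hs' => ?_⟩
    have e1 := h₁ t s' (Metric.ball_subset_ball (min_le_left _ _) hs')
    have e2 := h₂ t s' (Metric.ball_subset_ball (min_le_right _ _) hs')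
    rw [norm_smul] at e2
    calc _ = (1 + ‖t‖) ^ n * ‖h (t, s')‖ + (1 + ‖t‖) ^ n * (‖t‖ * ‖h (t, s')‖) := by ring
      _ ≤ _ := add_le_add e1 e2

theorem BiflatOn.continuous_slice (hU : IsOpen U) (hf : BiflatOn U h) {s : ℂ} (hs : s ∈ U) :
    Continuous fun t => h (t, s) :=
  continuous_iff_continuousAt.2 fun _ =>
    ContinuousAt.comp (f := fun t => (t, s)) (hf.zero.contDiffAt hU hs).continuousAt (by fun_prop)

end biflat

/-! ### Convolution with tempered kernels, differentiation under the integral -/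

/-- Kernels which can be convolved with functions decaying at infinity like `‖ξ‖⁻³`. -/
structure TemperedKernel (k : ℂ → ℂ) : Prop where
  meas : Measurable k
  int : Integrable (fun ξ => ‖k ξ‖ * ((1 + ‖ξ‖) ^ 3)⁻¹)

theorem temperedKernel_one : TemperedKernel (fun _ => 1) := by
  refine ⟨measurable_const, ?_⟩
  have := integrable_one_add_norm (E := ℂ) (μ := volume) (r := 3) (by
    rw [Complex.finrank_real_complex]; norm_num)
  refine this.congr (Filter.Eventually.of_forall fun ξ => ?_)
  simp only [norm_one, one_mul]
  rw [Real.rpow_neg (by positivity)]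
  norm_cast

/-- In polar coordinates the Jacobian r cancels the singularity 1/r and leaves (1 + r)⁻³ on the
half-line. -/
theorem temperedKernel_inv : TemperedKernel (fun ξ => ξ⁻¹) := by
  refine ⟨measurable_inv, ?_⟩
  have h := integrable_fun_norm_addHaar (E := ℂ) volume
    (f := fun r : ℝ => r⁻¹ * ((1 + r) ^ 3)⁻¹)
  simp only [norm_inv]
  refine h.2 ?_
  have := (integrable_one_add_norm (E := ℝ) (μ := volume) (r := 3) (by simp)).integrableOn
    (s := Ioi 0)
  refine this.congr_fun (fun y hy => ?_) measurableSet_Ioi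
  have hy : 0 < y := hy
  simp only [Complex.finrank_real_complex, Real.norm_eq_abs, abs_of_pos hy]
  rw [Real.rpow_neg (by positivity)]
  norm_cast
  simp only [Nat.reduceSub, pow_one, smul_eq_mul]
  field_simp

/-- The convolution in the first variable with the kernel `k`. -/
noncomputable def kconv {E : Type} [NormedAddCommGroup E] [NormedSpace ℂ E] (k : ℂ → ℂ)
    (h : ℂ × ℂ → E) (p : ℂ × ℂ) : E := ∫ ξ, k ξ • h (p.1 - ξ, p.2)

section kconv
variable {E F : Type} [NormedAddCommGroup E] [NormedSpace ℂ E]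
  [NormedAddCommGroup F] [NormedSpace ℂ F] {U : Set ℂ} {h h' : ℂ × ℂ → E} {k : ℂ → ℂ}

/-- A Peetre-type inequality, 1 + ‖ξ‖ ≤ (1 + ‖t' - ξ‖)(2 + ‖t‖), converts rapid decay into a
majorant in ξ that is uniform for (t', s') near (t, s). It is the domination used under all the
integrals below. -/
theorem BiflatOn.bound_translate (hU : IsOpen U) (hf : BiflatOn U h) (t : ℂ) {s : ℂ} (hs : s ∈ U) :
    ∃ C : ℝ, 0 ≤ C ∧ ∃ r > 0, Metric.ball s r ⊆ U ∧ ∀ t' ∈ Metric.ball t 1,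
      ∀ s' ∈ Metric.ball s r, ∀ ξ, ‖h (t' - ξ, s')‖ ≤ C * ((1 + ‖ξ‖) ^ 3)⁻¹ := by
  obtain ⟨C, hC, r, hr, hb, h1⟩ := hf.decay hU hs 3
  refine ⟨C * (2 + ‖t‖) ^ 3, by positivity, r, hr, hb, fun t' ht' s' hs' ξ => ?_⟩
  have h2 := h1 (t' - ξ) s' hs'
  rw [← div_eq_mul_inv, le_div_iff₀ (by positivity)]
  have h3 : ‖ξ‖ ≤ ‖t' - ξ‖ + ‖t'‖ := by
    have := norm_sub_le t' (t' - ξ)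
    rw [sub_sub_cancel] at this; linarith
  have h4 : ‖t'‖ ≤ 1 + ‖t‖ := by
    have : ‖t' - t‖ < 1 := by simpa [dist_eq_norm] using ht'
    have := norm_le_norm_add_norm_sub' t' t
    linarith
  have h5 : 1 + ‖ξ‖ ≤ (1 + ‖t' - ξ‖) * (2 + ‖t‖) := by
    nlinarith [norm_nonneg (t' - ξ), norm_nonneg t]
  calc ‖h (t' - ξ, s')‖ * (1 + ‖ξ‖) ^ 3
      ≤ ‖h (t' - ξ, s')‖ * ((1 + ‖t' - ξ‖) * (2 + ‖t‖)) ^ 3 := by gcongr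
    _ = ((1 + ‖t' - ξ‖) ^ 3 * ‖h (t' - ξ, s')‖) * (2 + ‖t‖) ^ 3 := by ring
    _ ≤ _ := by gcongr

theorem BiflatOn.aestronglyMeasurable_kconv (hU : IsOpen U) (hf : BiflatOn U h)
    (hk : TemperedKernel k) (t : ℂ) {s : ℂ} (hs : s ∈ U) :
    AEStronglyMeasurable (fun ξ => k ξ • h (t - ξ, s)) := by
  have h1 : Continuous fun ξ => h (t - ξ, s) :=
    (hf.continuous_slice hU hs).comp (continuous_const.sub continuous_id)
  exact hk.meas.aestronglyMeasurable.smul h1.aestronglyMeasurable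

theorem BiflatOn.integrable_kconv (hU : IsOpen U) (hf : BiflatOn U h)
    (hk : TemperedKernel k) (t : ℂ) {s : ℂ} (hs : s ∈ U) :
    Integrable (fun ξ => k ξ • h (t - ξ, s)) := by
  obtain ⟨C, hC, r, hr, hb, h1⟩ := hf.bound_translate hU t hs
  refine Integrable.mono' (hk.int.const_mul C) (hf.aestronglyMeasurable_kconv hU hk t hs)
    (Filter.Eventually.of_forall fun ξ => ?_)
  rw [norm_smul]
  calc _ ≤ ‖k ξ‖ * (C * ((1 + ‖ξ‖) ^ 3)⁻¹) := by
        gcongr; exact h1 t (by simp) s (by simpa using hr) ξ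
    _ = _ := by ring

/-- In the form ∫ k(ξ) h(t - ξ, s) the singularity of k does not move with the parameters, so
differentiation under the integral sign falls entirely on h. -/
theorem BiflatOn.hasFDerivAt_kconv (hU : IsOpen U) (hf : BiflatOn U h)
    (hk : TemperedKernel k) (t : ℂ) {s : ℂ} (hs : s ∈ U) :
    HasFDerivAt (𝕜 := ℝ) (kconv k h) (kconv k (_root_.fderiv ℝ h) (t, s)) (t, s) := by
  obtain ⟨C, hC, r, hr, hb, h1⟩ := (hf.fderiv hU).bound_translate hU t hs
  have hmem : ∀ x ∈ Metric.ball (t, s) (min 1 r), x.1 ∈ Metric.ball t 1 ∧ x.2 ∈ Metric.ball s r := by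
    intro x hx
    rw [Metric.mem_ball, Prod.dist_eq, max_lt_iff, lt_min_iff, lt_min_iff] at hx
    exact ⟨hx.1.1, hx.2.2⟩
  have hball := Metric.ball_mem_nhds (t, s) (lt_min one_pos hr)
  refine hasFDerivAt_integral_of_dominated_of_fderiv_le (𝕜 := ℝ)
    (F := fun x ξ => k ξ • h (x.1 - ξ, x.2))
    (F' := fun x ξ => k ξ • _root_.fderiv ℝ h (x.1 - ξ, x.2))
    (bound := fun ξ => C * (‖k ξ‖ * ((1 + ‖ξ‖) ^ 3)⁻¹))
    hball ?_ (hf.integrable_kconv hU hk t hs)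
    ((hf.fderiv hU).aestronglyMeasurable_kconv hU hk t hs) ?_ (hk.int.const_mul C) ?_
  · filter_upwards [hball] with x hx
    exact hf.aestronglyMeasurable_kconv hU hk x.1 (hb (hmem x hx).2)
  · refine Filter.Eventually.of_forall fun ξ x hx => ?_
    rw [norm_smul]
    calc _ ≤ ‖k ξ‖ * (C * ((1 + ‖ξ‖) ^ 3)⁻¹) := by
          gcongr; exact h1 _ (hmem x hx).1 _ (hmem x hx).2 ξ
      _ = _ := by ring
  · refine Filter.Eventually.of_forall fun ξ x hx => ?_
    have h2 := (hf.zero.differentiableAt hU (t := x.1 - ξ) (hb (hmem x hx).2)).hasFDerivAt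
    have h3 : HasFDerivAt (𝕜 := ℝ) (fun x : ℂ × ℂ => (x.1 - ξ, x.2))
        (ContinuousLinearMap.id ℝ (ℂ × ℂ)) x :=
      ((hasFDerivAt_fst (𝕜 := ℝ) (p := x)).sub_const ξ).prodMk
        (hasFDerivAt_snd (𝕜 := ℝ) (p := x))
    exact (HasFDerivAt.comp (g := h) x h2 h3).const_smul (k ξ)

/-- The induction ranges over all targets E, because each differentiation replaces E by a space of
linear maps. -/
theorem BiflatOn.contDiffOn_kconv_nat (hU : IsOpen U) (hk : TemperedKernel k) (n : ℕ) :
    ∀ (E : Type) [NormedAddCommGroup E] [NormedSpace ℂ E] (h : ℂ × ℂ → E), BiflatOn U h →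
    ContDiffOn ℝ n (kconv k h) (univ ×ˢ U) := by
  induction n with
  | zero =>
    intro E _ _ h hf
    rw [Nat.cast_zero, contDiffOn_zero]
    exact fun p hp => (hf.hasFDerivAt_kconv hU hk p.1 hp.2).continuousAt.continuousWithinAt
  | succ n ih =>
    intro E _ _ h hf
    push_cast
    rw [contDiffOn_succ_iff_fderiv_of_isOpen (isOpen_slab hU)]
    refine ⟨fun p hp =>
      (hf.hasFDerivAt_kconv hU hk p.1 hp.2).differentiableAt.differentiableWithinAt,
      by simp, ?_⟩
    exact (ih _ _ (hf.fderiv hU)).congr fun p hp => (hf.hasFDerivAt_kconv hU hk p.1 hp.2).fderiv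

theorem BiflatOn.contDiffOn_kconv (hU : IsOpen U) (hk : TemperedKernel k) (hf : BiflatOn U h) :
    ContDiffOn ℝ ∞ (kconv k h) (univ ×ˢ U) :=
  contDiffOn_infty.2 fun n => hf.contDiffOn_kconv_nat hU hk n E h

theorem kconv_one (t s : ℂ) : kconv (fun _ => 1) h (t, s) = ∫ ξ, h (ξ, s) := by
  simp only [kconv, one_smul]
  exact integral_sub_left_eq_self (fun ξ => h (ξ, s)) volume t

theorem BiflatOn.integrable (hU : IsOpen U) (hf : BiflatOn U h) {s : ℂ} (hs : s ∈ U) :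
    Integrable fun ξ => h (ξ, s) := by
  have := (hf.integrable_kconv hU temperedKernel_one 0 hs).comp_neg
  simpa using this

/-- Translation invariance plays the role of Stokes: convolution with 1 does not depend on t, while
its t-derivative is the integral of the derivative of h. -/
theorem BiflatOn.integral_fderiv_fst [CompleteSpace E] (hU : IsOpen U) (hf : BiflatOn U h)
    {s : ℂ} (hs : s ∈ U) (v : ℂ) : ∫ ξ, _root_.fderiv ℝ h (ξ, s) (v, 0) = 0 := by
  have h1 := hf.hasFDerivAt_kconv hU temperedKernel_one 0 hs
  have h2 : HasFDerivAt (𝕜 := ℝ) (fun t : ℂ => kconv (fun _ => 1) h (t, s)) _ 0 :=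
    HasFDerivAt.comp (g := kconv (fun _ => 1) h) (f := fun t : ℂ => (t, s)) 0 h1 (hasFDerivAt_prodMk_left (𝕜 := ℝ) (0 : ℂ) s)
  simp only [kconv_one] at h2
  have h3 := DFunLike.congr_fun (h2.unique (hasFDerivAt_const _ _)) v
  simp only [ContinuousLinearMap.comp_apply, ContinuousLinearMap.inl_apply, zero_apply] at h3
  rw [← h3, ContinuousLinearMap.integral_apply ((hf.fderiv hU).integrable hU hs)]

theorem differentiableOn_of_real {g : ℂ → ℂ} {D : ℂ → ℂ →L[ℝ] ℂ}
    (h1 : ∀ s ∈ U, HasFDerivAt (𝕜 := ℝ) g (D s) s)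
    (h2 : ∀ s ∈ U, D s Complex.I = Complex.I * D s 1) : DifferentiableOn ℂ g U := by
  intro s hs
  apply DifferentiableAt.differentiableWithinAt
  rw [differentiableAt_complex_iff_differentiableAt_real]
  refine ⟨(h1 s hs).differentiableAt, ?_⟩
  rw [(h1 s hs).fderiv, h2 s hs, smul_eq_mul]

theorem fderiv_snd_of_holo (hU : IsOpen U) {h : ℂ × ℂ → ℂ} (hd : ∀ t, ∀ s ∈ U,
    DifferentiableAt ℝ h (t, s)) (hol : ∀ t, DifferentiableOn ℂ (fun s => h (t, s)) U)
    (t : ℂ) {s : ℂ} (hs : s ∈ U) :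
    fderiv ℝ h (t, s) (0, Complex.I) = Complex.I * fderiv ℝ h (t, s) (0, 1) := by
  have h2 : HasFDerivAt (𝕜 := ℝ) (fun s' : ℂ => h (t, s'))
      ((fderiv ℝ h (t, s)).comp (ContinuousLinearMap.inr ℝ ℂ ℂ)) s :=
    HasFDerivAt.comp (g := h) (f := fun s' : ℂ => (t, s')) s
      (hd t s hs).hasFDerivAt (hasFDerivAt_prodMk_right t s)
  have h4 := h2.unique
    (((hol t).differentiableAt (hU.mem_nhds hs)).hasFDerivAt.restrictScalars ℝ)
  have e : ∀ w, fderiv ℝ h (t, s) (0, w) = fderiv ℂ (fun s => h (t, s)) s w := fun w => by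
    simpa using DFunLike.congr_fun h4 w
  rw [e, e, ← smul_eq_mul, ← map_smul, smul_eq_mul, mul_one]

/-- The Cauchy-Riemann equation in s passes under the integral sign. -/
theorem BiflatOn.holo_kconv (hU : IsOpen U) (hk : TemperedKernel k) {h : ℂ × ℂ → ℂ}
    (hf : BiflatOn U h) (hol : ∀ t, DifferentiableOn ℂ (fun s => h (t, s)) U) (t : ℂ) :
    DifferentiableOn ℂ (fun s => kconv k h (t, s)) U := by
  have hI := fun s (hs : s ∈ U) => (hf.fderiv hU).integrable_kconv hU hk t hs
  refine differentiableOn_of_real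
    (D := fun s => (kconv k (_root_.fderiv ℝ h) (t, s)).comp (ContinuousLinearMap.inr ℝ ℂ ℂ))
    (fun s hs => ?_) fun s hs => ?_
  · exact HasFDerivAt.comp (g := kconv k h) (f := fun s : ℂ => (t, s)) s
      (hf.hasFDerivAt_kconv hU hk t hs) (hasFDerivAt_prodMk_right (𝕜 := ℝ) t s)
  · simp only [ContinuousLinearMap.comp_apply, ContinuousLinearMap.inr_apply, kconv]
    rw [ContinuousLinearMap.integral_apply (hI s hs), ContinuousLinearMap.integral_apply (hI s hs),
      ← integral_const_mul]
    refine integral_congr_ae (Filter.Eventually.of_forall fun ξ => ?_)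
    simp only [smul_apply, smul_eq_mul]
    rw [fderiv_snd_of_holo hU (fun t s hs => hf.zero.differentiableAt hU hs) hol _ hs]
    ring

end kconv

/-! ### Vanishing moments, flatness of the Cauchy transform, inversion -/

/-- Vanishing of all moments, of positive and negative order, in the first variable. -/
def MomentsVanish {E : Type} [NormedAddCommGroup E] [NormedSpace ℂ E] (U : Set ℂ)
    (h : ℂ × ℂ → E) : Prop := ∀ k : ℤ, ∀ s ∈ U, ∫ ξ : ℂ, ξ ^ k • h (ξ, s) = 0

section moments
variable {E : Type} [NormedAddCommGroup E] [NormedSpace ℂ E] {U : Set ℂ} {h : ℂ × ℂ → E}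

/-- The Leibniz rule; `divAux E 1 e` is v ↦ -v.1 • e, which explains the sign of k. At t = 0 every
term vanishes by flatness, so negative k are allowed. -/
theorem BiflatOn.fderiv_zpow_smul (hU : IsOpen U) (hf : BiflatOn U h) (k : ℤ) (t : ℂ) {s : ℂ}
    (hs : s ∈ U) : _root_.fderiv ℝ (fun p : ℂ × ℂ => p.1 ^ k • h p) (t, s) =
      t ^ k • _root_.fderiv ℝ h (t, s) + (-(k : ℂ) * t ^ (k - 1)) • divAux E 1 (h (t, s)) := by
  by_cases ht : t = 0
  · subst ht
    rw [((hf.zpow_smul hU k).fderiv hU).eq_zero hs, (hf.fderiv hU).eq_zero hs, hf.eq_zero hs]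
    simp
  · have h1 := hasDerivAt_zpow k t (Or.inl ht)
    have h2 : HasFDerivAt (𝕜 := ℝ) (fun p : ℂ × ℂ => p.1 ^ k) _ (t, s) :=
      HasFDerivAt.comp (g := fun z : ℂ => z ^ k) (f := Prod.fst) (t, s)
        (h1.hasFDerivAt.restrictScalars ℝ)
        (hasFDerivAt_fst (𝕜 := ℝ) (E := ℂ) (F := ℂ) (p := (t, s)))
    refine (h2.smul (hf.zero.differentiableAt hU hs).hasFDerivAt).fderiv.trans ?_
    ext v
    · simp only [ContinuousLinearMap.comp_apply, ContinuousLinearMap.inl_apply, add_apply,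
        smul_apply, divAux_apply, smul_smul]
      simp
      ring_nf
    · simp [divAux_apply]

theorem divAux_smul (c : ℂ) (e : E) : divAux E 1 (c • e) = c • divAux E 1 e := by
  ext v <;> simp [divAux_apply, smul_smul, mul_comm]

/-- The k-th moment is identically 0 as a function of (t, s), hence so is its full derivative. The
Leibniz rule writes that derivative as the k-th moment of `fderiv ℝ h` plus a multiple of the moment
k - 1 of h, which is 0. -/
theorem MomentsVanish.fderiv [CompleteSpace E] (hU : IsOpen U) (hf : BiflatOn U h)
    (hm : MomentsVanish U h) : MomentsVanish U (fderiv ℝ h) := by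
  intro k s hs
  have hk := hf.zpow_smul hU k
  have h1 := hk.hasFDerivAt_kconv hU temperedKernel_one 0 hs
  have h2 : HasFDerivAt (𝕜 := ℝ) (kconv (fun _ => 1) fun p : ℂ × ℂ => p.1 ^ k • h p)
      (0 : ℂ × ℂ →L[ℝ] E) (0, s) := by
    refine (hasFDerivAt_const (0 : E) ((0 : ℂ), s)).congr_of_eventuallyEq ?_
    filter_upwards [(isOpen_slab hU).mem_nhds (mem_slab (t := 0) hs)] with p hp
    exact (kconv_one p.1 p.2).trans (hm k p.2 hp.2)
  have h3 := h1.unique h2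
  rw [kconv_one] at h3
  simp only [hf.fderiv_zpow_smul hU k _ hs] at h3
  have i1 : Integrable fun ξ : ℂ => ξ ^ k • _root_.fderiv ℝ h (ξ, s) :=
    ((hf.fderiv hU).zpow_smul hU k).integrable hU hs
  have i2 : Integrable fun ξ : ℂ => -(k : ℂ) • ξ ^ (k - 1) • h (ξ, s) :=
    ((hf.zpow_smul hU (k - 1)).integrable hU hs).smul (-(k : ℂ))
  simp only [mul_smul, ← divAux_smul] at h3
  rw [integral_add i1 ((divAux E 1).integrable_comp i2),
    ContinuousLinearMap.integral_comp_comm _ i2, integral_smul, hm (k - 1) s hs, smul_zero, map_zero, add_zero] at h3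
  exact h3

/-- The value of the Cauchy transform at t = 0 is, up to sign, the moment of order -1. Its
derivative is the Cauchy transform of the derivative of h, which has vanishing moments too, so
induction applies. -/
theorem BiflatOn.iteratedFDeriv_kconv_inv (hU : IsOpen U) (n : ℕ) : ∀ (E : Type)
    [NormedAddCommGroup E] [NormedSpace ℂ E] [CompleteSpace E] (h : ℂ × ℂ → E), BiflatOn U h →
    MomentsVanish U h → ∀ s ∈ U,
    iteratedFDeriv ℝ n (kconv (fun ξ => ξ⁻¹) h) (0, s) = 0 := by
  induction n with
  | zero =>
    intro E _ _ _ h hf hm s hs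
    rw [← norm_eq_zero, norm_iteratedFDeriv_zero, norm_eq_zero]
    have h1 := integral_neg_eq_self (fun ξ : ℂ => (-ξ)⁻¹ • h (ξ, s)) volume
    simp only [neg_neg] at h1
    simp only [kconv, zero_sub]
    rw [h1]
    simp only [inv_neg, neg_smul]
    rw [integral_neg, neg_eq_zero]
    simpa using hm (-1) s hs
  | succ n ih =>
    intro E _ _ _ h hf hm s hs
    rw [← norm_eq_zero, ← norm_iteratedFDeriv_fderiv, norm_eq_zero]
    have e : _root_.fderiv ℝ (kconv (fun ξ => ξ⁻¹) h) =ᶠ[𝓝 (0, s)]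
        kconv (fun ξ => ξ⁻¹) (_root_.fderiv ℝ h) := by
      filter_upwards [(isOpen_slab hU).mem_nhds (mem_slab (t := 0) hs)] with p hp
      exact (hf.hasFDerivAt_kconv hU temperedKernel_inv p.1 hp.2).fderiv
    rw [(e.iteratedFDeriv (𝕜 := ℝ) n).eq_of_nhds]
    exact ih _ _ (hf.fderiv hU) (hm.fderiv hU hf) s hs

/-- The Cauchy transform of a function all of whose moments vanish is flat at the origin. -/
theorem BiflatOn.flatOn_kconv_inv [CompleteSpace E] (hU : IsOpen U) (hf : BiflatOn U h)
    (hm : MomentsVanish U h) : FlatOn U (kconv (fun ξ => ξ⁻¹) h) :=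
  ⟨hf.contDiffOn_kconv hU temperedKernel_inv, fun s hs n =>
    hf.iteratedFDeriv_kconv_inv hU n E h hm s hs⟩

theorem abs_det_mul_complex (a : ℂ) :
    |((ContinuousLinearMap.toSpanSingleton ℂ a).restrictScalars ℝ : ℂ →L[ℝ] ℂ).det| = ‖a‖ ^ 2 := by
  have h := LinearMap.det_restrictScalars (R := ℝ) (A := ℂ)
    (f := (ContinuousLinearMap.toSpanSingleton ℂ a : ℂ →ₗ[ℂ] ℂ))
  have h2 : ((ContinuousLinearMap.toSpanSingleton ℂ a).restrictScalars ℝ : ℂ →L[ℝ] ℂ).det =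
    LinearMap.det (LinearMap.restrictScalars ℝ (ContinuousLinearMap.toSpanSingleton ℂ a : ℂ →ₗ[ℂ] ℂ)) := rfl
  rw [h2, h, Algebra.norm_complex_apply, ← Complex.sq_norm, abs_of_nonneg (by positivity)]
  congr 2
  rw [LinearMap.det_ring]; simp

/-- Change of variables `ξ = 1/η` in integrals over `ℂ`. -/
theorem integral_inv (F : ℂ → E) : ∫ ξ, F ξ = ∫ η : ℂ, ((‖η‖ ^ 4)⁻¹ : ℝ) • F η⁻¹ := by
  have h0 : MeasurableSet ({0}ᶜ : Set ℂ) := (measurableSet_singleton _).compl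
  have hae : ({0}ᶜ : Set ℂ) =ᵐ[volume] univ := by
    rw [ae_eq_univ, compl_compl]; simp
  have himg : (fun z : ℂ => z⁻¹) '' {0}ᶜ = {0}ᶜ := by
    ext z
    constructor
    · rintro ⟨w, hw, rfl⟩; simpa using hw
    · intro hz; exact ⟨z⁻¹, by simpa using hz, inv_inv z⟩
  have key := integral_image_eq_integral_abs_det_fderiv_smul (volume : Measure ℂ) h0
    (f := fun z : ℂ => z⁻¹)
    (f' := fun z => (ContinuousLinearMap.toSpanSingleton ℂ (-(z ^ 2)⁻¹)).restrictScalars ℝ)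
    (fun x hx => ((hasDerivAt_inv hx).hasFDerivAt.restrictScalars ℝ).hasFDerivWithinAt)
    (fun x _ y _ h => inv_injective h) F
  rw [himg, setIntegral_congr_set hae, setIntegral_congr_set hae, setIntegral_univ,
    setIntegral_univ] at key
  rw [key]
  refine integral_congr_ae (Filter.Eventually.of_forall fun z => ?_)
  simp only
  rw [abs_det_mul_complex]
  congr 1
  simp [← pow_mul]

/-- The Cauchy transform and the inversion `t ↦ 1/t`. -/
theorem BiflatOn.kconv_inv_comp_inv (hU : IsOpen U) {h h' : ℂ × ℂ → ℂ} (hf' : BiflatOn U h')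
    (e : ∀ t s, h' (t, s) = ((starRingEnd ℂ) t ^ 2)⁻¹ * h (t⁻¹, s)) {t : ℂ} (ht : t ≠ 0) {s : ℂ}
    (hs : s ∈ U) : kconv (fun ξ => ξ⁻¹) h (t⁻¹, s) =
      -kconv (fun ξ => ξ⁻¹) h' (t, s) - ∫ η, η⁻¹ * h' (η, s) := by
  have shift : ∀ (g : ℂ × ℂ → ℂ) (t : ℂ),
      kconv (fun ξ => ξ⁻¹) g (t, s) = ∫ ξ, (t - ξ)⁻¹ * g (ξ, s) := fun g t => by
    have := integral_sub_left_eq_self (fun ξ : ℂ => (t - ξ)⁻¹ * g (ξ, s)) volume t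
    simp only [sub_sub_cancel] at this
    exact this
  have i1 : Integrable fun ξ => (t - ξ)⁻¹ * h' (ξ, s) := by
    have := (hf'.integrable_kconv hU temperedKernel_inv t hs).comp_sub_left t
    simpa using this
  have i1n : Integrable fun ξ => -((t - ξ)⁻¹ * h' (ξ, s)) := i1.neg
  have i2 : Integrable fun ξ => ξ⁻¹ * h' (ξ, s) := by
    simpa using (hf'.inv_smul_fst hU).integrable hU hs
  rw [shift, shift, integral_inv, ← integral_neg, ← integral_sub i1n i2]
  have hae : ∀ᵐ η : ℂ, η ≠ 0 ∧ η ≠ t := by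
    have h1 : ∀ a : ℂ, ∀ᵐ η : ℂ, η ≠ a := fun a => by
      simp [ae_iff]
    exact (h1 0).and (h1 t)
  refine integral_congr_ae (hae.mono fun η ⟨h0, h1⟩ => ?_)
  beta_reduce
  rw [e, Complex.real_smul]
  have hc : (starRingEnd ℂ) η ≠ 0 := by simpa using h0
  -- The Jacobian splits as η⁻² η̄⁻²: the antiholomorphic half is built into h', the holomorphic
  -- half is absorbed by the kernel.
  have h4 : (((‖η‖ ^ 4)⁻¹ : ℝ) : ℂ) = (η ^ 2)⁻¹ * ((starRingEnd ℂ) η ^ 2)⁻¹ := by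
    rw [← mul_inv, ← mul_pow, Complex.mul_conj']
    push_cast; ring
  have h5 : t - η ≠ 0 := sub_ne_zero.2 (Ne.symm h1)
  have h6 : t⁻¹ - η⁻¹ ≠ 0 := sub_ne_zero.2 fun h => h1 (inv_injective h).symm
  have h7 : (t⁻¹ - η⁻¹)⁻¹ = - t * η * (t - η)⁻¹ := by
    rw [inv_eq_iff_eq_inv]; field_simp; ring
  rw [h4, h7]
  -- Partial fractions: the pole at η = t gives the new Cauchy transform, the pole at η = 0 gives
  -- the term independent of t.
  have h8 : -t * η * (t - η)⁻¹ * (η ^ 2)⁻¹ = - (t - η)⁻¹ - η⁻¹ := by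
    field_simp; ring
  linear_combination (((starRingEnd ℂ) η ^ 2)⁻¹ * h (η⁻¹, s)) * h8

end moments

/-! ### The Cauchy-Pompeiu formula -/

section pompeiu

/-- This expresses ∂/∂t̄ in the rotated frame (e, ie); with e = exp(iθ) it is the polar form of the
operator. -/
theorem wirtBar_rotate (L : ℂ →L[ℝ] ℂ) (e : ℂ) :
    L e + Complex.I * L (Complex.I * e) = (starRingEnd ℂ) e * (L 1 + Complex.I * L Complex.I) := by
  rw [real_lin L e, real_lin L (Complex.I * e)]
  have hb : (starRingEnd ℂ) e = (e.re : ℂ) - e.im * Complex.I := by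
    apply Complex.ext <;> simp
  rw [hb]
  simp
  linear_combination ((e.im : ℂ) * L Complex.I) * Complex.I_sq

/-- The Cauchy-Pompeiu formula for rapidly decreasing functions on the plane. -/
theorem cauchy_pompeiu {χ : ℂ → ℂ} (hχ : ContDiff ℝ 1 χ) {C : ℝ}
    (h0 : Filter.Tendsto χ (Filter.cocompact ℂ) (𝓝 0))
    (h1 : ∀ z, ‖fderiv ℝ χ z‖ ≤ C * ((1 + ‖z‖) ^ 3)⁻¹) :
    ∫ ξ : ℂ, ξ⁻¹ * wirtBar (fderiv ℝ χ ξ) = -(Real.pi : ℂ) * χ 0 := by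
  let e : ℝ → ℂ := fun θ => Complex.exp (θ * Complex.I)
  have hen : ∀ θ, ‖e θ‖ = 1 := fun θ => Complex.norm_exp_ofReal_mul_I θ
  have hec : Continuous e := by fun_prop
  have hzn : ∀ r θ : ℝ, 0 < r → ‖(r : ℂ) * e θ‖ = r := fun r θ hr => by
    rw [norm_mul, hen, mul_one, Complex.norm_real, Real.norm_of_nonneg hr.le]
  -- `A 1` is the radial derivative of χ at r exp(iθ), and `A I` is 1/r times the angular
  -- derivative.
  let A : ℂ → ℝ × ℝ → ℂ := fun c p => fderiv ℝ χ (p.1 * e p.2) (c * e p.2)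
  have hAc : ∀ c, Continuous (A c) := fun c => by
    have h2 := hχ.continuous_fderiv one_ne_zero
    have h3 : Continuous fun p : ℝ × ℝ => (p.1 : ℂ) * e p.2 := by fun_prop
    exact (h2.comp h3).clm_apply (continuous_const.mul (hec.comp continuous_snd))
  have hAb : ∀ c, ‖c‖ = 1 → ∀ r θ : ℝ, 0 < r → ‖A c (r, θ)‖ ≤ C * ((1 + r) ^ 3)⁻¹ :=
    fun c hc r θ hr => by
      refine (ContinuousLinearMap.le_opNorm _ _).trans ?_
      have := h1 (r * e θ)
      rw [hzn r θ hr] at this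
      simpa [hc, hen] using this
  have hint1 : IntegrableOn (fun r : ℝ => C * ((1 + r) ^ 3)⁻¹) (Ioi 0) := by
    have := (integrable_one_add_norm (E := ℝ) (μ := volume) (r := 3) (by simp)).integrableOn
      (s := Ioi 0)
    refine (this.congr_fun (fun y hy => ?_) measurableSet_Ioi).const_mul C
    have hy : 0 < y := hy
    simp only [Real.norm_eq_abs, abs_of_pos hy]
    rw [Real.rpow_neg (by positivity)]
    norm_cast
  have hAi : ∀ c, ‖c‖ = 1 → IntegrableOn (A c) (Ioi 0 ×ˢ Ioo (-Real.pi) Real.pi)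
      (volume.prod volume) := fun c hc => by
    have hb : IntegrableOn (fun p : ℝ × ℝ => (C * ((1 + p.1) ^ 3)⁻¹) * 1)
        (Ioi 0 ×ˢ Ioo (-Real.pi) Real.pi) (volume.prod volume) := by
      rw [IntegrableOn, ← Measure.prod_restrict]
      exact Integrable.mul_prod (μ := volume.restrict (Ioi (0 : ℝ)))
        (f := fun r : ℝ => C * ((1 + r) ^ 3)⁻¹) hint1 (integrable_const (1 : ℝ))
    refine Integrable.mono' hb (hAc c).aestronglyMeasurable ?_
    rw [ae_restrict_iff' (measurableSet_Ioi.prod measurableSet_Ioo)]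
    refine Filter.Eventually.of_forall fun p hp => ?_
    rw [mul_one]
    exact hAb c hc p.1 p.2 hp.1
  -- Integrating in r first, each ray contributes χ(∞) - χ(0) = -χ(0), and the angles contribute 2π.
  have hA1 : ∫ p in Ioi (0 : ℝ) ×ˢ Ioo (-Real.pi) Real.pi, A 1 p ∂(volume.prod volume) =
      -(2 * Real.pi : ℂ) * χ 0 := by
    have hi := hAi 1 (by simp)
    rw [IntegrableOn, ← Measure.prod_restrict] at hi
    rw [← Measure.prod_restrict, integral_prod_symm _ hi]
    have hr : ∀ θ : ℝ, ∫ r in Ioi (0 : ℝ), A 1 (r, θ) = -χ 0 := fun θ => by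
      have hd : ∀ r ∈ Ici (0 : ℝ), HasDerivAt (fun r : ℝ => χ (r * e θ)) (A 1 (r, θ)) r := by
        intro r _
        have h2 : HasDerivAt (fun r : ℝ => (r : ℂ) * e θ) (1 * e θ) r :=
          (Complex.ofRealCLM.hasDerivAt (x := r)).mul_const (e θ)
        exact ((hχ.differentiable one_ne_zero _).hasFDerivAt).comp_hasDerivAt r h2
      have hi2 : IntegrableOn (fun r => A 1 (r, θ)) (Ioi 0) := by
        refine Integrable.mono' hint1
          ((hAc 1).comp (by fun_prop : Continuous fun r : ℝ => (r, θ))).aestronglyMeasurable ?_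
        rw [ae_restrict_iff' measurableSet_Ioi]
        exact Filter.Eventually.of_forall fun r hr => hAb 1 (by simp) r θ hr
      have ht : Filter.Tendsto (fun r : ℝ => χ (r * e θ)) Filter.atTop (𝓝 0) := by
        refine h0.comp ?_
        rw [← Metric.cobounded_eq_cocompact, ← comap_norm_atTop, Filter.tendsto_comap_iff]
        refine Filter.tendsto_id.congr' ?_
        filter_upwards [Filter.eventually_gt_atTop 0] with r hr
        exact (hzn r θ hr).symm
      rw [integral_Ioi_of_hasDerivAt_of_tendsto' hd hi2 ht]
      simp
    simp only [hr]
    rw [integral_const]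
    simp
    rw [max_eq_left (by positivity)]
    left; push_cast; ring
  -- Integrating in θ first, each circle contributes 0 by periodicity.
  have hA2 : ∫ p in Ioi (0 : ℝ) ×ˢ Ioo (-Real.pi) Real.pi, A Complex.I p ∂(volume.prod volume) =
      0 := by
    rw [setIntegral_prod _ (hAi _ (by simp))]
    refine setIntegral_eq_zero_of_forall_eq_zero fun r hr => ?_
    have hr : (0 : ℝ) < r := hr
    rw [← integral_Ioc_eq_integral_Ioo, ← intervalIntegral.integral_of_le (by
      linarith [Real.pi_pos])]
    have hd : ∀ θ ∈ uIcc (-Real.pi) Real.pi,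
        HasDerivAt (fun θ : ℝ => (r : ℂ)⁻¹ * χ (r * e θ)) (A Complex.I (r, θ)) θ := by
      intro θ _
      have h2 : HasDerivAt (fun θ : ℝ => (r : ℂ) * e θ) (r * (e θ * (1 * Complex.I))) θ :=
        ((((Complex.ofRealCLM.hasDerivAt (x := θ)).mul_const Complex.I).cexp)).const_mul _
      have h3 := (((hχ.differentiable one_ne_zero _).hasFDerivAt).comp_hasDerivAt θ h2).const_mul
        (r : ℂ)⁻¹
      refine h3.congr_deriv ?_
      have : (r : ℂ) * (e θ * (1 * Complex.I)) = r • (Complex.I * e θ) := by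
        rw [Complex.real_smul]; ring
      rw [this, map_smul, Complex.real_smul, inv_mul_cancel_left₀ (by exact_mod_cast hr.ne')]
    rw [intervalIntegral.integral_eq_sub_of_hasDerivAt hd
      (((hAc _).comp (by fun_prop : Continuous fun θ : ℝ => (r, θ))).intervalIntegrable _ _)]
    have : e Real.pi = e (-Real.pi) := by
      simp [e, Complex.exp_neg, Complex.exp_pi_mul_I]
    rw [this, sub_self]
  rw [← Complex.integral_comp_polarCoord_symm, polarCoord_target, Measure.volume_eq_prod]
  -- The Jacobian r cancels ‖ξ⁻¹‖ and the phases cancel, so that no singularity is left in polar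
  -- coordinates.
  have hcongr : ∀ p ∈ Ioi (0 : ℝ) ×ˢ Ioo (-Real.pi) Real.pi,
      p.1 • ((Complex.polarCoord.symm p)⁻¹ *
        wirtBar (fderiv ℝ χ (Complex.polarCoord.symm p))) =
      (2 : ℂ)⁻¹ * (A 1 p + Complex.I * A Complex.I p) := by
    rintro ⟨r, θ⟩ ⟨hr, -⟩
    have hr : (r : ℂ) ≠ 0 := by
      have : (0 : ℝ) < r := hr
      exact_mod_cast this.ne'
    have hz : Complex.polarCoord.symm (r, θ) = r * e θ := by
      simp [e, Complex.exp_mul_I]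
    have he : e θ ≠ 0 := Complex.exp_ne_zero _
    have hc : (starRingEnd ℂ) (e θ) = (e θ)⁻¹ := by
      rw [Complex.inv_def, Complex.normSq_eq_norm_sq, hen]; simp
    simp only [A, one_mul]
    rw [wirtBar_rotate, hz, wirtBar, hc, Complex.real_smul]
    field_simp
  rw [setIntegral_congr_fun (measurableSet_Ioi.prod measurableSet_Ioo) hcongr,
    integral_const_mul, integral_add (hAi 1 (by simp)) ((hAi Complex.I (by simp)).const_mul _),
    integral_const_mul, hA1, hA2]
  ring

/-- Apply Cauchy-Pompeiu to ξ ↦ h(t - ξ, s). The reflection changes the sign of the derivative,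
which turns -π into π. Hence π⁻¹ times the Cauchy transform is a right inverse of ∂/∂t̄. -/
theorem BiflatOn.wirtBar_kconv_inv {U : Set ℂ} (hU : IsOpen U) {h : ℂ × ℂ → ℂ} (hf : BiflatOn U h)
    (t : ℂ) {s : ℂ} (hs : s ∈ U) :
    wirtBar (fstPart (_root_.fderiv ℝ (kconv (fun ξ => ξ⁻¹) h) (t, s))) = Real.pi * h (t, s) := by
  have hI := (hf.fderiv hU).integrable_kconv hU temperedKernel_inv t hs
  have hD := hf.hasFDerivAt_kconv hU temperedKernel_inv t hs
  have hs1 : ∀ z, HasFDerivAt (𝕜 := ℝ) (fun ξ => h (t - ξ, s))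
      (-fstPart (_root_.fderiv ℝ h (t - z, s))) z := fun z => by
    have h1 := hasFDerivAt_slice (hf.zero.differentiableAt hU (t := t - z) hs)
    have h2 := HasFDerivAt.comp (g := fun t' => h (t', s)) (f := fun ξ : ℂ => t - ξ) z h1
      ((hasFDerivAt_id (𝕜 := ℝ) z).const_sub t)
    refine h2.congr_fderiv ?_
    ext; simp
  obtain ⟨C, hC, r, hr, hb, hbd⟩ := (hf.fderiv hU).bound_translate hU t hs
  obtain ⟨C', hC', r', hr', hb', hbd'⟩ := hf.bound_translate hU t hs
  have hsmooth : ContDiff ℝ 1 fun ξ => h (t - ξ, s) := by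
    rw [contDiff_iff_contDiffAt]
    intro z
    exact ContDiffAt.comp (g := h) (f := fun ξ : ℂ => (t - ξ, s)) z
      ((hf.zero.contDiffAt hU hs).of_le (by exact_mod_cast le_top)) (by fun_prop)
  have key := cauchy_pompeiu hsmooth (C := C) (by
      refine squeeze_zero_norm (a := fun z : ℂ => C' * ((1 + ‖z‖) ^ 3)⁻¹)
        (fun z => hbd' t (by simp) s (by simpa using hr') z) ?_
      have h1 : Filter.Tendsto (fun z : ℂ => (1 + ‖z‖) ^ 3) (Filter.cocompact ℂ) Filter.atTop :=
        (Filter.tendsto_pow_atTop three_ne_zero).comp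
          (Filter.tendsto_atTop_add_const_left _ _ (tendsto_norm_cocompact_atTop (E := ℂ)))
      simpa using h1.inv_tendsto_atTop.const_mul C') (fun z => by
      rw [(hs1 z).fderiv, norm_neg]
      refine le_trans ?_ (hbd t (by simp) s (by simpa using hr) z)
      refine ContinuousLinearMap.opNorm_le_bound _ (norm_nonneg _) fun v => ?_
      rw [fstPart_apply]
      refine (ContinuousLinearMap.le_opNorm _ _).trans ?_
      simp [Prod.norm_def])
  rw [hD.fderiv, ← wirtBarCLM_apply]
  have hcomm := (wirtBarCLM.comp fstPart).integral_comp_comm hI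
  simp only [ContinuousLinearMap.comp_apply] at hcomm
  rw [kconv, ← hcomm]
  have e1 : ∀ ξ : ℂ, wirtBarCLM (fstPart (ξ⁻¹ • _root_.fderiv ℝ h (t - ξ, s))) =
      -(ξ⁻¹ * wirtBar (_root_.fderiv ℝ (fun ξ => h (t - ξ, s)) ξ)) := fun ξ => by
    rw [(hs1 ξ).fderiv, wirtBarCLM_apply]
    simp only [wirtBar, neg_apply, fstPart_apply, smul_apply, smul_eq_mul]
    ring
  simp only [e1]
  rw [integral_neg, key]
  simp

end pompeiu

/-! ### Sections of 𝒞^{<0} in the affine chart, commutation rules, moments -/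

section sections
variable {V : Opens CmodZ}

/-- A section of `𝒞^{<0}` read in the affine chart of `ℙ¹`. -/
noncomputable def Cflat.fn (f : Cflat V) : ℂ × ℂ → ℂ := inChart affChart f.1

theorem Cflat.fn_apply (f : Cflat V) (t : ℂ) {s : ℂ} (hs : s ∈ fiber V) :
    (Cflat.fn f) (t, s) = f.1 (t : OnePoint ℂ) ⟨s, hs⟩ := inChart_mem _ _ _ hs

/-- `infChart 0` is ∞ whereas `0⁻¹ = 0` designates the origin; the two readings agree because a
section vanishes at both points. -/
theorem Cflat.biflatOn (f : Cflat V) : BiflatOn (fiber V) (Cflat.fn f) := by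
  refine ⟨f.2.1, f.2.2.1.congr (isOpen_fiber V) fun t s hs => ?_⟩
  rw [Cflat.fn_apply _ _ hs, inChart_mem _ _ _ hs]
  by_cases ht : t = 0
  · subst ht
    rw [inv_zero, Cflat_zero f.2, infChart, if_pos rfl, Cflat_infty f.2]
  · rw [infChart, if_neg ht]

theorem Cflat.holo (f : Cflat V) (t : ℂ) :
    DifferentiableOn ℂ (fun s => (Cflat.fn f) (t, s)) (fiber V) := f.2.2.2 (affChart t)

theorem Cflat.ext_fn {f g : Cflat V} (h : ∀ t, ∀ s ∈ fiber V, (Cflat.fn f) (t, s) = (Cflat.fn g) (t, s)) :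
    f = g := by
  refine Subtype.ext (funext fun x => funext fun s => ?_)
  induction x using OnePoint.rec with
  | infty => rw [Cflat_infty f.2, Cflat_infty g.2]
  | coe t =>
    have := h t s s.2
    rwa [Cflat.fn_apply _ _ s.2, Cflat.fn_apply _ _ s.2] at this

/-- The section of `𝒞^{<0}` given by a function of the affine coordinate. -/
noncomputable def Cflat.ofBiflatOn (h : ℂ × ℂ → ℂ) (hf : BiflatOn (fiber V) h)
    (hol : ∀ t, DifferentiableOn ℂ (fun s => h (t, s)) (fiber V)) : Cflat V :=
  ⟨fun x s => x.elim 0 fun t => h (t, s), by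
    refine ⟨hf.zero.congr (isOpen_fiber V) fun t s hs => ?_,
      hf.inf.congr (isOpen_fiber V) fun t s hs => ?_, fun x => ?_⟩
    · rw [inChart_mem _ _ _ hs]; rfl
    · rw [inChart_mem _ _ _ hs]
      by_cases ht : t = 0
      · subst ht
        rw [infChart, if_pos rfl, inv_zero, hf.eq_zero hs]; rfl
      · rw [infChart, if_neg ht]; rfl
    · induction x using OnePoint.rec with
      | infty => exact (Holo V).zero_mem
      | coe t => exact (hol t).congr fun s hs => by rw [extZero_mem _ hs]; rfl⟩

theorem Cflat.fn_ofBiflatOn {h : ℂ × ℂ → ℂ} (hf : BiflatOn (fiber V) h)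
    (hol : ∀ t, DifferentiableOn ℂ (fun s => h (t, s)) (fiber V)) (t : ℂ) {s : ℂ}
    (hs : s ∈ fiber V) : (Cflat.fn (Cflat.ofBiflatOn h hf hol)) (t, s) = h (t, s) :=
  Cflat.fn_apply _ _ hs

theorem Cflat.fn_add (f g : Cflat V) (t : ℂ) {s : ℂ} (hs : s ∈ fiber V) :
    (Cflat.fn (f + g)) (t, s) = (Cflat.fn f) (t, s) + (Cflat.fn g) (t, s) := by
  rw [Cflat.fn_apply _ _ hs, Cflat.fn_apply _ _ hs, Cflat.fn_apply _ _ hs]; rfl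

theorem Cflat.fn_smul (c : ℂ) (f : Cflat V) (t : ℂ) {s : ℂ} (hs : s ∈ fiber V) :
    (Cflat.fn (c • f)) (t, s) = c * (Cflat.fn f) (t, s) := by
  rw [Cflat.fn_apply _ _ hs, Cflat.fn_apply _ _ hs]; rfl

theorem fn_mulT (f : Cflat V) (t : ℂ) {s : ℂ} (hs : s ∈ fiber V) :
    (Cflat.fn (mulT V f)) (t, s) = t * (Cflat.fn f) (t, s) := by
  rw [Cflat.fn_apply _ _ hs, Cflat.fn_apply _ _ hs]; rfl

theorem fn_mulTinv (f : Cflat V) (t : ℂ) {s : ℂ} (hs : s ∈ fiber V) :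
    (Cflat.fn (mulTinv V f)) (t, s) = t⁻¹ * (Cflat.fn f) (t, s) := by
  rw [Cflat.fn_apply _ _ hs, Cflat.fn_apply _ _ hs]; rfl

theorem fn_mulTbar (f : Cflat V) (t : ℂ) {s : ℂ} (hs : s ∈ fiber V) :
    (Cflat.fn (mulTbar V f)) (t, s) = (starRingEnd ℂ) t * (Cflat.fn f) (t, s) := by
  rw [Cflat.fn_apply _ _ hs, Cflat.fn_apply _ _ hs]; rfl

theorem fn_mulS (f : Cflat V) (t : ℂ) {s : ℂ} (hs : s ∈ fiber V) :
    (Cflat.fn (mulS V f)) (t, s) = s * (Cflat.fn f) (t, s) := by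
  rw [Cflat.fn_apply _ _ hs, Cflat.fn_apply _ _ hs]; rfl

theorem fn_tauC (f : Cflat V) (t : ℂ) {s : ℂ} (hs : s ∈ fiber V) :
    (Cflat.fn (tauC V f)) (t, s) = (Cflat.fn f) (t, shiftPt V 1 ⟨s, hs⟩) := by
  rw [Cflat.fn_apply _ _ hs, Cflat.fn_apply _ _ (shiftPt V 1 ⟨s, hs⟩).2]; rfl

theorem fn_resC {W : Opens CmodZ} (h : W ≤ V) (f : Cflat V) (t : ℂ) {s : ℂ} (hs : s ∈ fiber W) :
    (Cflat.fn (resC h f)) (t, s) = (Cflat.fn f) (t, s) := by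
  rw [Cflat.fn_apply _ _ hs, Cflat.fn_apply _ _ (fiber_mono h hs)]; rfl

theorem fn_dt (f : Cflat V) (t : ℂ) {s : ℂ} (hs : s ∈ fiber V) :
    (Cflat.fn (dt V f)) (t, s) = wirt (fstPart (fderiv ℝ (Cflat.fn f) (t, s))) := by
  rw [Cflat.fn_apply _ _ hs]
  exact congrArg wirt (hasFDerivAt_aff f.2 t ⟨s, hs⟩).fderiv

theorem fn_dtbar (f : Cflat V) (t : ℂ) {s : ℂ} (hs : s ∈ fiber V) :
    (Cflat.fn (dtbar V f)) (t, s) = wirtBar (fstPart (fderiv ℝ (Cflat.fn f) (t, s))) := by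
  rw [Cflat.fn_apply _ _ hs]
  exact congrArg wirtBar (hasFDerivAt_aff f.2 t ⟨s, hs⟩).fderiv

theorem Cflat.slice (f : Cflat V) (t : ℂ) {s : ℂ} (hs : s ∈ fiber V) :
    HasFDerivAt (𝕜 := ℝ) (fun t' => (Cflat.fn f) (t', s)) (fstPart (fderiv ℝ (Cflat.fn f) (t, s))) t :=
  hasFDerivAt_slice ((Cflat.biflatOn f).zero.differentiableAt (isOpen_fiber V) hs)

theorem fn_dt_of_hasFDerivAt (f : Cflat V) (t : ℂ) {s : ℂ} (hs : s ∈ fiber V) {g : ℂ → ℂ}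
    {L : ℂ →L[ℝ] ℂ} (e : ∀ t', (Cflat.fn f) (t', s) = g t') (h : HasFDerivAt (𝕜 := ℝ) g L t) :
    (Cflat.fn (dt V f)) (t, s) = wirt L := by
  rw [fn_dt f t hs]
  congr 1
  have e' : (fun t' => (Cflat.fn f) (t', s)) = g := funext e
  exact ((Cflat.slice f) t hs).unique (e' ▸ h)

theorem fn_dtbar_of_hasFDerivAt (f : Cflat V) (t : ℂ) {s : ℂ} (hs : s ∈ fiber V) {g : ℂ → ℂ}
    {L : ℂ →L[ℝ] ℂ} (e : ∀ t', (Cflat.fn f) (t', s) = g t') (h : HasFDerivAt (𝕜 := ℝ) g L t) :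
    (Cflat.fn (dtbar V f)) (t, s) = wirtBar L := by
  rw [fn_dtbar f t hs]
  congr 1
  have e' : (fun t' => (Cflat.fn f) (t', s)) = g := funext e
  exact ((Cflat.slice f) t hs).unique (e' ▸ h)

theorem mulTbar_mulT (f : Cflat V) : mulTbar V (mulT V f) = mulT V (mulTbar V f) :=
  Subtype.ext <| by funext x s; exact mul_left_comm _ _ _

theorem mulTbar_mulTinv (f : Cflat V) : mulTbar V (mulTinv V f) = mulTinv V (mulTbar V f) :=
  Subtype.ext <| by funext x s; exact mul_left_comm _ _ _

theorem mulTbar_mulS (f : Cflat V) : mulTbar V (mulS V f) = mulS V (mulTbar V f) :=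
  Subtype.ext <| by funext x s; exact mul_left_comm _ _ _

theorem dt_mulTbar (f : Cflat V) : dt V (mulTbar V f) = mulTbar V (dt V f) := by
  refine Cflat.ext_fn fun t s hs => ?_
  have h1 : HasFDerivAt (𝕜 := ℝ) (fun t' : ℂ => (starRingEnd ℂ) t')
    (Complex.conjCLE : ℂ →L[ℝ] ℂ) t := (Complex.conjCLE : ℂ →L[ℝ] ℂ).hasFDerivAt
  rw [fn_dt_of_hasFDerivAt _ t hs (fun t' => fn_mulTbar f t' hs) (h1.mul ((Cflat.slice f) t hs)),
    fn_mulTbar _ _ hs, fn_dt _ _ hs]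
  simp [wirt]
  linear_combination (((Cflat.fn f) (t, s)) / 2) * Complex.I_sq

theorem dtbar_mulT (f : Cflat V) : dtbar V (mulT V f) = mulT V (dtbar V f) := by
  refine Cflat.ext_fn fun t s hs => ?_
  have h1 : HasFDerivAt (𝕜 := ℝ) (fun t' : ℂ => t') (ContinuousLinearMap.id ℝ ℂ) t :=
    hasFDerivAt_id t
  rw [fn_dtbar_of_hasFDerivAt _ t hs (fun t' => fn_mulT f t' hs) (h1.mul ((Cflat.slice f) t hs)),
    fn_mulT _ _ hs, fn_dtbar _ _ hs]
  simp [wirtBar]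
  linear_combination (((Cflat.fn f) (t, s)) / 2) * Complex.I_sq

theorem dtbar_mulTinv (f : Cflat V) : dtbar V (mulTinv V f) = mulTinv V (dtbar V f) := by
  have h1 : mulT V (mulTinv V f) = f := LinearMap.congr_fun (mulT_mulTinv V) f
  have h2 : ∀ g, mulTinv V (mulT V g) = g := LinearMap.congr_fun (mulTinv_mulT V)
  rw [← h2 (dtbar V (mulTinv V f)), ← dtbar_mulT, h1]

theorem dtbar_mulS (f : Cflat V) : dtbar V (mulS V f) = mulS V (dtbar V f) := by
  refine Cflat.ext_fn fun t s hs => ?_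
  rw [fn_dtbar_of_hasFDerivAt _ t hs (fun t' => fn_mulS f t' hs) (((Cflat.slice f) t hs).const_mul s),
    fn_mulS _ _ hs, fn_dtbar _ _ hs]
  simp [wirtBar]
  ring

theorem dtbar_dt (f : Cflat V) : dtbar V (dt V f) = dt V (dtbar V f) := by
  refine Cflat.ext_fn fun t s hs => ?_
  have hc := (Cflat.biflatOn f).zero.contDiffAt (isOpen_fiber V) (t := t) hs
  have hd : DifferentiableAt ℝ (fderiv ℝ (Cflat.fn f)) (t, s) :=
    (hc.fderiv_right (m := 1) (by norm_cast)).differentiableAt one_ne_zero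
  have hsl : HasFDerivAt (𝕜 := ℝ) (fun t' : ℂ => fderiv ℝ (Cflat.fn f) (t', s)) _ t :=
    HasFDerivAt.comp (g := fderiv ℝ (Cflat.fn f)) (f := fun t' : ℂ => (t', s)) t hd.hasFDerivAt
      (hasFDerivAt_prodMk_left t s)
  have hsym : IsSymmSndFDerivAt ℝ (Cflat.fn f) (t, s) := hc.isSymmSndFDerivAt (by
    rw [minSmoothness_of_isRCLikeNormedField]; exact WithTop.coe_le_coe.2 le_top)
  rw [fn_dtbar_of_hasFDerivAt _ t hs
    (fun t' => (fn_dt f t' hs).trans (wirtCLM_apply _).symm)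
    ((wirtCLM.comp fstPart).hasFDerivAt.comp t hsl),
    fn_dt_of_hasFDerivAt _ t hs
    (fun t' => (fn_dtbar f t' hs).trans (wirtBarCLM_apply _).symm)
    ((wirtBarCLM.comp fstPart).hasFDerivAt.comp t hsl)]
  have e1 := hsym (Complex.I, 0) (1, 0)
  simp only [wirt, wirtBar, ContinuousLinearMap.comp_apply, wirtCLM_apply, wirtBarCLM_apply,
    fstPart_apply, ContinuousLinearMap.inl_apply, e1]
  ring

/-- Multiplication by the inverse of `t̄`. -/
noncomputable def mulTbarInv (f : Cflat V) : Cflat V :=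
  Cflat.ofBiflatOn (fun p => ((starRingEnd ℂ) p.1)⁻¹ * (Cflat.fn f) p)
    ((Cflat.biflatOn f).conj_inv_smul (isOpen_fiber V)) fun t => (Cflat.holo f t).const_mul ((starRingEnd ℂ) t)⁻¹

theorem fn_mulTbarInv (f : Cflat V) (t : ℂ) {s : ℂ} (hs : s ∈ fiber V) :
    (Cflat.fn (mulTbarInv f)) (t, s) = ((starRingEnd ℂ) t)⁻¹ * (Cflat.fn f) (t, s) := by
  rw [mulTbarInv, Cflat.fn_ofBiflatOn _ _ _ hs]

theorem mulTbar_mulTbarInv (f : Cflat V) : mulTbar V (mulTbarInv f) = f := by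
  refine Cflat.ext_fn fun t s hs => ?_
  rw [fn_mulTbar _ _ hs, fn_mulTbarInv _ _ hs]
  by_cases ht : t = 0
  · subst ht; rw [(Cflat.biflatOn f).eq_zero hs]; simp
  · exact mul_inv_cancel_left₀ (by simpa using ht) _

theorem mulTbarInv_mulTbar (f : Cflat V) : mulTbarInv (mulTbar V f) = f := by
  refine Cflat.ext_fn fun t s hs => ?_
  rw [fn_mulTbarInv _ _ hs, fn_mulTbar _ _ hs]
  by_cases ht : t = 0
  · subst ht; rw [(Cflat.biflatOn f).eq_zero hs]; simp
  · exact inv_mul_cancel_left₀ (by simpa using ht) _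

theorem dt_mulTbarInv (f : Cflat V) : dt V (mulTbarInv f) = mulTbarInv (dt V f) := by
  rw [← mulTbarInv_mulTbar (dt V (mulTbarInv f)), ← dt_mulTbar, mulTbar_mulTbarInv]

theorem mulTbarInv_mulT (f : Cflat V) : mulTbarInv (mulT V f) = mulT V (mulTbarInv f) := by
  rw [← mulTbarInv_mulTbar (mulT V (mulTbarInv f)), mulTbar_mulT, mulTbar_mulTbarInv]

/-- The integral over `ℂ` of `ξ ^ k f(ξ, s)`. -/
noncomputable def Cflat.mom (f : Cflat V) (k : ℤ) (s : ℂ) : ℂ := ∫ ξ : ℂ, ξ ^ k * (Cflat.fn f) (ξ, s)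

theorem Cflat.integrable_mom (f : Cflat V) (k : ℤ) {s : ℂ} (hs : s ∈ fiber V) :
    Integrable fun ξ : ℂ => ξ ^ k * (Cflat.fn f) (ξ, s) :=
  ((Cflat.biflatOn f).zpow_smul (isOpen_fiber V) k).integrable (isOpen_fiber V) hs

theorem Cflat.differentiableOn_mom (f : Cflat V) (k : ℤ) :
    DifferentiableOn ℂ ((Cflat.mom f) k) (fiber V) := by
  have := ((Cflat.biflatOn f).zpow_smul (isOpen_fiber V) k).holo_kconv (isOpen_fiber V)
    temperedKernel_one (fun t => ((Cflat.holo f) t).const_smul (t ^ k)) 0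
  simp only [kconv_one] at this
  exact this

theorem Cflat.mom_mulT (f : Cflat V) (k : ℤ) {s : ℂ} (hs : s ∈ fiber V) :
    (Cflat.mom (mulT V f)) k s = (Cflat.mom f) (k + 1) s := by
  refine integral_congr_ae (Filter.Eventually.of_forall fun ξ => ?_)
  simp only [fn_mulT f ξ hs]
  -- For k = -1 the rule ξ^k ξ = ξ^(k+1) fails at ξ = 0; the vanishing of f there makes up for it.
  by_cases h : ξ = 0
  · subst h; rw [(Cflat.biflatOn f).eq_zero hs]; simp
  · rw [zpow_add_one₀ h, mul_assoc]

/-- Stokes for an arbitrary first-order operator L in t, to be used with L = ∂/∂t and L = ∂/∂t̄. -/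
theorem Cflat.integral_clm_fderiv (f : Cflat V) (k : ℤ) {s : ℂ} (hs : s ∈ fiber V)
    (L : (ℂ →L[ℝ] ℂ) →L[ℝ] ℂ) :
    ∫ ξ : ℂ, L (fstPart (fderiv ℝ (fun p : ℂ × ℂ => p.1 ^ k • (Cflat.fn f) p) (ξ, s))) = 0 := by
  have hb := (Cflat.biflatOn f).zpow_smul (isOpen_fiber V) k
  have hI := (hb.fderiv (isOpen_fiber V)).integrable (isOpen_fiber V) hs
  have hcomm := (L.comp fstPart).integral_comp_comm hI
  simp only [ContinuousLinearMap.comp_apply] at hcomm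
  rw [hcomm]
  have : fstPart (∫ ξ : ℂ, fderiv ℝ (fun p : ℂ × ℂ => p.1 ^ k • (Cflat.fn f) p) (ξ, s)) = 0 := by
    ext v
    rw [fstPart_apply, ContinuousLinearMap.integral_apply hI,
      hb.integral_fderiv_fst (isOpen_fiber V) hs]
    simp
  rw [this, map_zero]

theorem Cflat.mom_dt (f : Cflat V) (k : ℤ) {s : ℂ} (hs : s ∈ fiber V) :
    (Cflat.mom (dt V f)) k s = -k * (Cflat.mom f) (k - 1) s := by
  have h := (Cflat.integral_clm_fderiv f) k hs wirtCLM
  have e : ∀ ξ, wirtCLM (fstPart (fderiv ℝ (fun p : ℂ × ℂ => p.1 ^ k • (Cflat.fn f) p) (ξ, s))) =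
      ξ ^ k * (Cflat.fn (dt V f)) (ξ, s) + k * (ξ ^ (k - 1) * (Cflat.fn f) (ξ, s)) := fun ξ => by
    rw [(Cflat.biflatOn f).fderiv_zpow_smul (isOpen_fiber V) k ξ hs, wirtCLM_apply, fn_dt _ _ hs]
    simp only [wirt, fstPart_apply, add_apply, smul_apply, divAux_apply, smul_eq_mul]
    push_cast
    linear_combination (-(k : ℂ) * ξ ^ (k - 1) * (Cflat.fn f) (ξ, s) / 2) * Complex.I_sq
  simp only [e] at h
  rw [integral_add ((Cflat.integrable_mom (dt V f)) k hs) (((Cflat.integrable_mom f) (k - 1) hs).const_mul _),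
    integral_const_mul] at h
  rw [Cflat.mom, Cflat.mom]
  linear_combination h

/-- Since ξ^k is holomorphic off 0, ∂/∂t̄ of ξ^k f is ξ^k ∂f/∂t̄, and flatness removes the singular
point. This is the easy inclusion, image into kernel. -/
theorem Cflat.mom_dtbar (f : Cflat V) (k : ℤ) {s : ℂ} (hs : s ∈ fiber V) :
    (Cflat.mom (dtbar V f)) k s = 0 := by
  have h := (Cflat.integral_clm_fderiv f) k hs wirtBarCLM
  have e : ∀ ξ, wirtBarCLM (fstPart (fderiv ℝ (fun p : ℂ × ℂ => p.1 ^ k • (Cflat.fn f) p) (ξ, s))) =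
      ξ ^ k * (Cflat.fn (dtbar V f)) (ξ, s) := fun ξ => by
    rw [(Cflat.biflatOn f).fderiv_zpow_smul (isOpen_fiber V) k ξ hs, wirtBarCLM_apply, fn_dtbar _ _ hs]
    simp only [wirtBar, fstPart_apply, add_apply, smul_apply, divAux_apply, smul_eq_mul]
    push_cast
    linear_combination ((k : ℂ) * ξ ^ (k - 1) * (Cflat.fn f) (ξ, s) / 2) * Complex.I_sq
  simp only [e] at h
  exact h

end sections

/-! ### The morphism ε as the moment map -/

section epsilon
variable {V : Opens CmodZ}

/-- As t, t⁻¹ and t∂_t generate `TorusD`, linearity over it need only be checked on them. -/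
theorem weylAction_comm {M N : Type} [AddCommGroup M] [Module ℂ M] [AddCommGroup N] [Module ℂ N]
    {T Ti Th : Module.End ℂ M} {h1 : T * Ti = 1} {h2 : Ti * T = 1} {h3 : Th * T = T * Th + T}
    {T' Ti' Th' : Module.End ℂ N} {h1' : T' * Ti' = 1} {h2' : Ti' * T' = 1}
    {h3' : Th' * T' = T' * Th' + T'} (L : M →ₗ[ℂ] N) (e1 : ∀ m, L (T m) = T' (L m))
    (e2 : ∀ m, L (Ti m) = Ti' (L m)) (e3 : ∀ m, L (Th m) = Th' (L m)) (P : TorusD) (m : M) :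
    L (weylAction T Ti Th h1 h2 h3 P m) = weylAction T' Ti' Th' h1' h2' h3' P (L m) := by
  obtain ⟨x, rfl⟩ := RingQuot.mkAlgHom_surjective ℂ WeylRel P
  induction x using FreeAlgebra.induction generalizing m with
  | grade0 c => simp [AlgHom.commutes, Module.algebraMap_end_apply]
  | grade1 g => cases g <;> simp [weylAction, e1, e2, e3]
  | mul a b ha hb => simp only [map_mul, Module.End.mul_apply, ha, hb]
  | add a b ha hb => simp only [map_add, LinearMap.add_apply, ha, hb]

theorem mulTbarInv_add (f g : Cflat V) : mulTbarInv (f + g) = mulTbarInv f + mulTbarInv g := by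
  rw [← mulTbarInv_mulTbar (mulTbarInv f + mulTbarInv g), map_add, mulTbar_mulTbarInv,
    mulTbar_mulTbarInv]

theorem mulTbarInv_smul (c : ℂ) (f : Cflat V) : mulTbarInv (c • f) = c • mulTbarInv f := by
  rw [← mulTbarInv_mulTbar (c • mulTbarInv f), map_smul, mulTbar_mulTbarInv]

theorem mulTbarInv_mulTinv (f : Cflat V) : mulTbarInv (mulTinv V f) = mulTinv V (mulTbarInv f) := by
  rw [← mulTbarInv_mulTbar (mulTinv V (mulTbarInv f)), mulTbar_mulTinv, mulTbar_mulTbarInv]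

theorem mulTbarInv_mulS (f : Cflat V) : mulTbarInv (mulS V f) = mulS V (mulTbarInv f) := by
  rw [← mulTbarInv_mulTbar (mulS V (mulTbarInv f)), mulTbar_mulS, mulTbar_mulTbarInv]

theorem Cflat.mom_add (f g : Cflat V) (k : ℤ) {s : ℂ} (hs : s ∈ fiber V) :
    Cflat.mom (f + g) k s = Cflat.mom f k s + Cflat.mom g k s := by
  rw [Cflat.mom, Cflat.mom, Cflat.mom, ← integral_add (Cflat.integrable_mom f k hs)
    (Cflat.integrable_mom g k hs)]
  simp only [Cflat.fn_add _ _ _ hs, mul_add]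

theorem Cflat.mom_smul (c : ℂ) (f : Cflat V) (k : ℤ) {s : ℂ} (hs : s ∈ fiber V) :
    Cflat.mom (c • f) k s = c * Cflat.mom f k s := by
  rw [Cflat.mom, Cflat.mom, ← integral_const_mul]
  simp only [Cflat.fn_smul _ _ _ hs, mul_left_comm]

theorem Cflat.mom_mulS (f : Cflat V) (k : ℤ) {s : ℂ} (hs : s ∈ fiber V) :
    Cflat.mom (mulS V f) k s = s * Cflat.mom f k s := by
  rw [Cflat.mom, Cflat.mom, ← integral_const_mul]
  simp only [fn_mulS _ _ hs, mul_left_comm]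

/-- The coefficients `c_k(f) = (1/π) ∫ f(ξ, s) ξ^{-k} |ξ|⁻² dx dy`. -/
noncomputable def moments (V : Opens CmodZ) : Cflat V →ₗ[ℂ] (ℤ → Holo V) where
  -- The exponent comes from ξ^(-k) |ξ|⁻² = ξ^(-k-1) ξ̄⁻¹, the factor ξ̄⁻¹ being carried by
  -- `mulTbarInv`.
  toFun f k := ⟨fun s => (Real.pi : ℂ)⁻¹ * Cflat.mom (mulTbarInv f) (-k - 1) s,
    ((Cflat.differentiableOn_mom (mulTbarInv f) (-k - 1)).const_mul _).congr fun s hs => by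
      rw [extZero_mem _ hs]⟩
  map_add' f g := by
    refine funext fun k => Subtype.ext (funext fun s => ?_)
    change (Real.pi : ℂ)⁻¹ * Cflat.mom _ _ _ =
      (Real.pi : ℂ)⁻¹ * Cflat.mom _ _ _ + (Real.pi : ℂ)⁻¹ * Cflat.mom _ _ _
    rw [mulTbarInv_add, Cflat.mom_add _ _ _ s.2, mul_add]
  map_smul' c f := by
    refine funext fun k => Subtype.ext (funext fun s => ?_)
    change (Real.pi : ℂ)⁻¹ * Cflat.mom _ _ _ = c * ((Real.pi : ℂ)⁻¹ * Cflat.mom _ _ _)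
    rw [mulTbarInv_smul, Cflat.mom_smul _ _ _ s.2, mul_left_comm]

theorem moments_apply (f : Cflat V) (k : ℤ) (s : fiber V) :
    (moments V f k).1 s = (Real.pi : ℂ)⁻¹ * Cflat.mom (mulTbarInv f) (-k - 1) s := rfl

theorem holo_ext {a b : Holo V} (h : ∀ s, a.1 s = b.1 s) : a = b := Subtype.ext (funext h)

theorem moments_mulT (f : Cflat V) (k : ℤ) : moments V (mulT V f) k = moments V f (k - 1) := by
  refine holo_ext fun s => ?_
  rw [moments_apply, moments_apply, mulTbarInv_mulT, Cflat.mom_mulT _ _ s.2]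
  ring_nf

theorem moments_mulTinv (f : Cflat V) (k : ℤ) :
    moments V (mulTinv V f) k = moments V f (k + 1) := by
  have h : mulT V (mulTinv V f) = f := LinearMap.congr_fun (mulT_mulTinv V) f
  have h' := moments_mulT (mulTinv V f) (k + 1)
  rw [h, add_sub_cancel_right] at h'
  exact h'.symm

/-- Integration by parts against ξ^(-k) produces the factor k of t ∂/∂t on t^k; the part -s - 1
passes through the integral. -/
theorem moments_thetaC (f : Cflat V) :
    moments V (thetaC V f) = biTheta V (moments V f) := by
  have e : thetaC V f = mulT V (dt V f) - mulS V f - f := rfl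
  rw [e, map_sub, map_sub]
  refine funext fun k => holo_ext fun s => ?_
  show (moments V (mulT V (dt V f)) k).1 s - (moments V (mulS V f) k).1 s - (moments V f k).1 s =
    (((k : Holo V)).1 s) * (moments V f k).1 s - s * (moments V f k).1 s - (moments V f k).1 s
  have hk : ((k : Holo V)).1 s = k := by
    simp
  rw [hk, moments_apply, moments_apply, moments_apply, mulTbarInv_mulT, ← dt_mulTbarInv,
    mulTbarInv_mulS, Cflat.mom_mulT _ _ s.2, Cflat.mom_dt _ _ s.2, Cflat.mom_mulS _ _ s.2]
  simp only [sub_add_cancel]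
  push_cast
  ring

theorem moments_mulTbar_dtbar (f : Cflat V) : moments V (mulTbar V (dtbar V f)) = 0 := by
  refine funext fun k => holo_ext fun s => ?_
  rw [moments_apply, mulTbarInv_mulTbar, Cflat.mom_dtbar _ _ s.2, mul_zero]; rfl

theorem moments_tauC (f : Cflat V) (k : ℤ) :
    moments V (tauC V f) k = holoShift V 1 (moments V f k) := by
  refine holo_ext fun s => ?_
  change (Real.pi : ℂ)⁻¹ * Cflat.mom _ _ _ = (Real.pi : ℂ)⁻¹ * Cflat.mom _ _ _
  congr 1
  refine integral_congr_ae (Filter.Eventually.of_forall fun ξ => ?_)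
  simp only
  rw [fn_mulTbarInv _ _ s.2, fn_tauC _ _ s.2, fn_mulTbarInv _ _ (shiftPt V 1 s).2]

theorem moments_resC {W : Opens CmodZ} (h : W ≤ V) (f : Cflat V) (k : ℤ) :
    moments W (resC h f) k = holoRes h (moments V f k) := by
  refine holo_ext fun s => ?_
  change (Real.pi : ℂ)⁻¹ * Cflat.mom _ _ _ = (Real.pi : ℂ)⁻¹ * Cflat.mom _ _ _
  congr 1
  refine integral_congr_ae (Filter.Eventually.of_forall fun ξ => ?_)
  simp only
  rw [fn_mulTbarInv _ _ s.2, fn_resC _ _ _ s.2, fn_mulTbarInv _ _ (fiber_mono h s.2)]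

/-- The morphism `ε`. -/
noncomputable def epsilon (V : Opens CmodZ) : Cflat V →ₗ[TorusD] Tails V where
  -- The moments serve as definition, which makes linearity algebraic; `epsilon_eq` and the two
  -- `isExpansion` theorems recover the asymptotic description.
  toFun f := (tailsEquiv V).symm (moments V f)
  map_add' f g := by rw [map_add, map_add]
  map_smul' P f := by
    apply (tailsEquiv V).injective
    rw [RingHom.id_apply, tailsEquiv_smul, LinearEquiv.apply_symm_apply,
      LinearEquiv.apply_symm_apply]
    refine weylAction_comm (moments V) (fun f => ?_) (fun f => ?_) moments_thetaC P f
    · exact funext fun k => moments_mulT f k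
    · refine funext fun k => (moments_mulTinv f k).trans ?_
      exact congrArg (moments V f) (by ring)

theorem tailsEquiv_epsilon (f : Cflat V) : tailsEquiv V (epsilon V f) = moments V f :=
  LinearEquiv.apply_symm_apply _ _

/-- `∂/∂t̄` as a `D`-linear map. -/
noncomputable def dtbarD (V : Opens CmodZ) : Cflat V →ₗ[TorusD] Cflat V where
  toFun f := dtbar V f
  map_add' := map_add _
  map_smul' P f := by
    refine weylAction_comm (dtbar V) dtbar_mulT dtbar_mulTinv (fun f => ?_) P f
    change dtbar V (mulT V (dt V f) - mulS V f - f) =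
      mulT V (dt V (dtbar V f)) - mulS V (dtbar V f) - dtbar V f
    rw [map_sub, map_sub, dtbar_mulT, dtbar_mulS, dtbar_dt]

/-- Multiplication by `t̄` as a `D`-linear map. -/
noncomputable def mulTbarD (V : Opens CmodZ) : Cflat V →ₗ[TorusD] Cflat V where
  toFun f := mulTbar V f
  map_add' := map_add _
  map_smul' P f := by
    refine weylAction_comm (mulTbar V) mulTbar_mulT mulTbar_mulTinv (fun f => ?_) P f
    change mulTbar V (mulT V (dt V f) - mulS V f - f) =
      mulT V (dt V (mulTbar V f)) - mulS V (mulTbar V f) - mulTbar V f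
    rw [map_sub, map_sub, mulTbar_mulT, mulTbar_mulS, dt_mulTbar]

theorem tailsEquiv_tinv_smul (q : Tails V) (k : ℤ) :
    tailsEquiv V (TorusD.tinv • q) k = tailsEquiv V q (k + 1) := by
  rw [tailsEquiv_smul]
  simp [biAction, weylAction, TorusD.tinv, biShift]

theorem epsilon_tau (f : Cflat V) : epsilon V (tauC V (TorusD.tinv • f)) =
    tauTails V (TorusD.tinv • epsilon V f) := by
  apply (tailsEquiv V).injective
  have e : tailsEquiv V (tauTails V (TorusD.tinv • epsilon V f)) = fun k =>
      holoShift V 1 (tailsEquiv V (TorusD.tinv • epsilon V f) k) :=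
    LinearEquiv.apply_symm_apply _ _
  rw [e, tailsEquiv_epsilon]
  funext k
  rw [tailsEquiv_tinv_smul, tailsEquiv_epsilon, moments_tauC, tinv_smul, moments_mulTinv]

theorem epsilon_res {W : Opens CmodZ} (h : W ≤ V) (f : Cflat V) :
    epsilon W (resC h f) = resTails h (epsilon V f) := by
  apply (tailsEquiv W).injective
  have e : tailsEquiv W (resTails h (epsilon V f)) = fun k =>
      holoRes h (tailsEquiv V (epsilon V f) k) := LinearEquiv.apply_symm_apply _ _
  rw [e, tailsEquiv_epsilon, tailsEquiv_epsilon]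
  exact funext fun k => moments_resC h f k

end epsilon

/-! ### Asymptotic expansions of K * f -/

section expansion
variable {V : Opens CmodZ}

/-- The Cauchy transform of `f / t̄`. -/
noncomputable def cauchy (f : Cflat V) : ℂ × ℂ → ℂ :=
  kconv (fun ξ => ξ⁻¹) (Cflat.fn (mulTbarInv f))

theorem cauchy_eq (f : Cflat V) (t s : ℂ) :
    cauchy f (t, s) = ∫ ξ, (t - ξ)⁻¹ * Cflat.fn (mulTbarInv f) (ξ, s) := by
  have := integral_sub_left_eq_self
    (fun ξ : ℂ => (t - ξ)⁻¹ * Cflat.fn (mulTbarInv f) (ξ, s)) volume t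
  simp only [sub_sub_cancel] at this
  exact this

theorem integrable_cauchy (f : Cflat V) (t : ℂ) {s : ℂ} (hs : s ∈ fiber V) :
    Integrable fun ξ => (t - ξ)⁻¹ * Cflat.fn (mulTbarInv f) (ξ, s) := by
  have := ((Cflat.biflatOn (mulTbarInv f)).integrable_kconv (isOpen_fiber V)
    temperedKernel_inv t hs).comp_sub_left t
  simpa using this

theorem ae_ne_zero_and_ne (t : ℂ) : ∀ᵐ ξ : ℂ, ξ ≠ 0 ∧ ξ ≠ t := by
  have h1 : ∀ a : ℂ, ∀ᵐ ξ : ℂ, ξ ≠ a := fun a => by simp [ae_iff]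
  exact (h1 0).and (h1 t)

/-- The constants combine to K(ξ/t) (-2i) = -π⁻¹ t/(t - ξ), and of the remaining |ξ|⁻² the factor
ξ⁻¹ goes to `mulTinv`, ξ̄⁻¹ to `mulTbarInv`. -/
theorem convIntegrand_ae_eq (f : Cflat V) {t : ℂ} (ht : t ≠ 0) (s : fiber V) :
    convIntegrand f t s =ᵐ[volume] fun ξ => -((Real.pi : ℂ)⁻¹ * t) *
      ((t - ξ)⁻¹ * Cflat.fn (mulTbarInv (mulTinv V f)) (ξ, s)) := by
  refine (ae_ne_zero_and_ne t).mono fun ξ ⟨h0, h1⟩ => ?_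
  beta_reduce
  rw [convIntegrand, kernelK, fn_mulTbarInv _ _ s.2, fn_mulTinv _ _ s.2, Cflat.fn_apply _ _ s.2]
  have hc : (starRingEnd ℂ) ξ ≠ 0 := by simpa using h0
  have hp : (Real.pi : ℂ) ≠ 0 := by exact_mod_cast Real.pi_ne_zero
  have h2 : t - ξ ≠ 0 := sub_ne_zero.2 (Ne.symm h1)
  have h3 : ξ / t - 1 = -(t - ξ) / t := by field_simp; ring
  rw [h3]
  field_simp

theorem integrable_convIntegrand (f : Cflat V) {t : ℂ} (ht : t ≠ 0) (s : fiber V) :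
    Integrable (convIntegrand f t s) :=
  ((integrable_cauchy (mulTinv V f) t s.2).const_mul _).congr (convIntegrand_ae_eq f ht s).symm

theorem convK_eq_mul_cauchy (f : Cflat V) {t : ℂ} (ht : t ≠ 0) (s : fiber V) :
    convK f t s = -((Real.pi : ℂ)⁻¹ * t) * cauchy (mulTinv V f) (t, s) := by
  rw [convK, integral_congr_ae (convIntegrand_ae_eq f ht s), integral_const_mul, cauchy_eq]

/-- From t/(ξ(t - ξ)) = 1/ξ + 1/(t - ξ). Unlike `convK_eq_mul_cauchy` this form has no factor t,
hence suits t → ∞. -/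
theorem convK_eq_cauchy (f : Cflat V) {t : ℂ} (ht : t ≠ 0) (s : fiber V) :
    convK f t s = -(moments V f 0).1 s - (Real.pi : ℂ)⁻¹ * cauchy f (t, s) := by
  have hi : Integrable fun ξ : ℂ => -((Real.pi : ℂ)⁻¹ *
      (ξ ^ (-0 - 1 : ℤ) * Cflat.fn (mulTbarInv f) (ξ, s))) :=
    ((Cflat.integrable_mom (mulTbarInv f) (-0 - 1) s.2).const_mul _).neg
  rw [convK_eq_mul_cauchy f ht, moments_apply, cauchy_eq, cauchy_eq, Cflat.mom,
    ← integral_const_mul, ← integral_const_mul, ← integral_const_mul, ← integral_neg,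
    ← integral_sub hi ((integrable_cauchy f t s.2).const_mul _)]
  refine integral_congr_ae ((ae_ne_zero_and_ne t).mono fun ξ ⟨h0, h1⟩ => ?_)
  beta_reduce
  rw [mulTbarInv_mulTinv, fn_mulTinv _ _ s.2]
  have h2 : t - ξ ≠ 0 := sub_ne_zero.2 (Ne.symm h1)
  have e : ξ ^ (-0 - 1 : ℤ) = ξ⁻¹ := by norm_num
  rw [e]
  have h3 : t * (t - ξ)⁻¹ * ξ⁻¹ = ξ⁻¹ + (t - ξ)⁻¹ := by field_simp; ring
  linear_combination (-(Real.pi : ℂ)⁻¹ * Cflat.fn (mulTbarInv f) (ξ, s)) * h3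

/-- One step of the geometric series for the kernel: the leading term at 0 is split off, with an
exact remainder of the same shape. `convK_mulT` is its counterpart at ∞. -/
theorem convK_mulTinv (f : Cflat V) {t : ℂ} (ht : t ≠ 0) (s : fiber V) :
    convK f t s = (moments V f 1).1 s * t + t * convK (mulTinv V f) t s := by
  rw [convK_eq_mul_cauchy f ht, convK_eq_cauchy _ ht, moments_mulTinv, zero_add]
  ring

theorem convK_mulT (f : Cflat V) {t : ℂ} (ht : t ≠ 0) (s : fiber V) :
    convK f t s = -(moments V f 0).1 s + t⁻¹ * convK (mulT V f) t s := by
  have h : mulTinv V (mulT V f) = f := LinearMap.congr_fun (mulTinv_mulT V) f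
  rw [convK_eq_cauchy f ht, convK_eq_mul_cauchy _ ht, h]
  field_simp
  ring

theorem moments_iterate_mulTinv (f : Cflat V) (n : ℕ) (k : ℤ) :
    moments V ((mulTinv V)^[n] f) k = moments V f (k + n) := by
  induction n generalizing k with
  | zero => simp
  | succ n ih =>
    rw [Function.iterate_succ_apply', moments_mulTinv, ih]
    exact congrArg (moments V f) (by push_cast; ring)

theorem moments_iterate_mulT (f : Cflat V) (n : ℕ) (k : ℤ) :
    moments V ((mulT V)^[n] f) k = moments V f (k - n) := by
  induction n generalizing k with
  | zero => simp
  | succ n ih =>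
    rw [Function.iterate_succ_apply', moments_mulT, ih]
    exact congrArg (moments V f) (by push_cast; ring)

/-- Iterating the previous recursion gives a Taylor formula whose remainder is t^n times the
transform of t^(-n) f, a section again by flatness. -/
theorem convK_eq_sum_zero (f : Cflat V) (n : ℕ) {t : ℂ} (ht : t ≠ 0) (s : fiber V) :
    convK f t s = ∑ j ∈ Finset.range n, (moments V f (1 + j)).1 s * t ^ (1 + (j : ℤ)) +
      t ^ n * convK ((mulTinv V)^[n] f) t s := by
  induction n with
  | zero => simp
  | succ n ih =>
    rw [ih, Finset.sum_range_succ, convK_mulTinv ((mulTinv V)^[n] f) ht, moments_iterate_mulTinv,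
      Function.iterate_succ_apply', zpow_add₀ ht, zpow_one, zpow_natCast]
    ring

theorem convK_eq_sum_inf (f : Cflat V) (n : ℕ) {t : ℂ} (ht : t ≠ 0) (s : fiber V) :
    convK f t s = ∑ j ∈ Finset.range n, -(moments V f (-j)).1 s * t⁻¹ ^ j +
      t⁻¹ ^ n * convK ((mulT V)^[n] f) t s := by
  induction n with
  | zero => simp
  | succ n ih =>
    rw [ih, Finset.sum_range_succ, convK_mulT ((mulT V)^[n] f) ht, moments_iterate_mulT,
      Function.iterate_succ_apply', zero_sub]
    ring

theorem sum_Ico_int (F : ℤ → ℂ) (m : ℤ) (n : ℕ) :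
    ∑ k ∈ Finset.Ico m (m + n), F k = ∑ j ∈ Finset.range n, F (m + j) := by
  refine Finset.sum_nbij' (fun k => (k - m).toNat) (fun j => m + j) ?_ ?_ ?_ ?_ ?_
  all_goals intro k hk; simp at hk ⊢
  · omega
  · omega
  · omega
  · congr 1; omega

/-- The order of the expansion is unknown when its leading moments vanish; any lower bound m of the
support may replace it. -/
theorem partialSum_eq (a : LaurentSeries (Holo V)) (m : ℤ) (hm : ∀ k < m, a.coeff k = 0)
    (N : ℤ) (z : ℂ) (s : fiber V) :
    partialSum a N z s = ∑ k ∈ Finset.Ico m N, (a.coeff k).1 s * z ^ k := by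
  have h1 : ∀ m' : ℤ, (∀ k < m', a.coeff k = 0) →
      ∑ k ∈ Finset.Ico m' N, (a.coeff k).1 s * z ^ k =
      ∑ k ∈ Finset.Ico (min a.order m) N ∪ Finset.Ico m' N, (a.coeff k).1 s * z ^ k := by
    intro m' h
    refine Finset.sum_subset Finset.subset_union_right fun k hk hk' => ?_
    have : k < m' := by
      by_contra hc
      refine hk' (Finset.mem_Ico.2 ⟨not_lt.1 hc, ?_⟩)
      rcases Finset.mem_union.1 hk with h | h <;> exact (Finset.mem_Ico.1 h).2
    rw [h k this]; simp
  have e1 : Finset.Ico (min a.order m) N ∪ Finset.Ico a.order N = Finset.Ico (min a.order m) N :=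
    Finset.union_eq_left.2 (Finset.Ico_subset_Ico_left (min_le_left _ _))
  have e2 : Finset.Ico (min a.order m) N ∪ Finset.Ico m N = Finset.Ico (min a.order m) N :=
    Finset.union_eq_left.2 (Finset.Ico_subset_Ico_left (min_le_right _ _))
  rw [partialSum, h1 _ fun k hk => HahnSeries.coeff_eq_zero_of_lt_order hk, h1 m hm, e1, e2]

theorem exists_bound_cauchy (f : Cflat V) {S : Set (fiber V)} (hS : IsCompact S) :
    ∃ C : ℝ, ∀ t : ℂ, ‖t‖ ≤ 1 → ∀ s ∈ S, ‖cauchy f (t, s)‖ ≤ C := by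
  have hK : IsCompact (Metric.closedBall (0 : ℂ) 1 ×ˢ ((fun s : fiber V => (s : ℂ)) '' S)) :=
    (isCompact_closedBall _ _).prod (hS.image continuous_subtype_val)
  have hc : ContinuousOn (cauchy f) (univ ×ˢ fiber V) :=
    ((Cflat.biflatOn (mulTbarInv f)).contDiffOn_kconv (isOpen_fiber V)
      temperedKernel_inv).continuousOn
  obtain ⟨C, hC⟩ := hK.exists_bound_of_continuousOn (hc.mono
    (prod_mono (subset_univ _) (by rintro _ ⟨s, -, rfl⟩; exact s.2)))
  exact ⟨C, fun t ht s hs => hC (t, s) ⟨by simpa using ht, s, hs, rfl⟩⟩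

/-- The function `t̄⁻² f(1/t) / \overline{1/t}` corresponding to `f / t̄` under inversion. -/
noncomputable def invForm (f : Cflat V) : ℂ × ℂ → ℂ := fun p =>
  ((starRingEnd ℂ) p.1 ^ 2)⁻¹ * Cflat.fn (mulTbarInv f) (p.1⁻¹, p.2)

theorem biflatOn_invForm (f : Cflat V) : BiflatOn (fiber V) (invForm f) := by
  refine (((Cflat.biflatOn (mulTbarInv f)).comp_inv.conj_inv_smul (isOpen_fiber V)).conj_inv_smul
    (isOpen_fiber V)).congr (isOpen_fiber V) fun t s _ => ?_
  simp only [invForm]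
  rw [pow_two, mul_inv, mul_assoc]

theorem cauchy_inv (f : Cflat V) {t : ℂ} (ht : t ≠ 0) {s : ℂ} (hs : s ∈ fiber V) :
    cauchy f (t⁻¹, s) = -kconv (fun ξ => ξ⁻¹) (invForm f) (t, s) -
      ∫ η, η⁻¹ * invForm f (η, s) :=
  (biflatOn_invForm f).kconv_inv_comp_inv (isOpen_fiber V) (fun _ _ => rfl) ht hs

/-- Inversion carries ‖t‖ ≥ 1 into the unit disc, where the Cauchy transform of `invForm f` is
continuous on a compact set. -/
theorem exists_bound_cauchy_inf (f : Cflat V) {S : Set (fiber V)} (hS : IsCompact S) :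
    ∃ C : ℝ, ∀ t : ℂ, 1 ≤ ‖t‖ → ∀ s ∈ S, ‖cauchy f (t, s)‖ ≤ C := by
  have hS' := hS.image continuous_subtype_val
  have hsub : (fun s : fiber V => (s : ℂ)) '' S ⊆ fiber V := by
    rintro _ ⟨s, -, rfl⟩; exact s.2
  have hK : IsCompact (Metric.closedBall (0 : ℂ) 1 ×ˢ ((fun s : fiber V => (s : ℂ)) '' S)) :=
    (isCompact_closedBall _ _).prod hS'
  have hb := biflatOn_invForm f
  obtain ⟨C, hC⟩ := hK.exists_bound_of_continuousOn ((hb.contDiffOn_kconv (isOpen_fiber V)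
      temperedKernel_inv).continuousOn.mono (prod_mono (subset_univ _) hsub))
  have hm : ContinuousOn (fun s => ∫ η, η⁻¹ * invForm f (η, s)) (fiber V) := by
    have h1 := ((hb.inv_smul_fst (isOpen_fiber V)).contDiffOn_kconv (isOpen_fiber V)
      temperedKernel_one).continuousOn
    have h2 := h1.comp (f := fun s : ℂ => ((0 : ℂ), s)) (s := fiber V) (by fun_prop)
      fun s hs => mem_slab hs
    refine h2.congr fun s _ => ?_
    simp only [Function.comp, kconv_one, smul_eq_mul]
  obtain ⟨C', hC'⟩ := hS'.exists_bound_of_continuousOn (hm.mono hsub)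
  refine ⟨C + C', fun t ht s hs => ?_⟩
  have ht0 : t ≠ 0 := by rintro rfl; simp at ht; linarith
  have := cauchy_inv f (inv_ne_zero ht0) s.2
  rw [inv_inv] at this
  rw [this]
  refine (norm_sub_le _ _).trans (add_le_add ?_ (hC' s ⟨s, hs, rfl⟩))
  rw [norm_neg]
  exact hC (t⁻¹, s) ⟨by simpa using inv_le_one_of_one_le₀ ht, s, hs, rfl⟩

theorem exists_bound_holo (a : Holo V) {S : Set (fiber V)} (hS : IsCompact S) :
    ∃ C : ℝ, ∀ s ∈ S, ‖a.1 s‖ ≤ C := by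
  have hc : Continuous a.1 := by
    have h := continuousOn_iff_continuous_domRestrict.1 (DifferentiableOn.continuousOn a.2)
    refine h.congr fun s => ?_
    exact extZero_coe _ _
  exact hS.exists_bound_of_continuousOn hc.continuousOn

theorem bddBelow_support_ite {R : Type} [Zero R] (m : ℤ) (c : ℤ → R) :
    BddBelow (Function.support fun k : ℤ => if m ≤ k then c k else 0) :=
  ⟨m, fun k hk => by by_contra h; exact Function.mem_support.1 hk (if_neg h)⟩

/-- The expansion of `K * f` at `0`. -/
noncomputable def expansionZero (f : Cflat V) : LaurentSeries (Holo V) :=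
  HahnSeries.ofSuppBddBelow (fun k : ℤ => if 1 ≤ k then moments V f k else 0)
    (bddBelow_support_ite 1 _)

/-- The expansion of `K * f` at `∞`. -/
noncomputable def expansionInf (f : Cflat V) : LaurentSeries (Holo V) :=
  HahnSeries.ofSuppBddBelow (fun k : ℤ => if 0 ≤ k then -moments V f (-k) else 0)
    (bddBelow_support_ite 0 fun k => -moments V f (-k))

theorem coeff_expansionZero (f : Cflat V) (k : ℤ) :
    (expansionZero f).coeff k = if 1 ≤ k then moments V f k else 0 := by
  rw [expansionZero, HahnSeries.coeff_ofSuppBddBelow]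

theorem coeff_expansionInf (f : Cflat V) (k : ℤ) :
    (expansionInf f).coeff k = if 0 ≤ k then -moments V f (-k) else 0 := by
  rw [expansionInf, HahnSeries.coeff_ofSuppBddBelow]

/-- The minus sign of the expansion at ∞ cancels the one in the difference a - b, so both halves
give the same moment sequence. -/
theorem epsilon_eq (f : Cflat V) : epsilon V f =
    (Submodule.Quotient.mk (expansionZero f), Submodule.Quotient.mk (expansionInf f)) := by
  apply (tailsEquiv V).injective
  rw [tailsEquiv_epsilon]
  funext k
  refine Eq.trans ?_ (tailsDiff_mk V _ _ k).symm
  rw [coeff_expansionZero, coeff_expansionInf]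
  by_cases h : 1 ≤ k
  · rw [if_pos h, if_pos h, if_neg (by omega), sub_zero]
  · rw [if_neg h, if_pos (by omega), if_pos (by omega), neg_neg, sub_neg_eq_add, zero_add]

theorem isExpansionAtZero (f : Cflat V) : IsExpansionAtZero (convK f) (expansionZero f) := by
  intro N S hS
  -- The exponents 1, …, n are those below N. The remainder t^n K * (t^(-n) f) carries one more
  -- factor t by `convK_eq_mul_cauchy`, so it is O(t^(n+1)) with n + 1 ≥ N.
  set n := (N - 1).toNat
  obtain ⟨C, hC⟩ := exists_bound_cauchy (mulTinv V ((mulTinv V)^[n] f)) hS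
  refine ⟨‖(Real.pi : ℂ)⁻¹‖ * max C 0, 1, one_pos, fun t ht ht1 s hs => ?_⟩
  have e1 : partialSum (expansionZero f) N t s =
      ∑ j ∈ Finset.range n, (moments V f (1 + j)).1 s * t ^ (1 + (j : ℤ)) := by
    rw [partialSum_eq _ 1 (fun k hk => by rw [coeff_expansionZero, if_neg (by omega)]),
      ← sum_Ico_int (fun k => (moments V f k).1 s * t ^ k)]
    refine Finset.sum_congr ?_ fun k hk => ?_
    · ext k; simp only [Finset.mem_Ico]; omega
    · rw [coeff_expansionZero, if_pos (Finset.mem_Ico.1 hk).1]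
  rw [e1, convK_eq_sum_zero f n ht s, add_sub_cancel_left, convK_eq_mul_cauchy _ ht,
    norm_mul, norm_mul, norm_neg, norm_mul, norm_pow]
  have h1 := (hC t ht1.le s hs).trans (le_max_left C 0)
  have h2 : ‖t‖ ^ (n + 1) ≤ ‖t‖ ^ N := by
    rw [← zpow_natCast]
    exact zpow_le_zpow_right_of_le_one₀ (norm_pos_iff.2 ht) ht1.le (by push_cast; omega)
  calc _ = ‖(Real.pi : ℂ)⁻¹‖ * ‖cauchy (mulTinv V ((mulTinv V)^[n] f)) (t, s)‖ *
        ‖t‖ ^ (n + 1) := by ring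
    _ ≤ ‖(Real.pi : ℂ)⁻¹‖ * max C 0 * ‖t‖ ^ N := by gcongr

theorem isExpansionAtInf (f : Cflat V) : IsExpansionAtInf (convK f) (expansionInf f) := by
  intro N S hS
  -- Here the exponents start at 0, so n terms are needed. For N < 0 the sum is empty and
  -- boundedness suffices, since ‖t⁻¹‖ ≤ 1.
  set n := N.toNat
  set g := (mulT V)^[n] f
  obtain ⟨C, hC⟩ := exists_bound_cauchy_inf g hS
  obtain ⟨C', hC'⟩ := exists_bound_holo (moments V g 0) hS
  refine ⟨max (C' + ‖(Real.pi : ℂ)⁻¹‖ * C) 0, 1, one_pos, fun t ht1 s hs => ?_⟩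
  have ht : t ≠ 0 := by rintro rfl; simp at ht1; linarith
  have e1 : partialSum (expansionInf f) N t⁻¹ s =
      ∑ j ∈ Finset.range n, -(moments V f (-j)).1 s * t⁻¹ ^ j := by
    have h := sum_Ico_int (fun k => -(moments V f (-k)).1 s * t⁻¹ ^ k) 0 n
    simp only [zero_add, zpow_natCast] at h
    rw [partialSum_eq _ 0 (fun k hk => by rw [coeff_expansionInf, if_neg (by omega)]), ← h]
    refine Finset.sum_congr ?_ fun k hk => ?_
    · ext k; simp only [Finset.mem_Ico]; omega
    · rw [coeff_expansionInf, if_pos (Finset.mem_Ico.1 hk).1]; rfl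
  rw [e1, convK_eq_sum_inf f n ht s, add_sub_cancel_left, norm_mul, norm_pow]
  have h1 : ‖convK g t s‖ ≤ max (C' + ‖(Real.pi : ℂ)⁻¹‖ * C) 0 := by
    rw [convK_eq_cauchy g ht]
    refine le_trans ((norm_sub_le _ _).trans (add_le_add ?_ ?_)) (le_max_left _ _)
    · rw [norm_neg]; exact hC' s hs
    · rw [norm_mul]; gcongr; exact hC t ht1.le s hs
  have h2 : ‖t⁻¹‖ ^ n ≤ ‖t⁻¹‖ ^ N := by
    rw [← zpow_natCast]
    refine zpow_le_zpow_right_of_le_one₀ (norm_pos_iff.2 (inv_ne_zero ht)) ?_ (by omega)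
    rw [norm_inv]; exact inv_le_one_of_one_le₀ ht1.le
  rw [mul_comm]
  gcongr

end expansion

/-! ### Injectivity and exactness in the middle -/

section exactness
variable {V : Opens CmodZ}

/-- Liouville: for fixed s the function is entire in t, bounded on ℙ¹, and vanishes at t = 0. -/
theorem dtbar_eq_zero {f : Cflat V} (h : dtbar V f = 0) : f = 0 := by
  refine Cflat.ext_fn fun t s hs => ?_
  have hb := Cflat.biflatOn f
  have hd : Differentiable ℂ fun t => Cflat.fn f (t, s) := by
    rw [← differentiableOn_univ]
    refine differentiableOn_of_real (fun t _ => Cflat.slice f t hs) fun t _ => ?_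
    have h1 : (Cflat.fn (dtbar V f)) (t, s) = 0 := by
      rw [h, Cflat.fn_apply _ _ hs]; rfl
    rw [fn_dtbar f t hs, wirtBar] at h1
    linear_combination (-2 * Complex.I) * h1 + (fstPart (fderiv ℝ (Cflat.fn f) (t, s)) Complex.I) *
      Complex.I_sq
  obtain ⟨C, -, r, hr, -, hC⟩ := hb.bounded (isOpen_fiber V) hs
  have hbd : Bornology.IsBounded (range fun t => Cflat.fn f (t, s)) := by
    rw [isBounded_iff_forall_norm_le]
    exact ⟨C, by rintro _ ⟨t, rfl⟩; exact hC t s (by simpa using hr)⟩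
  have := hd.apply_eq_apply_of_bounded hbd t 0
  rw [this, hb.eq_zero hs, Cflat.fn_apply _ _ hs]; rfl

theorem dtbarD_injective : Function.Injective (dtbarD V) :=
  (injective_iff_map_eq_zero _).2 fun _ h => dtbar_eq_zero h

theorem mulTbarD_injective : Function.Injective (mulTbarD V) :=
  Function.LeftInverse.injective mulTbarInv_mulTbar

theorem epsilon_eq_zero_iff (f : Cflat V) : epsilon V f = 0 ↔ moments V f = 0 := by
  rw [← tailsEquiv_epsilon, LinearEquiv.map_eq_zero_iff]

theorem momentsVanish_of_moments (f : Cflat V) (h : moments V f = 0) :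
    MomentsVanish (fiber V) (Cflat.fn (mulTbarInv f)) := by
  intro k s hs
  have h1 : (moments V f (-k - 1)).1 ⟨s, hs⟩ = 0 := by rw [h]; rfl
  rw [moments_apply] at h1
  have hp : (Real.pi : ℂ)⁻¹ ≠ 0 := inv_ne_zero (by exact_mod_cast Real.pi_ne_zero)
  have h2 := (mul_eq_zero.1 h1).resolve_left hp
  rwa [show -(-k - 1) - 1 = k by ring] at h2

/-- The substitution ξ = 1/η identifies the k-th moment of `invForm f` with the moment of order -k -
2 of f/t̄. -/
theorem momentsVanish_invForm (f : Cflat V) (h : moments V f = 0) :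
    MomentsVanish (fiber V) (invForm f) := by
  intro k s hs
  have h1 := momentsVanish_of_moments f h (-k - 2) s hs
  rw [integral_inv] at h1
  rw [← h1]
  refine integral_congr_ae ((ae_ne_zero_and_ne 0).mono fun η ⟨h0, _⟩ => ?_)
  simp only [invForm, smul_eq_mul]
  have hc : (starRingEnd ℂ) η ≠ 0 := by simpa using h0
  have h4 : (((‖η‖ ^ 4)⁻¹ : ℝ) : ℂ) = (η ^ 2)⁻¹ * ((starRingEnd ℂ) η ^ 2)⁻¹ := by
    rw [← mul_inv, ← mul_pow, Complex.mul_conj']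
    push_cast; ring
  have h5 : η⁻¹ ^ (-k - 2) = η ^ k * η ^ 2 := by
    rw [inv_zpow', ← zpow_natCast, ← zpow_add₀ h0]; congr 1; push_cast; ring
  rw [Complex.real_smul, h4, h5]
  field_simp

/-- At 0 the vanishing moments give flatness directly. At ∞ the inversion formula leaves minus the
Cauchy transform of `invForm f`, flat for the same reason, and a term which is the moment of order
-1 of `invForm f`, hence 0. -/
theorem biflatOn_cauchy (f : Cflat V) (h : moments V f = 0) : BiflatOn (fiber V) (cauchy f) := by
  have hm := momentsVanish_of_moments f h
  have hm' := momentsVanish_invForm f h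
  have hb := Cflat.biflatOn (mulTbarInv f)
  have hz := hb.flatOn_kconv_inv (isOpen_fiber V) hm
  refine ⟨hz, ?_⟩
  have h1 := (biflatOn_invForm f).flatOn_kconv_inv (isOpen_fiber V) hm'
  refine (h1.clm (isOpen_fiber V) (-ContinuousLinearMap.id ℝ ℂ)).congr (isOpen_fiber V)
    fun t s hs => ?_
  simp only [neg_apply, ContinuousLinearMap.id_apply]
  by_cases ht : t = 0
  · subst ht
    rw [inv_zero, h1.eq_zero hs, neg_zero]
    exact hz.eq_zero hs
  · rw [cauchy_inv f ht hs]
    have := hm' (-1) s hs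
    simp only [zpow_neg_one, smul_eq_mul] at this
    rw [this, sub_zero]

theorem exists_mulTbar_dtbar_eq (f : Cflat V) (h : moments V f = 0) :
    ∃ g : Cflat V, mulTbar V (dtbar V g) = f := by
  have hb := Cflat.biflatOn (mulTbarInv f)
  have hol := fun t => (hb.holo_kconv (isOpen_fiber V) temperedKernel_inv
    (Cflat.holo (mulTbarInv f)) t)
  let G := Cflat.ofBiflatOn (cauchy f) (biflatOn_cauchy f h) hol
  refine ⟨(Real.pi : ℂ)⁻¹ • G, ?_⟩
  have hG : dtbar V G = (Real.pi : ℂ) • mulTbarInv f := by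
    refine Cflat.ext_fn fun t s hs => ?_
    have hs1 := hasFDerivAt_slice ((biflatOn_cauchy f h).zero.differentiableAt
      (isOpen_fiber V) (t := t) hs)
    rw [fn_dtbar_of_hasFDerivAt G t hs (fun t' => Cflat.fn_ofBiflatOn _ _ t' hs) hs1,
      Cflat.fn_smul _ _ _ hs]
    exact hb.wirtBar_kconv_inv (isOpen_fiber V) t hs
  rw [map_smul, hG, smul_smul, inv_mul_cancel₀ (by exact_mod_cast Real.pi_ne_zero), one_smul,
    mulTbar_mulTbarInv]

theorem epsilon_eq_zero_iff_exists (f : Cflat V) :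
    epsilon V f = 0 ↔ ∃ g : Cflat V, mulTbar V (dtbar V g) = f := by
  rw [epsilon_eq_zero_iff]
  refine ⟨exists_mulTbar_dtbar_eq f, ?_⟩
  rintro ⟨g, rfl⟩
  exact moments_mulTbar_dtbar g

end exactness

/-! ### A Borel-type summation -/

section borel

/-- A smooth bump function on the real line, supported near `1`. -/
noncomputable def bumpOne : ContDiffBump (1 : ℝ) := ⟨1 / 4, 1 / 2, by norm_num, by norm_num⟩

/-- A smooth radial function on the plane, supported in an annulus. -/
noncomputable def radialBump (w : ℂ) : ℝ := bumpOne (‖w‖ ^ 2)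

theorem contDiff_radialBump : ContDiff ℝ ∞ radialBump :=
  bumpOne.contDiff.comp (contDiff_norm_sq ℝ)

theorem radialBump_nonneg (w : ℂ) : 0 ≤ radialBump w := bumpOne.nonneg

theorem radialBump_eq_zero_of_le {w : ℂ} (h : 2 ≤ ‖w‖) : radialBump w = 0 :=
  bumpOne.zero_of_le_dist (by
    rw [Real.dist_eq]
    refine le_trans ?_ (le_abs_self _)
    have : bumpOne.rOut = 1 / 2 := rfl
    rw [this]; nlinarith)

theorem radialBump_eq_zero_of_ge {w : ℂ} (h : ‖w‖ ≤ 1 / 2) : radialBump w = 0 :=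
  bumpOne.zero_of_le_dist (by
    rw [Real.dist_eq, abs_sub_comm]
    refine le_trans ?_ (le_abs_self _)
    have : bumpOne.rOut = 1 / 2 := rfl
    rw [this]; nlinarith [norm_nonneg w])

theorem integral_radialBump_pos : 0 < ∫ w, radialBump w := by
  refine Continuous.integral_pos_of_hasCompactSupport_nonneg_nonzero (x := 1)
    contDiff_radialBump.continuous ?_ radialBump_nonneg ?_
  · refine HasCompactSupport.intro (isCompact_closedBall (0 : ℂ) 2) fun w hw => ?_
    exact radialBump_eq_zero_of_le (by simpa using (not_le.1 (by simpa using hw)).le)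
  · have : radialBump 1 = 1 := by
      rw [radialBump, norm_one, one_pow]
      exact bumpOne.one_of_mem_closedBall (by simp [bumpOne.rIn_pos.le])
    rw [this]; exact one_ne_zero

/-- The function `t ^ k ‖t/ε‖² h(t/ε)`, `h` the radial bump function. -/
noncomputable def radialTerm (k : ℕ) (ε : ℝ) (t : ℂ) : ℂ :=
  -- The factor ‖t/ε‖² is there to cancel the weight |ξ|⁻² in the moments.
  t ^ k * ((‖t / ε‖ ^ 2 * radialBump (t / ε) : ℝ) : ℂ)

theorem radialTerm_eq_zero_of_le {k : ℕ} {ε : ℝ} (hε : 0 < ε) {t : ℂ} (h : 2 * ε ≤ ‖t‖) :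
    radialTerm k ε t = 0 := by
  rw [radialTerm, radialBump_eq_zero_of_le]
  · simp
  · rw [norm_div, Complex.norm_real, Real.norm_of_nonneg hε.le, le_div_iff₀ hε]; exact h

theorem radialTerm_eq_zero_of_ge {k : ℕ} {ε : ℝ} (hε : 0 < ε) {t : ℂ} (h : ‖t‖ ≤ ε / 2) :
    radialTerm k ε t = 0 := by
  rw [radialTerm, radialBump_eq_zero_of_ge]
  · simp
  · rw [norm_div, Complex.norm_real, Real.norm_of_nonneg hε.le, div_le_iff₀ hε]; linarith

theorem contDiff_radialTerm (k : ℕ) (ε : ℝ) : ContDiff ℝ ∞ (radialTerm k ε) := by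
  have h1 : ContDiff ℝ ∞ fun t : ℂ => t / (ε : ℂ) := by fun_prop
  exact (contDiff_id.pow k).mul (Complex.ofRealCLM.contDiff.comp
    (((contDiff_norm_sq ℝ).comp h1).mul (contDiff_radialBump.comp h1)))

theorem radialTerm_scale (k : ℕ) {ε : ℝ} (hε : 0 < ε) (t : ℂ) :
    radialTerm k ε t = (ε : ℂ) ^ k * radialTerm k 1 (t / ε) := by
  have h : (ε : ℂ) ≠ 0 := by exact_mod_cast hε.ne'
  simp only [radialTerm, Complex.ofReal_one, div_one, div_pow]
  field_simp

/-- The coefficients a_k are unbounded on U in general. Countably many cutoffs, used at stage k only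
for m ≤ k, reduce the estimates to compactly supported functions. -/
theorem exists_cutoffs {U : Set ℂ} (hU : IsOpen U) : ∃ χ : ℕ → ℂ → ℝ,
    (∀ m, ContDiff ℝ ∞ (χ m) ∧ HasCompactSupport (χ m) ∧ tsupport (χ m) ⊆ U) ∧
    ∀ s ∈ U, ∃ m, χ m =ᶠ[𝓝 s] 1 := by
  rcases U.eq_empty_or_nonempty with rfl | hne
  · exact ⟨fun _ => 0, fun m => ⟨contDiff_const, HasCompactSupport.zero, by simp⟩, by simp⟩
  have h1 : ∀ s : U, ∃ f : ContDiffBump (s : ℂ), tsupport f ⊆ U := fun s => by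
    obtain ⟨r, hr, hb⟩ := Metric.nhds_basis_closedBall.mem_iff.1 (hU.mem_nhds s.2)
    exact ⟨⟨r / 2, r, by positivity, by linarith⟩, by rwa [ContDiffBump.tsupport_eq]⟩
  choose f hf using h1
  have : Nonempty U := hne.to_subtype
  obtain ⟨T, hTc, hT⟩ := TopologicalSpace.countable_cover_nhds (α := U)
    (f := fun s => {x : U | f s =ᶠ[𝓝 (x : ℂ)] 1}) fun s =>
      (continuous_subtype_val.continuousAt (x := s)).eventually
        (eventually_eventually_nhds.2 (f s).eventuallyEq_one)
  have hTne : T.Nonempty := by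
    by_contra h
    rw [not_nonempty_iff_eq_empty] at h
    subst h
    have := hT ▸ mem_univ (Classical.arbitrary U)
    simp at this
  obtain ⟨e, rfl⟩ := hTc.exists_eq_range hTne
  refine ⟨fun m => f (e m), fun m => ⟨(f (e m)).contDiff, (f (e m)).hasCompactSupport, hf _⟩,
    fun s hs => ?_⟩
  have : (⟨s, hs⟩ : U) ∈ ⋃ x ∈ range e, {x' : U | f x =ᶠ[𝓝 (x' : ℂ)] 1} := hT ▸ mem_univ _
  simp only [mem_iUnion, mem_range] at this
  obtain ⟨_, ⟨m, rfl⟩, h⟩ := this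
  exact ⟨m, h⟩

theorem contDiff_cutoff_mul {U : Set ℂ} (hU : IsOpen U) {χ : ℂ → ℝ} (hχ : ContDiff ℝ ∞ χ)
    (hs : tsupport χ ⊆ U) {a : ℂ → ℂ} (ha : DifferentiableOn ℂ a U) :
    ContDiff ℝ ∞ fun s => (χ s : ℂ) * a s := by
  rw [contDiff_iff_contDiffAt]
  intro s
  by_cases h : s ∈ tsupport χ
  · have h1 : ContDiffAt ℝ ∞ a s :=
      ((ha.contDiffOn (n := ∞) hU).contDiffAt (hU.mem_nhds (hs h))).restrict_scalars ℝ
    exact (Complex.ofRealCLM.contDiff.contDiffAt.comp s hχ.contDiffAt).mul h1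
  · refine (contDiffAt_const (c := (0 : ℂ))).congr_of_eventuallyEq ?_
    filter_upwards [notMem_tsupport_iff_eventuallyEq.1 h] with x hx
    simp [hx]

/-- Each derivative costs at most ε⁻¹, and the prefactor ε^k with k > j leaves at least one power of
ε. -/
theorem norm_iteratedFDeriv_scale {G : ℂ × ℂ → ℂ} (hG : ContDiff ℝ ∞ G)
    {j : ℕ} {B : ℝ} (hB : ∀ x, ‖iteratedFDeriv ℝ j G x‖ ≤ B) {k : ℕ} (hjk : j < k) {ε : ℝ}
    (hε : 0 < ε) (hε1 : ε ≤ 1) (x : ℂ × ℂ) :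
    ‖iteratedFDeriv ℝ j (fun p : ℂ × ℂ => (ε : ℂ) ^ k * G (p.1 / ε, p.2)) x‖ ≤ B * ε := by
  let A : ℂ × ℂ →L[ℝ] ℂ × ℂ := (ε⁻¹ • ContinuousLinearMap.fst ℝ ℂ ℂ).prod
    (ContinuousLinearMap.snd ℝ ℂ ℂ)
  have hA : ∀ p, A p = (p.1 / ε, p.2) := fun p => by
    ext
    · simp [A, div_eq_inv_mul]
    · simp [A]
  have hAn : ‖A‖ ≤ ε⁻¹ := by
    refine ContinuousLinearMap.opNorm_le_bound _ (by positivity) fun p => ?_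
    rw [hA, Prod.norm_def, Prod.norm_def, norm_div, Complex.norm_real, Real.norm_of_nonneg hε.le,
      div_eq_inv_mul]
    have : 1 ≤ ε⁻¹ := (one_le_inv₀ hε).2 hε1
    refine max_le (by gcongr; exact le_max_left _ _) ?_
    calc ‖p.2‖ ≤ 1 * max ‖p.1‖ ‖p.2‖ := by rw [one_mul]; exact le_max_right _ _
      _ ≤ _ := by gcongr
  have e : (fun p : ℂ × ℂ => (ε : ℂ) ^ k * G (p.1 / ε, p.2)) = ((ε : ℂ) ^ k) • (G ∘ A) := by
    funext p; simp [hA]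
  have hc : ContDiff ℝ ∞ (G ∘ A) := hG.comp A.contDiff
  have hB0 : 0 ≤ B := (norm_nonneg _).trans (hB 0)
  rw [e, iteratedFDeriv_const_smul_apply (hc.contDiffAt.of_le (by exact_mod_cast le_top)),
    norm_smul, A.iteratedFDeriv_comp_right hG x (by exact_mod_cast le_top), norm_pow,
    Complex.norm_real, Real.norm_of_nonneg hε.le]
  calc _ ≤ ε ^ k * (B * ε⁻¹ ^ j) := by
        gcongr
        refine (ContinuousMultilinearMap.norm_compContinuousLinearMap_le _ _).trans ?_
        rw [Finset.prod_const, Finset.card_univ, Fintype.card_fin]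
        gcongr
        exact hB _
    _ = B * ε ^ (k - j) := by
        have : ε ^ k = ε ^ (k - j) * ε ^ j := by rw [← pow_add]; congr 1; omega
        rw [this, inv_pow]; field_simp
    _ ≤ B * ε := by
        gcongr
        exact pow_le_of_le_one hε.le hε1 (by omega)

/-- The general term of the series of Borel's construction. -/
noncomputable def borelTerm (a : ℕ → ℂ → ℂ) (ε : ℕ → ℝ) (k : ℕ) (p : ℂ × ℂ) : ℂ :=
  a k p.2 * radialTerm k (ε k) p.1

/-- Finitely many conditions of the form constant · ε ≤ 2^(-k) hold for all small ε > 0. Those on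
derivatives give smoothness of the sum; the last one is for exchanging sum and integral in the
moments. -/
theorem exists_scale {U : Set ℂ} (hU : IsOpen U) {χ : ℕ → ℂ → ℝ}
    (hχ : ∀ m, ContDiff ℝ ∞ (χ m) ∧ HasCompactSupport (χ m) ∧ tsupport (χ m) ⊆ U)
    {a : ℂ → ℂ} (ha : DifferentiableOn ℂ a U) (k : ℕ) :
    ∃ ε : ℝ, 0 < ε ∧ ε ≤ (1 / 2) ^ k ∧ ∀ m ≤ k,
      (∀ j < k, ∀ x, ‖iteratedFDeriv ℝ j (fun p : ℂ × ℂ =>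
        (χ m p.2 : ℂ) * a p.2 * radialTerm k ε p.1) x‖ ≤ (1 / 2) ^ k) ∧
      ∀ s, ‖(χ m s : ℂ) * a s‖ * ε ≤ (1 / 2) ^ k := by
  have hsm := fun m => contDiff_cutoff_mul hU (hχ m).1 (hχ m).2.2 ha
  let G : ℕ → ℂ × ℂ → ℂ := fun m p => (χ m p.2 : ℂ) * a p.2 * radialTerm k 1 p.1
  have hG : ∀ m, ContDiff ℝ ∞ (G m) := fun m =>
    ((hsm m).comp contDiff_snd).mul ((contDiff_radialTerm k 1).comp contDiff_fst)
  have hGc : ∀ m, HasCompactSupport (G m) := fun m => by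
    refine HasCompactSupport.intro ((isCompact_closedBall (0 : ℂ) 2).prod (hχ m).2.1.isCompact)
      fun p hp => ?_
    rw [mem_prod, not_and_or] at hp
    rcases hp with hp | hp
    · simp only [G]
      rw [radialTerm_eq_zero_of_le one_pos, mul_zero]
      simpa using (not_le.1 (by simpa using hp)).le
    · simp [G, image_eq_zero_of_notMem_tsupport hp]
  have hB : ∀ m j, ∃ B, ∀ x, ‖iteratedFDeriv ℝ j (G m) x‖ ≤ B := fun m j =>
    ((hGc m).iteratedFDeriv j).exists_bound_of_continuous
      ((hG m).continuous_iteratedFDeriv (by exact_mod_cast le_top))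
  have hB' : ∀ m, ∃ B, ∀ s, ‖(χ m s : ℂ) * a s‖ ≤ B := fun m => by
    refine HasCompactSupport.exists_bound_of_continuous ?_ (hsm m).continuous
    refine HasCompactSupport.intro (hχ m).2.1.isCompact fun s hs => ?_
    simp [image_eq_zero_of_notMem_tsupport hs]
  choose B hB using hB
  choose B' hB' using hB'
  have hpos : (0 : ℝ) < (1 / 2) ^ k := by positivity
  have small : ∀ c : ℝ, ∀ᶠ ε in 𝓝[>] (0 : ℝ), c * ε ≤ (1 / 2) ^ k := fun c => by
    have : Filter.Tendsto (fun ε : ℝ => c * ε) (𝓝[>] 0) (𝓝 (c * 0)) :=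
      (tendsto_nhdsWithin_of_tendsto_nhds (Filter.tendsto_id)).const_mul c
    rw [mul_zero] at this
    exact (this.eventually (gt_mem_nhds hpos)).mono fun _ h => h.le
  have h1 : ∀ᶠ ε in 𝓝[>] (0 : ℝ), ∀ m ∈ Finset.range (k + 1), ∀ j ∈ Finset.range k,
      B m j * ε ≤ (1 / 2) ^ k :=
    (Finset.eventually_all _).2 fun m _ => (Finset.eventually_all _).2 fun j _ => small _
  have h2 : ∀ᶠ ε in 𝓝[>] (0 : ℝ), ∀ m ∈ Finset.range (k + 1), B' m * ε ≤ (1 / 2) ^ k :=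
    (Finset.eventually_all _).2 fun m _ => small _
  obtain ⟨ε, ⟨⟨h1, h2⟩, h3⟩, hε⟩ := (((h1.and h2).and (small 1)).and
    (eventually_mem_nhdsWithin)).exists
  have hε : 0 < ε := hε
  rw [one_mul] at h3
  have hε1 : ε ≤ 1 := h3.trans (pow_le_one₀ (by norm_num) (by norm_num))
  refine ⟨ε, hε, h3, fun m hm => ⟨fun j hj x => ?_, fun s => ?_⟩⟩
  · refine le_trans ?_ (h1 m (Finset.mem_range.2 (by omega)) j (Finset.mem_range.2 hj))
    have e : (fun p : ℂ × ℂ => (χ m p.2 : ℂ) * a p.2 * radialTerm k ε p.1) =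
        fun p => (ε : ℂ) ^ k * G m (p.1 / ε, p.2) := by
      funext p
      simp only [G]
      rw [radialTerm_scale k hε]; ring
    rw [e]
    exact norm_iteratedFDeriv_scale (hG m) (hB m j) hj hε hε1 x
  · exact (mul_le_mul_of_nonneg_right (hB' m s) hε.le).trans
      (h2 m (Finset.mem_range.2 (by omega)))

/-- Near s some cutoff m equals 1, and from k ≥ max(m, j + 1) on the j-th derivatives are at most
2^(-k), so the series can be differentiated term by term. All terms vanish for ‖t‖ ≥ 2, and for
fixed t ≠ 0 only finitely many do not vanish, which gives holomorphy in s. -/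
theorem exists_borelSum {U : Set ℂ} (hU : IsOpen U) {a : ℕ → ℂ → ℂ}
    (ha : ∀ k, DifferentiableOn ℂ (a k) U) :
    ∃ ε : ℕ → ℝ, (∀ k, 0 < ε k ∧ ε k ≤ (1 / 2) ^ k) ∧
      (∀ s ∈ U, ∀ᶠ k in Filter.atTop, ‖a k s‖ * ε k ≤ (1 / 2) ^ k) ∧
      BiflatOn U (fun p => ∑' k, borelTerm a ε k p) ∧
      ∀ t, DifferentiableOn ℂ (fun s => ∑' k, borelTerm a ε k (t, s)) U := by
  obtain ⟨χ, hχ, hχ1⟩ := exists_cutoffs hU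
  choose ε hε0 hε1 hε using fun k => exists_scale hU hχ (ha k) k
  have hle1 : ∀ k, ε k ≤ 1 := fun k =>
    (hε1 k).trans (pow_le_one₀ (by norm_num) (by norm_num))
  have hsum : Summable fun k : ℕ => (1 / 2 : ℝ) ^ k := summable_geometric_two
  let g : ℕ → ℕ → ℂ × ℂ → ℂ := fun m k p =>
    (χ m p.2 : ℂ) * a k p.2 * radialTerm k (ε k) p.1
  have hg : ∀ m k, ContDiff ℝ ∞ (g m k) := fun m k =>
    ((contDiff_cutoff_mul hU (hχ m).1 (hχ m).2.2 (ha k)).comp contDiff_snd).mul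
      ((contDiff_radialTerm k (ε k)).comp contDiff_fst)
  have hzero : ∀ t s, (t = 0 ∨ 2 ≤ ‖t‖) → ∀ k, borelTerm a ε k (t, s) = 0 := by
    rintro t s (rfl | ht) k
    · rw [borelTerm, radialTerm_eq_zero_of_ge (hε0 k)
        (by rw [norm_zero]; exact (half_pos (hε0 k)).le), mul_zero]
    · rw [borelTerm, radialTerm_eq_zero_of_le (hε0 k) (by linarith [hle1 k]), mul_zero]
  have hloc : ∀ s ∈ U, ∃ m, ∀ᶠ s' in 𝓝 s, ∀ t k, borelTerm a ε k (t, s') = g m k (t, s') := by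
    intro s hs
    obtain ⟨m, hm⟩ := hχ1 s hs
    refine ⟨m, hm.mono fun s' hs' t k => ?_⟩
    simp [g, borelTerm, hs']
  have hsmooth : ∀ m, ContDiff ℝ ∞ fun p => ∑' k, g m k p := fun m => by
    refine contDiff_tsum_of_eventually (N := ⊤) (hg m) (v := fun _ k => (1 / 2 : ℝ) ^ k)
      (fun _ _ => hsum) fun j _ => ?_
    rw [Nat.cofinite_eq_atTop]
    filter_upwards [Filter.eventually_ge_atTop m, Filter.eventually_gt_atTop j] with k h1 h2 x
    exact (hε k m h1).1 j h2 x
  have hev : ∀ t, ∀ s ∈ U, ∃ m, (fun p => ∑' k, borelTerm a ε k p) =ᶠ[𝓝 (t, s)]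
      fun p => ∑' k, g m k p := by
    intro t s hs
    obtain ⟨m, hm⟩ := hloc s hs
    refine ⟨m, ?_⟩
    have := (continuous_snd.tendsto (t, s)).eventually hm
    filter_upwards [this] with p hp
    exact tsum_congr fun k => hp p.1 k
  have hcd : ∀ t, ∀ s ∈ U, ContDiffAt ℝ ∞ (fun p => ∑' k, borelTerm a ε k p) (t, s) := by
    intro t s hs
    obtain ⟨m, hm⟩ := hev t s hs
    exact (hsmooth m).contDiffAt.congr_of_eventuallyEq hm
  have hinf : ∀ s, (fun p : ℂ × ℂ => ∑' k, borelTerm a ε k (p.1⁻¹, p.2)) =ᶠ[𝓝 (0, s)]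
      fun _ => 0 := by
    intro s
    have h1 : ∀ᶠ u : ℂ in 𝓝 0, ‖u‖ < 1 / 2 :=
      (tendsto_norm_zero (E := ℂ)).eventually (gt_mem_nhds (by norm_num))
    filter_upwards [(continuous_fst.tendsto ((0 : ℂ), s)).eventually h1] with p hp
    have h2 : p.1⁻¹ = 0 ∨ 2 ≤ ‖p.1⁻¹‖ := by
      by_cases h0 : p.1 = 0
      · exact Or.inl (by rw [h0, inv_zero])
      · refine Or.inr ?_
        rw [norm_inv, le_inv_comm₀ two_pos (norm_pos_iff.2 h0)]
        linarith
    simp only [hzero _ _ h2, tsum_zero]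
  refine ⟨ε, fun k => ⟨hε0 k, hε1 k⟩, fun s hs => ?_, ⟨⟨fun p hp =>
    (hcd p.1 p.2 hp.2).contDiffWithinAt, fun s hs j => ?_⟩, ⟨fun p hp => ?_, fun s hs n => ?_⟩⟩,
    fun t => ?_⟩
  · obtain ⟨m, hm⟩ := hχ1 s hs
    filter_upwards [Filter.eventually_ge_atTop m] with k hk
    have := (hε k m hk).2 s
    rw [hm.self_of_nhds] at this
    simpa using this
  · obtain ⟨m, hm⟩ := hev 0 s hs
    -- Each term vanishes near t = 0, though on a disc shrinking with k. Dropping the first n terms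
    -- changes nothing near (0, s) and leaves a series for which the bounds hold at every index and
    -- every order up to j.
    set n := max m (j + 1)
    have hnear : ∀ k, ∀ᶠ p : ℂ × ℂ in 𝓝 (0, s), g m k p = 0 := fun k => by
      have h1 : ∀ᶠ t : ℂ in 𝓝 0, ‖t‖ ≤ ε k / 2 := by
        have : Filter.Tendsto (fun t : ℂ => ‖t‖) (𝓝 0) (𝓝 0) := tendsto_norm_zero
        exact (this.eventually (gt_mem_nhds (half_pos (hε0 k)))).mono fun _ h => h.le
      filter_upwards [(continuous_fst.tendsto ((0 : ℂ), s)).eventually h1] with p hp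
      simp only [g]
      rw [radialTerm_eq_zero_of_ge (hε0 k) hp, mul_zero]
    have hshift : (fun p => ∑' k, borelTerm a ε k p) =ᶠ[𝓝 (0, s)]
        fun p => ∑' k, g m (k + n) p := by
      have h2 : ∀ᶠ p : ℂ × ℂ in 𝓝 (0, s), ∀ k ∈ Finset.range n, g m k p = 0 :=
        (Finset.eventually_all _).2 fun k _ => hnear k
      filter_upwards [hm, h2] with p hp hp2
      rw [hp]
      -- A series and its tail are summable together, so the default value 0 of `tsum` is
      -- consistent.
      by_cases hs' : Summable fun k => g m k p
      · rw [← hs'.sum_add_tsum_nat_add n, Finset.sum_eq_zero hp2, zero_add]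
      · rw [tsum_eq_zero_of_not_summable hs', tsum_eq_zero_of_not_summable]
        rwa [summable_nat_add_iff (f := fun k => g m k p)]
    rw [(hshift.iteratedFDeriv (𝕜 := ℝ) j).eq_of_nhds,
      iteratedFDeriv_tsum_apply (N := j) (v := fun _ k => (1 / 2 : ℝ) ^ (k + n))
        (fun k => (hg m (k + n)).of_le (by exact_mod_cast le_top))
        (fun _ _ => (summable_nat_add_iff n).2 hsum)
        (fun i k x hi => (hε (k + n) m (by omega)).1 i
          (by have : i ≤ j := by exact_mod_cast hi
              omega) x) le_rfl]
    have : ∀ k, iteratedFDeriv ℝ j (g m (k + n)) (0, s) = 0 := fun k => by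
      have h3 : g m (k + n) =ᶠ[𝓝 (0, s)] fun _ => 0 := hnear (k + n)
      rw [(h3.iteratedFDeriv (𝕜 := ℝ) j).eq_of_nhds]
      simp
    simp [this]
  · obtain ⟨u, s⟩ := p
    refine ContDiffAt.contDiffWithinAt ?_
    by_cases hu : u = 0
    · subst hu
      exact contDiffAt_const.congr_of_eventuallyEq (hinf s)
    · exact ContDiffAt.comp (u, s) (hcd u⁻¹ s hp.2)
        (((contDiffAt_inv ℝ hu).comp (u, s) contDiffAt_fst).prodMk contDiffAt_snd)
  · rw [((hinf s).iteratedFDeriv (𝕜 := ℝ) n).eq_of_nhds]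
    simp
  · by_cases ht : t = 0
    · subst ht
      simp only [hzero 0 _ (Or.inl rfl)]
      simp
    -- As 2 ε_k tends to 0, the terms with 2 ε_k ≤ ‖t‖ drop out and the sum is finite.
    · have hlim : Filter.Tendsto (fun k : ℕ => 2 * (1 / 2 : ℝ) ^ k) Filter.atTop (𝓝 (2 * 0)) :=
        (tendsto_pow_atTop_nhds_zero_of_lt_one (by norm_num) (by norm_num)).const_mul 2
      rw [mul_zero] at hlim
      obtain ⟨n, hn⟩ := Filter.eventually_atTop.1
        (hlim.eventually (gt_mem_nhds (norm_pos_iff.2 ht)))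
      have e : ∀ s, ∑' k, borelTerm a ε k (t, s) =
          ∑ k ∈ Finset.range n, borelTerm a ε k (t, s) := fun s => by
        refine tsum_eq_sum fun k hk => ?_
        have hk : n ≤ k := by simpa using hk
        rw [borelTerm, radialTerm_eq_zero_of_le (hε0 k) (by linarith [hn k hk, hε1 k]), mul_zero]
      simp only [e]
      exact DifferentiableOn.fun_sum fun k _ => (ha k).mul_const (radialTerm k (ε k) t)

end borel

/-! ### Sections with prescribed moments: surjectivity of ε -/

section moments

/-- The function `w ^ n h(w)`, `h` the radial bump function. -/
noncomputable def radialPow (n : ℤ) (w : ℂ) : ℂ := w ^ n * (radialBump w : ℂ)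

theorem integrable_radialPow (n : ℤ) : Integrable (radialPow n) := by
  refine Continuous.integrable_of_hasCompactSupport ?_ ?_
  · rw [continuous_iff_continuousAt]
    intro w
    by_cases hw : w = 0
    · subst hw
      refine (continuousAt_const (y := (0 : ℂ))).congr ?_
      have h1 : ∀ᶠ u : ℂ in 𝓝 0, ‖u‖ < 1 / 2 :=
        (tendsto_norm_zero (E := ℂ)).eventually (gt_mem_nhds (by norm_num))
      filter_upwards [h1] with u hu
      simp [radialPow, radialBump_eq_zero_of_ge hu.le]
    · exact (continuousAt_zpow₀ w n (Or.inl hw)).mul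
        (Complex.continuous_ofReal.comp contDiff_radialBump.continuous).continuousAt
  · refine HasCompactSupport.intro (isCompact_closedBall (0 : ℂ) 2) fun w hw => ?_
    rw [radialPow, radialBump_eq_zero_of_le, Complex.ofReal_zero, mul_zero]
    simpa using (not_le.1 (by simpa using hw)).le

theorem integral_radialPow_zero : ∫ w, radialPow 0 w = (∫ w, radialBump w : ℝ) := by
  simp only [radialPow, zpow_zero, one_mul]
  exact integral_ofReal

/-- Rotation by exp(iπ/n) preserves the measure and the radial bump but changes the sign of w^n. -/
theorem integral_radialPow {n : ℤ} (hn : n ≠ 0) : ∫ w, radialPow n w = 0 := by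
  let ζ : Circle := Circle.exp (Real.pi / n)
  have hζ : (ζ : ℂ) ^ n = -1 := by
    rw [Circle.coe_exp, ← Complex.exp_int_mul, ← Complex.exp_pi_mul_I]
    congr 1
    push_cast
    have : (n : ℂ) ≠ 0 := by exact_mod_cast hn
    field_simp
  have h1 : ∫ w, radialPow n (rotation ζ w) = ∫ w, radialPow n w :=
    (rotation ζ).measurePreserving.integral_comp
      (rotation ζ).toHomeomorph.measurableEmbedding _
  have h2 : ∀ w, radialPow n (rotation ζ w) = -radialPow n w := fun w => by
    rw [rotation_apply, radialPow, mul_zpow, hζ, radialBump, norm_mul, Circle.norm_coe, one_mul,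
      radialPow, radialBump]
    ring
  simp only [h2, integral_neg] at h1
  exact self_eq_neg.1 h1.symm

theorem integral_norm_radialPow_le (n : ℕ) :
    ∫ w, ‖radialPow n w‖ ≤ 2 ^ n * ∫ w, radialBump w := by
  have h0 : Integrable radialBump := by
    have := (integrable_radialPow 0).norm
    refine this.congr (Filter.Eventually.of_forall fun w => ?_)
    simp [radialPow, abs_of_nonneg (radialBump_nonneg w)]
  rw [← integral_const_mul]
  refine integral_mono (integrable_radialPow n).norm (h0.const_mul _) fun w => ?_
  rw [radialPow, norm_mul, Complex.norm_real, Real.norm_of_nonneg (radialBump_nonneg w),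
    zpow_natCast, norm_pow]
  rcases le_total 2 ‖w‖ with h | h
  · rw [radialBump_eq_zero_of_le h, mul_zero, mul_zero]
  · exact mul_le_mul_of_nonneg_right (pow_le_pow_left₀ (norm_nonneg _) h _) (radialBump_nonneg w)

theorem integral_comp_div {E : Type} [NormedAddCommGroup E] [NormedSpace ℝ E] (G : ℂ → E) {ε : ℝ}
    (hε : 0 < ε) : ∫ ξ : ℂ, G (ξ / ε) = ε ^ 2 • ∫ w, G w := by
  have := Measure.integral_comp_inv_smul_of_nonneg (volume : Measure ℂ) G hε.le
  rw [Complex.finrank_real_complex] at this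
  rw [← this]
  refine integral_congr_ae (Filter.Eventually.of_forall fun ξ => ?_)
  simp [div_eq_inv_mul]

theorem integrable_comp_div {G : ℂ → ℂ} (hG : Integrable G) {ε : ℝ} (hε : 0 < ε) :
    Integrable fun ξ : ℂ => G (ξ / ε) := by
  refine (hG.comp_smul (inv_ne_zero hε.ne')).congr (Filter.Eventually.of_forall fun ξ => ?_)
  simp [div_eq_inv_mul]

/-- The factor ‖ξ/ε‖² absorbs ξ⁻¹ ξ̄⁻¹, so that a pure power of ξ times the bump at scale ε remains.
-/
theorem zpow_mul_radialTerm (j : ℤ) (k : ℕ) {ε : ℝ} (hε : 0 < ε) (ξ : ℂ) :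
    ξ ^ (-j - 1) * (((starRingEnd ℂ) ξ)⁻¹ * radialTerm k ε ξ) =
      (ε : ℂ) ^ ((k : ℤ) - j - 2) * radialPow (k - j) (ξ / ε) := by
  have hc : (ε : ℂ) ≠ 0 := by exact_mod_cast hε.ne'
  by_cases hξ : ξ = 0
  · subst hξ
    rw [radialTerm_eq_zero_of_ge hε (by rw [norm_zero]; positivity), radialPow, zero_div,
      radialBump_eq_zero_of_ge (by rw [norm_zero]; norm_num)]
    simp
  · have hs : (starRingEnd ℂ) ξ ≠ 0 := by simpa using hξ
    have h2 : ((‖ξ / ε‖ ^ 2 : ℝ) : ℂ) = ξ * (starRingEnd ℂ) ξ / ε ^ 2 := by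
      rw [norm_div, div_pow, Complex.norm_real, Real.norm_of_nonneg hε.le, Complex.mul_conj']
      push_cast; rfl
    rw [radialTerm, radialPow, Complex.ofReal_mul, h2, div_zpow, zpow_sub₀ hc, zpow_sub₀ hξ,
      zpow_sub₀ hξ, zpow_neg, zpow_natCast]
    have a1 := zpow_ne_zero j hξ
    have a2 := zpow_ne_zero j hc
    field_simp

variable {V : Opens CmodZ}

/-- By rotation invariance the k-th term of the Borel sum has only its k-th moment nonzero, and the
scale ε_k cancels from it. Once sum and integral are exchanged, each moment of index k ≥ 0 involves
a single coefficient. -/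
theorem exists_moments_nat (q : ℕ → Holo V) : ∃ f : Cflat V, ∀ j : ℤ,
    (∀ k : ℕ, j = k → moments V f j = q k) ∧ (j < 0 → moments V f j = 0) := by
  set c : ℝ := ∫ w, radialBump w with hc
  have hc0 : 0 < c := integral_radialBump_pos
  -- The constant π/c undoes the factor π⁻¹ of the moments and the mass c of the bump.
  let a : ℕ → ℂ → ℂ := fun k s => ((Real.pi / c : ℝ) : ℂ) * extZero (q k).1 s
  have ha : ∀ k, DifferentiableOn ℂ (a k) (fiber V) := fun k =>
    (mem_Holo.1 (q k).2).const_mul _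
  obtain ⟨ε, hε, hεa, hb, hh⟩ := exists_borelSum (isOpen_fiber V) ha
  have key : ∀ (j : ℤ) (s : fiber V), HasSum
      (fun k : ℕ => a k s * ((ε k : ℂ) ^ ((k : ℤ) - j) * ∫ w, radialPow (k - j) w))
      (Cflat.mom (mulTbarInv (Cflat.ofBiflatOn _ hb hh)) (-j - 1) s) := by
    intro j s
    let F : ℕ → ℂ → ℂ := fun k ξ =>
      a k s * ((ε k : ℂ) ^ ((k : ℤ) - j - 2) * radialPow (k - j) (ξ / ε k))
    have hF : ∀ k, Integrable (F k) := fun k =>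
      ((integrable_comp_div (integrable_radialPow _) (hε k).1).const_mul _).const_mul _
    have hn : ∀ k, ∫ ξ, ‖F k ξ‖ =
        ‖a k s‖ * (ε k ^ ((k : ℤ) - j) * ∫ w, ‖radialPow (k - j) w‖) := fun k => by
      simp only [F, norm_mul]
      rw [integral_const_mul, integral_const_mul,
        integral_comp_div (fun w => ‖radialPow (k - j) w‖) (hε k).1, norm_zpow, Complex.norm_real,
        Real.norm_of_nonneg (hε k).1.le, smul_eq_mul, zpow_sub₀ (hε k).1.ne' _ 2, zpow_ofNat]
      have := (hε k).1.ne'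
      field_simp
    have hi : ∀ k, ∫ ξ, F k ξ =
        a k s * ((ε k : ℂ) ^ ((k : ℤ) - j) * ∫ w, radialPow (k - j) w) := fun k => by
      have h0 : (ε k : ℂ) ≠ 0 := by exact_mod_cast (hε k).1.ne'
      simp only [F]
      rw [integral_const_mul, integral_const_mul, integral_comp_div (radialPow (k - j)) (hε k).1,
        zpow_sub₀ h0 _ 2, zpow_ofNat, Complex.real_smul]
      push_cast
      field_simp
    have hS : Summable fun k => ∫ ξ, ‖F k ξ‖ := by
      have hg : Summable fun k : ℕ => 2 * c * (1 / 2 : ℝ) ^ k := summable_geometric_two.mul_left _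
      refine Summable.of_norm_bounded_eventually_nat hg ?_
      filter_upwards [hεa s s.2, Filter.eventually_ge_atTop 1,
        Filter.eventually_ge_atTop (j.toNat + 1)] with k h1 h2 h3
      -- Of the n + 1 = k - j factors ε_k, one is spent on ‖a_k(s)‖ ε_k ≤ 2^(-k); the others are
      -- bounded by (2 ε_k)^n ≤ 1.
      obtain ⟨n, hn1⟩ : ∃ n : ℕ, (k : ℤ) - j = (n + 1 : ℕ) := ⟨((k : ℤ) - j - 1).toNat, by omega⟩
      rw [Real.norm_of_nonneg (integral_nonneg fun _ => norm_nonneg _), hn, hn1, zpow_natCast]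
      have e1 : 2 * ε k ≤ 1 := by
        have : ((1 / 2 : ℝ)) ^ k ≤ 1 / 2 := pow_le_of_le_one (by norm_num) (by norm_num) (by omega)
        linarith [(hε k).2]
      have e0 := (hε k).1
      calc ‖a k s‖ * (ε k ^ (n + 1) * ∫ w, ‖radialPow (n + 1 : ℕ) w‖)
          ≤ ‖a k s‖ * (ε k ^ (n + 1) * (2 ^ (n + 1) * c)) := by
            gcongr; exact integral_norm_radialPow_le _
        _ = 2 * c * (‖a k s‖ * ε k) * (2 * ε k) ^ n := by rw [mul_pow]; ring
        _ ≤ 2 * c * (1 / 2) ^ k * 1 := by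
            gcongr
            exact pow_le_one₀ (by positivity) e1
        _ = _ := mul_one _
    have := hasSum_integral_of_summable_integral_norm hF hS
    simp only [hi] at this
    suffices e : Cflat.mom (mulTbarInv (Cflat.ofBiflatOn _ hb hh)) (-j - 1) s =
        ∫ ξ, ∑' k, F k ξ by rw [e]; exact this
    refine integral_congr_ae (Filter.Eventually.of_forall fun ξ => ?_)
    simp only
    rw [fn_mulTbarInv _ _ s.2, Cflat.fn_ofBiflatOn _ _ _ s.2, ← tsum_mul_left, ← tsum_mul_left]
    refine tsum_congr fun k => ?_
    simp only [F]
    rw [← zpow_mul_radialTerm j k (hε k).1, borelTerm]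
    ring
  refine ⟨Cflat.ofBiflatOn _ hb hh, fun j => ⟨?_, fun hj => ?_⟩⟩
  · rintro k rfl
    refine holo_ext fun s => ?_
    rw [moments_apply, ← (key k s).tsum_eq, tsum_eq_single k, sub_self, zpow_zero, one_mul,
      integral_radialPow_zero]
    · simp only [a]
      rw [extZero_coe, ← hc]
      have h1 : (c : ℂ) ≠ 0 := by exact_mod_cast hc0.ne'
      have h2 : (Real.pi : ℂ) ≠ 0 := by exact_mod_cast Real.pi_ne_zero
      push_cast
      field_simp
    · intro i hi
      rw [integral_radialPow (by omega), mul_zero, mul_zero]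
  · refine holo_ext fun s => ?_
    rw [moments_apply, ← (key j s).tsum_eq]
    have : ∀ k : ℕ, ∫ w, radialPow (k - j) w = 0 := fun k => integral_radialPow (by omega)
    simp [this]

/-- The inversion `t ↦ 1/t` on sections of `𝒞^{<0}`. -/
noncomputable def Cflat.compInv (f : Cflat V) : Cflat V :=
  Cflat.ofBiflatOn (fun p => Cflat.fn f (p.1⁻¹, p.2)) (Cflat.biflatOn f).comp_inv
    fun t => Cflat.holo f t⁻¹

/-- The measure |ξ|⁻² dx dy on ℂ^* is invariant under inversion, which exchanges ξ^(-k) and ξ^k. -/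
theorem moments_compInv (f : Cflat V) (k : ℤ) :
    moments V (Cflat.compInv f) k = moments V f (-k) := by
  refine holo_ext fun s => ?_
  rw [moments_apply, moments_apply, Cflat.mom, Cflat.mom, integral_inv]
  congr 1
  refine integral_congr_ae (Filter.Eventually.of_forall fun ξ => ?_)
  simp only
  rw [fn_mulTbarInv _ _ s.2, fn_mulTbarInv _ _ s.2, Cflat.compInv, Cflat.fn_ofBiflatOn _ _ _ s.2,
    inv_inv]
  by_cases hξ : ξ = 0
  · subst hξ
    simp
  · have hs : (starRingEnd ℂ) ξ ≠ 0 := by simpa using hξ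
    have h4 : ((‖ξ‖ ^ 4 : ℝ) : ℂ) = (ξ * (starRingEnd ℂ) ξ) ^ 2 := by
      rw [Complex.mul_conj']; push_cast; ring
    rw [Complex.real_smul, Complex.ofReal_inv, h4, map_inv₀, inv_inv, inv_zpow', zpow_sub₀ hξ,
      neg_sub, neg_neg, sub_neg_eq_add, zpow_add₀ hξ]
    have a1 := zpow_ne_zero k hξ
    field_simp

theorem moments_surjective : Function.Surjective (moments V) := by
  intro q
  obtain ⟨f, hf⟩ := exists_moments_nat fun k : ℕ => q k
  -- Inversion moves the indices of g to k ≤ 0 and t⁻¹ shifts them to k ≤ -1, so g's index j becomes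
  -- -j - 1 and does not meet those of f.
  obtain ⟨g, hg⟩ := exists_moments_nat fun k : ℕ => q (-k - 1)
  refine ⟨f + mulTinv V (Cflat.compInv g), funext fun k => ?_⟩
  rw [map_add, Pi.add_apply, moments_mulTinv, moments_compInv]
  rcases le_or_gt 0 k with hk | hk
  · rw [(hf k).1 k.toNat (by omega), (hg _).2 (by omega), add_zero]
    congr 1; omega
  · rw [(hf k).2 hk, (hg _).1 (-(k + 1)).toNat (by omega), zero_add]
    congr 1; omega

theorem epsilon_surjective : Function.Surjective (epsilon V) := fun q => by
  obtain ⟨f, hf⟩ := moments_surjective (tailsEquiv V q)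
  exact ⟨f, (tailsEquiv V).injective ((tailsEquiv_epsilon f).trans hf)⟩

theorem resTails_refl (q : Tails V) : resTails le_rfl q = q := (tailsEquiv V).symm_apply_apply q

end moments

end MellinDA

theorem mainTheorem4 :
    ∃ (d m : ∀ V : TopologicalSpace.Opens CmodZ, Cflat V →ₗ[TorusD] Cflat V)
      (ε : ∀ V : TopologicalSpace.Opens CmodZ, Cflat V →ₗ[TorusD] Tails V),
      (∀ V (f : Cflat V), d V f = dtbar V f) ∧
      (∀ V (f : Cflat V), m V f = mulTbar V f) ∧
      (∀ V (f : Cflat V) (t : ℂ) (s : fiber V), t ≠ 0 →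
        MeasureTheory.Integrable (convIntegrand f t s)) ∧
      (∀ V (f : Cflat V), ∃ a b : LaurentSeries (Holo V),
        IsExpansionAtZero (convK f) a ∧ IsExpansionAtInf (convK f) b ∧
        ε V f = (Submodule.Quotient.mk a, Submodule.Quotient.mk b)) ∧
      (∀ (V W : TopologicalSpace.Opens CmodZ) (h : W ≤ V) (f : Cflat V), ε W (resC h f) = resTails h (ε V f)) ∧
      IsExactSequence (fun V => m V ∘ₗ d V) ε ∧
      IsExactSequence d (fun V => ε V ∘ₗ m V) ∧
      (∀ V (f : Cflat V), ε V (tauC V (TorusD.tinv • f) - f) =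
        tauTails V (TorusD.tinv • ε V f) - ε V f) ∧
      (∀ V (f : Cflat V), ε V (m V (tauC V (TorusD.tinv • f) - f)) =
        tauTails V (TorusD.tinv • ε V (m V f)) - ε V (m V f)) := by
  refine ⟨dtbarD, mulTbarD, epsilon, fun _ _ => rfl, fun _ _ => rfl,
    fun V f t s ht => integrable_convIntegrand f ht s,
    fun V f => ⟨expansionZero f, expansionInf f, isExpansionAtZero f, isExpansionAtInf f,
      epsilon_eq f⟩, fun V W h f => epsilon_res h f,
    ⟨fun V => mulTbarD_injective.comp dtbarD_injective, fun V f => epsilon_eq_zero_iff_exists f,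
      -- Surjectivity holds on sections over V itself, so W = V is taken.
      fun V q x hx => ⟨V, le_rfl, hx, ?_⟩⟩,
    ⟨fun V => dtbarD_injective, fun V f => (epsilon_eq_zero_iff_exists (mulTbar V f)).trans ?_,
      fun V q x hx => ⟨V, le_rfl, hx, ?_⟩⟩, fun V f => ?_, fun V f => ?_⟩
  · rw [resTails_refl]
    exact epsilon_surjective q
  -- Exactness for ε ∘ t̄ is that for ε applied to t̄ f, after cancelling the injective factor t̄.
  · exact exists_congr fun g => ⟨fun h => mulTbarD_injective h, fun h => congrArg (mulTbar V) h⟩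
  · rw [resTails_refl]
    obtain ⟨f, hf⟩ := epsilon_surjective q
    exact ⟨mulTbarInv f, (congrArg (epsilon V) (mulTbar_mulTbarInv f)).trans hf⟩
  · rw [map_sub, epsilon_tau]
  · rw [map_sub, map_sub, ← epsilon_tau, ← (mulTbarD V).map_smul]
    rfl
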